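/- Two balls of masses $m$ (lower) and $1-m$ (upper), $m\in(1/2,1)$, fall on a vertical half-line under unit gravity, colliding elastically with each other and with the floor, at total energy $1/2$. When the lower ball leaves the floor, let $h$ be its energy and $z$ the velocity of the upper ball minus that of the lower one. The phase space is $$\mathcal M_1=\Bigl\{(h,z): 0<h<\tfrac12,\ \tfrac12-h>\tfrac{1-m}{2}\bigl(z+\sqrt{2h/m}\bigr)^2,\ m(1-m)z\bigl(2\sqrt{2h/m}-z\bigr)-2h+m<0\Bigr\}$$ (the lower ball is on the floor and will meet the upper one before it returns to the floor). Put $F=1-h/m+\alpha z^2$, $\alpha=1-3m+2m^2$, and $T_n(h,z)=(mF,\,-(2n+2)\sqrt{2F}-z)$, the configuration after the $(n+1)$-st bump of the lower ball on the floor following the collision. Let $R_n$ be the set of $(h,z)\in\mathcal M_1$ for which $n\ge 0$ is the least integer with $T_n(h,z)\in\mathcal M_1$, and let $T=T_n$ on $R_n$ be the first return map. A point $P\in\mathcal M_1$ has symbolic representation $x\in\mathbb N^{\mathbb Z}$ if its two-sided $T$-orbit is defined and $T^iP\in R_{x_i}$ for all $i\in\mathbb Z$. Let $k\ge 1$ and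 $\frac{1+k}{2+k}\le m<\frac{2k^2+2k-1}{2k^2+2k}$. Then every sequence $x\in\{k-1,k\}^{\mathbb Z}$ is the symbolic representation of exactly one point $\pi(x)\in\mathcal M_1$. The map $\pi$ is a homeomorphism onto its image and $T\circ\pi=\pi\circ\sigma$ with the left shift $\sigma$, so that $T$ contains a full shift on the symbols $k-1$ and $k$. Moreover, each $\pi(x)$ has a local stable and a local unstable manifold that fully cross the phase space, namely $$W^s=\{Q:\ T^iQ\in R_{x_i}\ \forall i\ge 0\},\qquad W^u=\{Q:\ T^{i}Q\in R_{x_i}\ \forall i<0\}.$$ That is: $W^s$ (resp. $W^u$) is a simple $C^1$ curve in $\mathcal M_1$ through $\pi(x)$ whose tangent vectors $(dh,dz)$ satisfy $dh\,dz>0$ (resp. $dh\,dz<0$); the distance of $T^nQ$ and $T^n\pi(x)$ tends to $0$ exponentially as $n\to\infty$ (resp. $n\to-\infty$), uniformly in $Q$ on the curve; and the curve has one endpoint on the left part $\{h<mF\}$ and the other on the right part $\{h>mF\}$ of $\partial\mathcal M_1$ (the two parts are exchanged by the time reversal $(h,z)\mapsto(mF,z)$). -/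

import Mathlib

open Set Filter Topology

namespace FallingBalls

noncomputable section

/-!
Two balls of masses `m` (lower) and `1 - m` (upper) fall on a vertical half-line under unit
gravity, with elastic collisions and total energy `1/2`. A configuration in which the lower ball
is on the floor and about to leave it is described by `(h, z)`: `h` is the energy of the lower
ball, and `z` is the velocity of the upper ball minus that of the lower ball.
-/

/-- The phase space: the lower ball leaves the floor, the upper ball has positive height, and the
balls collide before the lower one returns to the floor. -/
def phaseSpace (m : ℝ) : Set (ℝ × ℝ) :=
  {p | (0 < p.1 ∧ p.1 < 1 / 2) ∧
    1 / 2 - p.1 > 1 / 2 * (1 - m) * (p.2 + √(2 * p.1 / m)) ^ 2 ∧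
    m * (1 - m) * p.2 * (2 * √(2 * p.1 / m) - p.2) - 2 * p.1 + m < 0}

/-- The constant `α = 1 - 3m + 2m²`. -/
def alpha (m : ℝ) : ℝ := 1 - 3 * m + 2 * m ^ 2

/-- `F = 1 - h/m + α z²`. The energy of the lower ball after the collision is `m F`, so that it
hits the floor with speed `√(2F)`. -/
def F (m : ℝ) (p : ℝ × ℝ) : ℝ := 1 - p.1 / m + alpha m * p.2 ^ 2

/-- The configuration right after the lower ball has hit the floor for the `(n+1)`-st time since
the collision of the two balls (provided that they have not collided again): the collision turns
`z` into `-z`, and each bump of the lower ball on the floor decreases it by `2√(2F)`. -/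
def floorHit (m : ℝ) (n : ℕ) (p : ℝ × ℝ) : ℝ × ℝ :=
  (m * F m p, -(2 * n + 2) * √(2 * F m p) - p.2)

/-- The set `R_n` of the points whose trajectory bumps on the floor exactly `n` times before the
bump at which it returns to the phase space for the first time. -/
def R (m : ℝ) (n : ℕ) : Set (ℝ × ℝ) :=
  {p | p ∈ phaseSpace m ∧ floorHit m n p ∈ phaseSpace m ∧
    ∀ j < n, floorHit m j p ∉ phaseSpace m}

/-- The number of bumps before the return (`0` for the points that do not return). -/
def bumps (m : ℝ) (p : ℝ × ℝ) : ℕ := sInf {n | floorHit m n p ∈ phaseSpace m}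

/-- The first return map `T`. It is only meaningful on the union of the sets `R m n`, where
`T = floorHit m n` on `R m n`, see `T_eq`. -/
def T (m : ℝ) (p : ℝ × ℝ) : ℝ × ℝ := floorHit m (bumps m p) p

theorem bumps_eq {m : ℝ} {n : ℕ} {p : ℝ × ℝ} (hp : p ∈ R m n) : bumps m p = n := by
  obtain ⟨-, h1, h2⟩ := hp
  refine le_antisymm (Nat.sInf_le h1) ?_
  by_contra hlt
  exact h2 _ (not_le.mp hlt) (Nat.sInf_mem (s := {n | floorHit m n p ∈ phaseSpace m}) ⟨n, h1⟩)

theorem T_eq {m : ℝ} {n : ℕ} {p : ℝ × ℝ} (hp : p ∈ R m n) :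
    T m p = (m * F m p, -(2 * n + 2) * √(2 * F m p) - p.2) := by
  rw [T, bumps_eq hp, floorHit]

/-- `P` has the two-sided symbolic representation `x`: its full orbit is defined and
`T^i P ∈ R_{x i}` for every integer `i`. -/
def HasItinerary (m : ℝ) (P : ℝ × ℝ) (x : ℤ → ℕ) : Prop :=
  ∃ o : ℤ → ℝ × ℝ, o 0 = P ∧ ∀ i, o i ∈ R m (x i) ∧ T m (o i) = o (i + 1)

/-- `o 0 = P, o 1 = T⁻¹ P, o 2 = T⁻² P, …`. -/
def IsBackwardOrbit (m : ℝ) (o : ℕ → ℝ × ℝ) (P : ℝ × ℝ) : Prop :=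
  o 0 = P ∧ ∀ i, (∃ n, o (i + 1) ∈ R m n) ∧ T m (o (i + 1)) = o i

/-- The points `Q` with `T^i Q ∈ R_{x i}` for all `i ≥ 0`. -/
def futureSet (m : ℝ) (x : ℤ → ℕ) : Set (ℝ × ℝ) :=
  {Q | ∀ i : ℕ, (T m)^[i] Q ∈ R m (x i)}

/-- The points `Q` with `T^i Q ∈ R_{x i}` for all `i < 0`. -/
def pastSet (m : ℝ) (x : ℤ → ℕ) : Set (ℝ × ℝ) :=
  {Q | ∃ o, IsBackwardOrbit m o Q ∧ ∀ i : ℕ, o (i + 1) ∈ R m (x (-((i : ℤ) + 1)))}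

/-- The directions of stable curves: these curves are increasing in the coordinates `(h, z)`. -/
def stableCone : Set (ℝ × ℝ) := {v | 0 < v.1 * v.2}

/-- The directions of unstable curves: these curves are decreasing in the coordinates `(h, z)`. -/
def unstableCone : Set (ℝ × ℝ) := {v | v.1 * v.2 < 0}

/-- The left part of the boundary of the phase space. The time reversal involution
`(h, z) ↦ (m F, z)` exchanges it with the right part; its fixed points on the boundary are the
top `(m/2, 0)` and the bottom `((1-m)/2, -1/√(m(1-m)))`, which separate the two parts. -/
def leftSide (m : ℝ) : Set (ℝ × ℝ) := {p | p ∈ frontier (phaseSpace m) ∧ p.1 < m * F m p}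

/-- The right part of the boundary of the phase space. -/
def rightSide (m : ℝ) : Set (ℝ × ℝ) := {p | p ∈ frontier (phaseSpace m) ∧ m * F m p < p.1}

/-- `W` is a simple `C¹` curve in the phase space with tangent directions in `cone`, which fully
crosses the phase space: it stretches from the left side of the boundary to the right side. -/
def FullyCrosses (m : ℝ) (cone W : Set (ℝ × ℝ)) : Prop :=
  W ⊆ phaseSpace m ∧
  ∃ γ : ℝ → ℝ × ℝ, ContinuousOn γ (Icc 0 1) ∧ InjOn γ (Icc 0 1) ∧
    ContDiffOn ℝ 1 γ (Ioo 0 1) ∧ (∀ t ∈ Ioo (0 : ℝ) 1, deriv γ t ∈ cone) ∧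
    γ '' Ioo 0 1 = W ∧ γ 0 ∈ leftSide m ∧ γ 1 ∈ rightSide m

/-- `W` contains `P`, and the forward orbits of the points of `W` are defined and
approach that of `P` exponentially fast, without being separated from it by a discontinuity
of `T`. -/
def ForwardAsymptotic (m : ℝ) (P : ℝ × ℝ) (W : Set (ℝ × ℝ)) : Prop :=
  P ∈ W ∧ ∃ C lam : ℝ, 0 < lam ∧ lam < 1 ∧ ∀ Q ∈ W, ∀ n : ℕ,
    (∃ l, (T m)^[n] P ∈ R m l ∧ (T m)^[n] Q ∈ R m l) ∧
    dist ((T m)^[n] Q) ((T m)^[n] P) ≤ C * lam ^ n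

/-- The same for the backward orbits. -/
def BackwardAsymptotic (m : ℝ) (P : ℝ × ℝ) (W : Set (ℝ × ℝ)) : Prop :=
  P ∈ W ∧ ∃ C lam : ℝ, 0 < lam ∧ lam < 1 ∧ ∀ Q ∈ W, ∃ oP oQ : ℕ → ℝ × ℝ,
    IsBackwardOrbit m oP P ∧ IsBackwardOrbit m oQ Q ∧ ∀ n : ℕ,
      (∃ l, oP (n + 1) ∈ R m l ∧ oQ (n + 1) ∈ R m l) ∧
      dist (oQ n) (oP n) ≤ C * lam ^ n

/-- `W` is a local stable manifold of `P` that fully crosses the phase space. -/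
def IsCrossingStableManifold (m : ℝ) (P : ℝ × ℝ) (W : Set (ℝ × ℝ)) : Prop :=
  ForwardAsymptotic m P W ∧ FullyCrosses m stableCone W

/-- `W` is a local unstable manifold of `P` that fully crosses the phase space. -/
def IsCrossingUnstableManifold (m : ℝ) (P : ℝ × ℝ) (W : Set (ℝ × ℝ)) : Prop :=
  BackwardAsymptotic m P W ∧ FullyCrosses m unstableCone W

/-- The space of two-sided sequences of the symbols `k - 1` and `k` (for `k ≥ 1`), with the
product topology. -/
abbrev Symb (k : ℕ) : Type := ℤ → ({k - 1, k} : Set ℕ)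

/-- The left shift. -/
def shift {k : ℕ} (x : Symb k) : Symb k := fun i => x (i + 1)

end

end FallingBalls

/-! ### Triangle coordinates and a priori bounds -/

namespace FallingBalls

/-! Put `c = 2(1 - m)`, `v = √(2h/m)`, `w = √(2F)` and `u = -c z`. The phase space becomes the set
of nondegenerate triangles with sides `v, w, u` satisfying `c(v² + w²) + (1 - c)u² = 2c`
(`mem_phaseSpace_iff`). The return after `n` bumps becomes `(v, w, u) ↦ (w, v', u')` with `u + u' =
2cNw` and `N = n + 1`, and time reversal exchanges `v` and `w`. The range of `m` turns into `c(k +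
2) ≤ 2` and `1 < ck(k + 1)`, and the symbols into `N ∈ [k, k + 1]`.

Hyperbolicity is proved for differences of two points, without derivatives. If `Δv` and `Δu` have
the same sign, energy gives `Δw` the opposite sign, and the link `u + u' = 2cNw` makes `|Δu'|`
exceed `|Δu|` (`unstable_step`); two steps expand by a fixed factor (`IsOrbit.two_step_le`). Since
`u` is bounded, points with a common future never differ by an unstable vector
(`IsOrbit.eq_of_unstable`). So they form a graph over the `v`-axis and approach each other
exponentially (`IsOrbit.stable_contraction`).

Existence is topological: a path in the closed phase space from above the strips to below them
contains a piece whose image is again such a path (`exists_image_path`). Iteration, time reversal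
and compactness show that the set with a given closed future reaches both sides of the boundary and
is a graph over a whole interval (`exists_graph`). Its secant slopes with respect to `v²` are
convergent continued fractions depending continuously on both points, so the graph is `C¹`
(`IsOrbit.slope_eq`, `graph_smooth`).

Compactness only yields orbits in the closed phase space; height comparisons and the two parameter
inequalities show that they stay off the boundary where this is needed (`IsOrbit.strict_succ`,
`IsOrbit.strict_of_two_sided`). Unstable manifolds are the time reversals of stable ones. A past
curve meets a future curve because paths cross (`exists_two_sided`), and only once because the cones
are opposite (`two_sided_unique`). -/

/-- The speeds `v`, `w` of the lower ball at two consecutive bumps on the floor and the rescaled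
relative velocity `u` of the balls at the collision in between. These numbers are the sides of a
(possibly degenerate) triangle, and are normalized by the total energy. -/
structure Config (c v w u : ℝ) : Prop where
  energy : c * (v ^ 2 + w ^ 2) + (1 - c) * u ^ 2 = 2 * c
  u_le : u ≤ v + w
  v_le : v ≤ w + u
  w_le : w ≤ v + u

/-- The range of the parameters in the rescaled coordinates. -/
structure Adm (c k : ℝ) : Prop where
  c_pos : 0 < c
  one_le : 1 ≤ k
  le_two : c * (k + 2) ≤ 2
  one_lt : 1 < c * k * (k + 1)

namespace Adm

variable {c k : ℝ}

theorem c_le (h : Adm c k) : c ≤ 2 / 3 := by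
  have := h.c_pos
  nlinarith [h.le_two, h.one_le]

end Adm

namespace Config

variable {c k v w u N v' u' : ℝ}

theorem v_nonneg (h : Config c v w u) : 0 ≤ v := by linarith [h.u_le, h.w_le]
theorem w_nonneg (h : Config c v w u) : 0 ≤ w := by linarith [h.u_le, h.v_le]
theorem u_nonneg (h : Config c v w u) : 0 ≤ u := by linarith [h.v_le, h.w_le]

theorem symm (h : Config c v w u) : Config c w v u :=
  ⟨by linarith [h.energy], by linarith [h.u_le], h.w_le, h.v_le⟩

theorem sub_sq_le (h : Config c v w u) : (w - u) ^ 2 ≤ v ^ 2 :=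
  sq_le_sq' (by linarith [h.u_le]) (by linarith [h.w_le])

theorem sub_sq_le' (h : Config c v w u) : (v - u) ^ 2 ≤ w ^ 2 :=
  h.symm.sub_sq_le

theorem le_add_sq (h : Config c v w u) : v ^ 2 ≤ (w + u) ^ 2 :=
  pow_le_pow_left₀ h.v_nonneg h.v_le 2

theorem le_add_sq' (h : Config c v w u) : w ^ 2 ≤ (v + u) ^ 2 :=
  h.symm.le_add_sq

theorem v_le_bound (a : Adm c k) (h : Config c v w u) : v ≤ 3 / 2 := by
  have h1 := h.energy
  have h2 := a.c_pos
  have h3 := a.c_le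
  have : v ^ 2 ≤ 2 := by
    by_contra hv
    nlinarith [sq_nonneg w, mul_nonneg (by linarith : 0 ≤ 1 - c) (sq_nonneg u)]
  nlinarith

theorem w_le_bound (a : Adm c k) (h : Config c v w u) : w ≤ 3 / 2 := h.symm.v_le_bound a

theorem u_le_bound (a : Adm c k) (h : Config c v w u) : u ≤ 3 := by
  linarith [h.v_le_bound a, h.w_le_bound a, h.u_le]

end Config

/-! The four expressions for the height of the upper ball at two consecutive bumps. -/

section Links

variable {c k v w u N v' u' : ℝ}

/-- Between two collisions the upper ball falls freely while the lower one bumps `N` times with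
speed `w`. Up to a common factor, `v² - (w - u)²` and `v'² - (w - u')²` are the heights of the upper
ball at the first and the last of these bumps. With `w + u` and `w + u'` they become the heights at
the virtual bumps one before the first and one after the last. All lie on one parabola in the number
of bumps, and the triangle inequalities make the real heights nonnegative and the virtual ones
nonpositive. -/
theorem height_eq₁ (hc : c ≠ 0) (h : c * (v ^ 2 + w ^ 2) + (1 - c) * u ^ 2 = 2 * c)
    (h' : c * (w ^ 2 + v' ^ 2) + (1 - c) * u' ^ 2 = 2 * c) (hu : u + u' = 2 * c * N * w) :
    v' ^ 2 - (w - u') ^ 2 = v ^ 2 - (w - u) ^ 2 + 4 * (N - 1) * w * (u - c * N * w) := by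
  obtain rfl : u' = 2 * c * N * w - u := by linarith
  apply mul_left_cancel₀ hc
  linear_combination h' - h

theorem height_eq₂ (hc : c ≠ 0) (h : c * (v ^ 2 + w ^ 2) + (1 - c) * u ^ 2 = 2 * c)
    (h' : c * (w ^ 2 + v' ^ 2) + (1 - c) * u' ^ 2 = 2 * c) (hu : u + u' = 2 * c * N * w) :
    v' ^ 2 - (w - u') ^ 2 = v ^ 2 - (w + u) ^ 2 + 4 * N * w * (u - c * (N - 1) * w) := by
  linear_combination height_eq₁ hc h h' hu

theorem height_eq₃ (hc : c ≠ 0) (h : c * (v ^ 2 + w ^ 2) + (1 - c) * u ^ 2 = 2 * c)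
    (h' : c * (w ^ 2 + v' ^ 2) + (1 - c) * u' ^ 2 = 2 * c) (hu : u + u' = 2 * c * N * w) :
    v' ^ 2 - (w + u') ^ 2 = v ^ 2 - (w - u) ^ 2 + 4 * N * w * (u - c * (N + 1) * w) := by
  linear_combination height_eq₁ hc h h' hu - 4 * w * hu

theorem height_eq₄ (hc : c ≠ 0) (h : c * (v ^ 2 + w ^ 2) + (1 - c) * u ^ 2 = 2 * c)
    (h' : c * (w ^ 2 + v' ^ 2) + (1 - c) * u' ^ 2 = 2 * c) (hu : u + u' = 2 * c * N * w) :
    v' ^ 2 - (w + u') ^ 2 = v ^ 2 - (w + u) ^ 2 + 4 * (N + 1) * w * (u - c * N * w) := by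
  linear_combination height_eq₁ hc h h' hu - 4 * w * hu

theorem Config.mid_pos (a : Adm c k) (h : Config c v w u) (h' : Config c w v' u')
    (hu : u + u' = 2 * c * N * w) : 0 < w := by
  rcases h.w_nonneg.lt_or_eq with hw | rfl
  · exact hw
  · have h1 := h.u_nonneg
    have h2 := h'.u_nonneg
    have h3 : u = 0 := by linarith
    have h4 : v = 0 := by linarith [h.v_le, h.v_nonneg]
    have h5 := h.energy
    rw [h3, h4] at h5
    linarith [a.c_pos]

/-- The height is nonnegative at the first bump and nonpositive at the virtual bump after the last.
-/
theorem Config.u_le_mul (a : Adm c k) (h : Config c v w u) (h' : Config c w v' u')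
    (hu : u + u' = 2 * c * N * w) (hN : 0 < N) : u ≤ c * (N + 1) * w := by
  have hw := h.mid_pos a h' hu
  have h1 := height_eq₃ a.c_pos.ne' h.energy h'.energy hu
  have h2 := h.sub_sq_le
  have h3 := h'.le_add_sq'
  have h4 : 4 * N * w * (u - c * (N + 1) * w) ≤ 0 := by linarith
  have h5 : 0 < 4 * N * w := by positivity
  linarith [nonpos_of_mul_nonpos_right h4 h5]

theorem Config.u_le_two_mul (a : Adm c k) (h : Config c v w u) (h' : Config c w v' u')
    (hu : u + u' = 2 * c * N * w) (hN : k ≤ N) (hN' : N ≤ k + 1) : u ≤ 2 * w := by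
  have h1 := h.u_le_mul a h' hu (by linarith [a.one_le])
  have h2 := h.w_nonneg
  have h3 : c * (N + 1) ≤ 2 := by nlinarith [a.le_two, a.c_pos]
  nlinarith

/-- Both other sides are bounded by multiples of `w`, namely `u ≤ 2w` and `v ≤ 3w`, so the energy
normalization keeps `w` away from `0`. -/
theorem Config.mid_ge (a : Adm c k) (h : Config c v w u) (h' : Config c w v' u')
    (hu : u + u' = 2 * c * N * w) (hN : k ≤ N) (hN' : N ≤ k + 1) : c / 5 ≤ w := by
  have h1 := h.u_le_two_mul a h' hu hN hN'
  have h2 := h.w_nonneg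
  have h3 : v ≤ 3 * w := by linarith [h.v_le]
  have h4 := h.energy
  have hc := a.c_pos
  have hc' := a.c_le
  have h5 : v ^ 2 ≤ 9 * w ^ 2 := by nlinarith [h.v_nonneg]
  have h6 : u ^ 2 ≤ 4 * w ^ 2 := by nlinarith [h.u_nonneg]
  have h7 : c / 5 ≤ w ^ 2 := by nlinarith [sq_nonneg w]
  by_contra hlt
  nlinarith

end Links

/-! ### Forward orbits with prescribed symbols -/

/-- A forward orbit in the closure of the phase space, in the rescaled coordinates. -/
structure IsOrbit (c : ℝ) (N v u : ℕ → ℝ) : Prop where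
  config : ∀ i, Config c (v i) (v (i + 1)) (u i)
  link : ∀ i, u i + u (i + 1) = 2 * c * N i * v (i + 1)

/-- The sequences of symbols (increased by one). -/
def IsWord (k : ℝ) (N : ℕ → ℝ) : Prop := ∀ i, k ≤ N i ∧ N i ≤ k + 1

theorem IsWord.shift {k : ℝ} {N : ℕ → ℝ} (h : IsWord k N) : IsWord k fun i => N (i + 1) :=
  fun i => h (i + 1)

namespace IsOrbit

variable {c k : ℝ} {N v u v' u' : ℕ → ℝ}

theorem shift (h : IsOrbit c N v u) :
    IsOrbit c (fun i => N (i + 1)) (fun i => v (i + 1)) fun i => u (i + 1) :=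
  ⟨fun i => h.config (i + 1), fun i => h.link (i + 1)⟩

theorem v_ge (a : Adm c k) (hN : IsWord k N) (h : IsOrbit c N v u) (i : ℕ) :
    c / 5 ≤ v (i + 1) :=
  (h.config i).mid_ge a (h.config (i + 1)) (h.link i) (hN i).1 (hN i).2

theorem v_pos (a : Adm c k) (h : IsOrbit c N v u) (i : ℕ) : 0 < v (i + 1) :=
  (h.config i).mid_pos a (h.config (i + 1)) (h.link i)

theorem u_le_two_mul (a : Adm c k) (hN : IsWord k N) (h : IsOrbit c N v u) (i : ℕ) :
    u i ≤ 2 * v (i + 1) :=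
  (h.config i).u_le_two_mul a (h.config (i + 1)) (h.link i) (hN i).1 (hN i).2

end IsOrbit

/-! ### Hyperbolicity -/

/-- The expansion rate of two iterates of the map. -/
noncomputable def rate (c : ℝ) : ℝ := 2 / 3 * (1 - c) * (4 * c ^ 2 / 5)

theorem Adm.rate_pos {c k : ℝ} (a : Adm c k) : 0 < rate c := by
  have h1 := a.c_pos
  have h2 : 0 < 1 - c := by linarith [a.c_le]
  unfold rate
  positivity

section Step

variable {c k v w u N u₂ v' w' u' u₂' : ℝ}

/-- When `v` and `u` decrease, energy makes `w` increase, so `2cNw - u` increases for two reasons.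
The gain from `w` is quantified by `w + w' ≤ 3`, which yields the factor `2/3`. -/
theorem unstable_step (a : Adm c k) (h : Config c v w u) (h' : Config c v' w' u')
    (hu : u + u₂ = 2 * c * N * w) (hu' : u' + u₂' = 2 * c * N * w') (hN : 1 ≤ N)
    (hw : 0 < w) (hdv : v' ≤ v) (hdu : u' ≤ u) :
    w ≤ w' ∧ (u - u') * (1 + 2 / 3 * (1 - c) * (u + u')) ≤ u₂' - u₂ := by
  have hc := a.c_pos
  have hc' : 0 ≤ 1 - c := by linarith [a.c_le]
  have e : c * ((w' - w) * (w + w')) =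
      c * ((v + v') * (v - v')) + (1 - c) * ((u + u') * (u - u')) := by
    linear_combination h'.energy - h.energy
  have h1 : 0 ≤ (v + v') * (v - v') :=
    mul_nonneg (add_nonneg h.v_nonneg h'.v_nonneg) (sub_nonneg.2 hdv)
  have h2 : 0 ≤ (u + u') * (u - u') :=
    mul_nonneg (add_nonneg h.u_nonneg h'.u_nonneg) (sub_nonneg.2 hdu)
  have hW : 0 < w + w' := by linarith [h'.w_nonneg]
  have hww : w ≤ w' := by
    have : 0 ≤ c * ((w' - w) * (w + w')) := by rw [e]; positivity
    have := nonneg_of_mul_nonneg_right this hc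
    linarith [nonneg_of_mul_nonneg_left this hW]
  refine ⟨hww, ?_⟩
  have h3 : (w' - w) * (w + w') ≤ (w' - w) * 3 := by
    have := h.w_le_bound a
    have := h'.w_le_bound a
    exact mul_le_mul_of_nonneg_left (by linarith) (by linarith)
  have h4 : (1 - c) * ((u + u') * (u - u')) ≤ c * ((w' - w) * 3) := by nlinarith
  have h5 : c * (w' - w) ≤ c * (w' - w) * N :=
    le_mul_of_one_le_right (mul_nonneg hc.le (by linarith)) hN
  nlinarith

theorem unstable_step_abs (a : Adm c k) (h : Config c v w u) (h' : Config c v' w' u')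
    (hu : u + u₂ = 2 * c * N * w) (hu' : u' + u₂' = 2 * c * N * w') (hN : 1 ≤ N)
    (hw : 0 < w) (hw' : 0 < w') (hd : 0 ≤ (v - v') * (u - u')) :
    0 ≤ (w - w') * (u₂ - u₂') ∧
      |u - u'| * (1 + 2 / 3 * (1 - c) * (u + u')) ≤ |u₂ - u₂'| := by
  have hc' : 0 ≤ 1 - c := by linarith [a.c_le]
  have h0 := h.u_nonneg
  have h0' := h'.u_nonneg
  rcases mul_nonneg_iff.1 hd with ⟨h1, h2⟩ | ⟨h1, h2⟩
  · obtain ⟨h3, h4⟩ := unstable_step a h h' hu hu' hN hw (by linarith) (by linarith)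
    have h5 : 0 ≤ (u - u') * (1 + 2 / 3 * (1 - c) * (u + u')) := by positivity
    refine ⟨mul_nonneg_of_nonpos_of_nonpos (by linarith) (by linarith), ?_⟩
    rw [abs_of_nonneg h2, abs_of_nonpos (by linarith : u₂ - u₂' ≤ 0)]
    linarith
  · obtain ⟨h3, h4⟩ := unstable_step a h' h hu' hu hN hw' (by linarith) (by linarith)
    have h5 : 0 ≤ (u' - u) * (1 + 2 / 3 * (1 - c) * (u' + u)) :=
      mul_nonneg (by linarith) (by positivity)
    refine ⟨mul_nonneg (by linarith) (by linarith), ?_⟩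
    rw [abs_of_nonpos h2, abs_of_nonneg (by linarith : 0 ≤ u₂ - u₂')]
    linarith

/-- Exchanging `v` and `w` reverses time and reduces this to `unstable_step`. -/
theorem stable_step (a : Adm c k) (h : Config c v w u) (h' : Config c v' w' u')
    (hu : u₂ + u = 2 * c * N * v) (hu' : u₂' + u' = 2 * c * N * v') (hN : 1 ≤ N)
    (hv : 0 < v) (hdw : w' ≤ w) (hdu : u' ≤ u) :
    (u - u') * (1 + 2 / 3 * (1 - c) * (u + u')) ≤ u₂' - u₂ :=
  (unstable_step a h.symm h'.symm (by linarith) (by linarith) hN hv hdw hdu).2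

end Step

namespace IsOrbit

variable {c k : ℝ} {N v u v' u' : ℕ → ℝ}

theorem add_ge (a : Adm c k) (hN : IsWord k N) (h : IsOrbit c N v u) (i : ℕ) :
    2 * c ^ 2 / 5 ≤ u i + u (i + 1) := by
  rw [h.link i]
  have h1 := h.v_ge a hN i
  have h2 := (hN i).1
  have h3 := a.one_le
  have h4 := a.c_pos
  have h5 : c / 5 ≤ N i * v (i + 1) := by nlinarith
  nlinarith

/-- A single `u` may be small, but by `add_ge` two consecutive ones sum to at least `2c²/5` along
each orbit; this is why the expansion is measured over two steps. -/
theorem two_step_le (a : Adm c k) (hN : IsWord k N) (h : IsOrbit c N v u)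
    (h' : IsOrbit c N v' u') (i : ℕ) : 1 + rate c ≤
      (1 + 2 / 3 * (1 - c) * (u i + u' i)) * (1 + 2 / 3 * (1 - c) * (u (i + 1) + u' (i + 1))) := by
  have h1 := h.add_ge a hN i
  have h2 := h'.add_ge a hN i
  have h3 : 0 ≤ 1 - c := by linarith [a.c_le]
  have h4 : 0 ≤ (1 - c) * (u i + u' i) :=
    mul_nonneg h3 (add_nonneg (h.config i).u_nonneg (h'.config i).u_nonneg)
  have h5 : 0 ≤ (1 - c) * (u (i + 1) + u' (i + 1)) :=
    mul_nonneg h3 (add_nonneg (h.config _).u_nonneg (h'.config _).u_nonneg)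
  have h6 : (1 - c) * (4 * c ^ 2 / 5) ≤ (1 - c) * (u i + u' i + (u (i + 1) + u' (i + 1))) :=
    mul_le_mul_of_nonneg_left (by linarith) h3
  unfold rate
  nlinarith [mul_nonneg h4 h5]

/-- Two points with the same future whose difference is in the unstable cone coincide. -/
theorem eq_of_unstable (a : Adm c k) (hN : IsWord k N) (h : IsOrbit c N v u)
    (h' : IsOrbit c N v' u') (hd : 0 ≤ (v 0 - v' 0) * (u 0 - u' 0)) :
    v 0 = v' 0 ∧ u 0 = u' 0 := by
  have step : ∀ i, 0 ≤ (v i - v' i) * (u i - u' i) →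
      0 ≤ (v (i + 1) - v' (i + 1)) * (u (i + 1) - u' (i + 1)) ∧
      |u i - u' i| * (1 + 2 / 3 * (1 - c) * (u i + u' i)) ≤ |u (i + 1) - u' (i + 1)| :=
    fun i => unstable_step_abs a (h.config i) (h'.config i) (h.link i) (h'.link i)
      (a.one_le.trans (hN i).1) (h.v_pos a i) (h'.v_pos a i)
  have cone : ∀ i, 0 ≤ (v i - v' i) * (u i - u' i) := by
    intro i
    induction i with
    | zero => exact hd
    | succ i ih => exact (step i ih).1
  -- Otherwise `|Δu|` would grow geometrically along every second index, although both values lie in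
  -- `[0, 3]`.
  have zero : ∀ i, u i = u' i := by
    intro i
    by_contra hne
    have hpos : 0 < |u i - u' i| := abs_pos.2 (sub_ne_zero.2 hne)
    have grow : ∀ j, (1 + rate c) ^ j * |u i - u' i| ≤ |u (i + 2 * j) - u' (i + 2 * j)| := by
      intro j
      induction j with
      | zero => simp
      | succ j ih =>
        have s1 := (step _ (cone (i + 2 * j))).2
        have s2 := (step _ (cone (i + 2 * j + 1))).2
        have s3 := two_step_le a hN h h' (i + 2 * j)
        have h3 : 0 ≤ 1 - c := by linarith [a.c_le]
        have h5 : 0 ≤ 1 + 2 / 3 * (1 - c) * (u (i + 2 * j + 1) + u' (i + 2 * j + 1)) := by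
          have := (h.config (i + 2 * j + 1)).u_nonneg
          have := (h'.config (i + 2 * j + 1)).u_nonneg
          positivity
        have hr := a.rate_pos
        calc (1 + rate c) ^ (j + 1) * |u i - u' i|
            = (1 + rate c) ^ j * |u i - u' i| * (1 + rate c) := by ring
          _ ≤ |u (i + 2 * j) - u' (i + 2 * j)| * (1 + rate c) :=
              mul_le_mul_of_nonneg_right ih (by linarith)
          _ ≤ |u (i + 2 * j) - u' (i + 2 * j)| * _ :=
              mul_le_mul_of_nonneg_left s3 (abs_nonneg _)
          _ ≤ |u (i + 2 * j + 1) - u' (i + 2 * j + 1)| * _ := by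
              rw [← mul_assoc]
              exact mul_le_mul_of_nonneg_right s1 h5
          _ ≤ _ := s2
    obtain ⟨j, hj⟩ := pow_unbounded_of_one_lt (3 / |u i - u' i|)
      (by linarith [a.rate_pos] : 1 < 1 + rate c)
    have h1 := grow j
    rw [div_lt_iff₀ hpos] at hj
    have h2 : |u (i + 2 * j) - u' (i + 2 * j)| ≤ 3 := by
      have := (h.config (i + 2 * j)).u_nonneg
      have := (h'.config (i + 2 * j)).u_nonneg
      have := (h.config (i + 2 * j)).u_le_bound a
      have := (h'.config (i + 2 * j)).u_le_bound a
      exact abs_le.2 ⟨by linarith, by linarith⟩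
    linarith
  refine ⟨?_, zero 0⟩
  have l1 := h.link 0
  have l2 := h'.link 0
  have hv1 : v 1 = v' 1 := by
    have : 2 * c * N 0 * v 1 = 2 * c * N 0 * v' 1 := by
      rw [← l1, ← l2, zero 0, zero 1]
    have hc := a.c_pos
    have hN0 : 0 < N 0 := by linarith [a.one_le, (hN 0).1]
    exact mul_left_cancel₀ (by positivity) this
  have e1 := (h.config 0).energy
  have e2 := (h'.config 0).energy
  simp only [zero_add] at e1 e2
  rw [hv1, zero 0] at e1
  have : c * v 0 ^ 2 = c * v' 0 ^ 2 := by linarith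
  have := mul_left_cancel₀ a.c_pos.ne' this
  exact (pow_left_inj₀ (h.config 0).v_nonneg (h'.config 0).v_nonneg two_ne_zero).1 this

theorem stable_cone (a : Adm c k) (hN : IsWord k N) (h : IsOrbit c N v u)
    (h' : IsOrbit c N v' u') (hne : v 0 ≠ v' 0 ∨ u 0 ≠ u' 0) :
    (v 0 - v' 0) * (u 0 - u' 0) < 0 := by
  by_contra hd
  have := eq_of_unstable a hN h h' (not_lt.1 hd)
  tauto

/-- The map is injective: the link recovers `u` from the image, and then energy recovers `v ≥ 0`. -/
theorem ne_succ (a : Adm c k) (h : IsOrbit c N v u)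
    (h' : IsOrbit c N v' u') (i : ℕ) (hne : v i ≠ v' i ∨ u i ≠ u' i) :
    v (i + 1) ≠ v' (i + 1) ∨ u (i + 1) ≠ u' (i + 1) := by
  by_contra hcon
  push Not at hcon
  have hu : u i = u' i := by
    have := h.link i
    have := h'.link i
    rw [← hcon.1] at this
    linarith [hcon.2]
  have e1 := (h.config i).energy
  have e2 := (h'.config i).energy
  rw [hcon.1, hu] at e1
  have : c * v i ^ 2 = c * v' i ^ 2 := by linarith
  have := mul_left_cancel₀ a.c_pos.ne' this
  have := (pow_left_inj₀ (h.config i).v_nonneg (h'.config i).v_nonneg two_ne_zero).1 this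
  tauto

theorem stable_cone_all (a : Adm c k) (hN : IsWord k N) (h : IsOrbit c N v u)
    (h' : IsOrbit c N v' u') (hne : v 0 ≠ v' 0 ∨ u 0 ≠ u' 0) (i : ℕ) :
    (v i - v' i) * (u i - u' i) < 0 := by
  have key : v i ≠ v' i ∨ u i ≠ u' i := by
    induction i with
    | zero => exact hne
    | succ i ih => exact ne_succ a h h' i ih
  clear hne
  induction i generalizing N v u v' u' with
  | zero => exact stable_cone a hN h h' key
  | succ i ih =>
    exact ih hN.shift h.shift h'.shift key

/-- In the stable cone, the differences of `v (i + 1)` and `u i` have the same sign. -/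
theorem stable_cone_succ (a : Adm c k) (hN : IsWord k N) (h : IsOrbit c N v u)
    (h' : IsOrbit c N v' u') (hne : v 0 ≠ v' 0 ∨ u 0 ≠ u' 0) (i : ℕ) :
    0 < (v (i + 1) - v' (i + 1)) * (u i - u' i) := by
  have h1 := stable_cone_all a hN h h' hne (i + 1)
  have h2 : u i - u' i = 2 * c * N i * (v (i + 1) - v' (i + 1)) - (u (i + 1) - u' (i + 1)) := by
    linarith [h.link i, h'.link i]
  rw [h2]
  have hc := a.c_pos
  have hN0 : 0 < N i := by linarith [a.one_le, (hN i).1]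
  have : 0 ≤ 2 * c * N i * (v (i + 1) - v' (i + 1)) ^ 2 := by positivity
  nlinarith

/-- In the stable cone `Δu i` and `Δv (i + 1)` have the same sign and `Δu (i + 1)` the opposite one.
Seen backwards this is an unstable vector, which gives the first bound; for the second, the two
terms of `Δu i = 2cNΔv (i + 1) - Δu (i + 1)` do not cancel. -/
theorem stable_contraction (a : Adm c k) (hN : IsWord k N) (h : IsOrbit c N v u)
    (h' : IsOrbit c N v' u') (hne : v 0 ≠ v' 0 ∨ u 0 ≠ u' 0) (i : ℕ) :
    |u (i + 1) - u' (i + 1)| * (1 + 2 / 3 * (1 - c) * (u (i + 1) + u' (i + 1))) ≤ |u i - u' i| ∧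
      2 * c * |v (i + 1) - v' (i + 1)| ≤ |u i - u' i| := by
  have c1 := stable_cone_all a hN h h' hne (i + 1)
  have c2 := stable_cone_succ a hN h h' hne (i + 1)
  have c0 := stable_cone_succ a hN h h' hne i
  have l1 := h.link i
  have l2 := h'.link i
  have n1 : 1 ≤ N i := a.one_le.trans (hN i).1
  have hc := a.c_pos
  rcases mul_pos_iff.1 c2 with ⟨s1, s2⟩ | ⟨s1, s2⟩
  · have s3 : v (i + 1) - v' (i + 1) < 0 := by nlinarith
    have s4 : u i - u' i < 0 := by nlinarith
    have := stable_step a (h.config (i + 1)) (h'.config (i + 1)) l1 l2 n1 (h.v_pos a i)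
      (by linarith) (by linarith)
    rw [abs_of_pos s2, abs_of_neg s3, abs_of_neg s4]
    exact ⟨by linarith, by nlinarith⟩
  · have s3 : 0 < v (i + 1) - v' (i + 1) := by nlinarith
    have s4 : 0 < u i - u' i := by nlinarith
    have := stable_step a (h'.config (i + 1)) (h.config (i + 1)) l2 l1 n1 (h'.v_pos a i)
      (by linarith) (by linarith)
    rw [abs_of_neg s2, abs_of_pos s3, abs_of_pos s4]
    exact ⟨by linarith, by nlinarith⟩

theorem stable_two_step (a : Adm c k) (hN : IsWord k N) (h : IsOrbit c N v u)
    (h' : IsOrbit c N v' u') (hne : v 0 ≠ v' 0 ∨ u 0 ≠ u' 0) (i : ℕ) :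
    |u (i + 2) - u' (i + 2)| * (1 + rate c) ≤ |u i - u' i| := by
  have s1 := (stable_contraction a hN h h' hne i).1
  have s2 := (stable_contraction a hN h h' hne (i + 1)).1
  have s3 := two_step_le a hN h h' (i + 1)
  have h3 : 0 ≤ 1 - c := by linarith [a.c_le]
  have h5 : 0 ≤ 1 + 2 / 3 * (1 - c) * (u (i + 1) + u' (i + 1)) := by
    have := (h.config (i + 1)).u_nonneg
    have := (h'.config (i + 1)).u_nonneg
    positivity
  calc |u (i + 2) - u' (i + 2)| * (1 + rate c)
      ≤ |u (i + 2) - u' (i + 2)| * _ := mul_le_mul_of_nonneg_left s3 (abs_nonneg _)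
    _ = |u (i + 2) - u' (i + 2)| * (1 + 2 / 3 * (1 - c) * (u (i + 1 + 1) + u' (i + 1 + 1))) *
        (1 + 2 / 3 * (1 - c) * (u (i + 1) + u' (i + 1))) := by ring
    _ ≤ |u (i + 1) - u' (i + 1)| * _ := mul_le_mul_of_nonneg_right s2 h5
    _ ≤ _ := s1

end IsOrbit

/-- The contraction rate. -/
noncomputable def contr (c : ℝ) : ℝ := √(1 / (1 + rate c))

section

variable {c k : ℝ}

theorem Adm.contr_sq (a : Adm c k) : contr c ^ 2 * (1 + rate c) = 1 := by
  have := a.rate_pos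
  rw [contr, Real.sq_sqrt (by positivity)]
  field_simp

theorem Adm.contr_pos (a : Adm c k) : 0 < contr c := by
  have := a.rate_pos
  rw [contr]
  positivity

theorem Adm.contr_lt_one (a : Adm c k) : contr c < 1 := by
  have h1 := a.contr_sq
  have h2 := a.rate_pos
  have h3 := a.contr_pos
  by_contra h
  nlinarith [mul_pos h3 h3]

/-- A sequence that contracts at two steps contracts geometrically. -/
theorem Adm.le_geometric (a : Adm c k) {x : ℕ → ℝ} {B : ℝ} (h0 : x 0 ≤ B) (h1 : x 1 ≤ B)
    (hB : 0 ≤ B) (hx : ∀ i, x (i + 2) * (1 + rate c) ≤ x i) (n : ℕ) :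
    x n ≤ B / contr c * contr c ^ n := by
  have hp := a.contr_pos
  have hl := a.contr_lt_one
  -- The division by `contr c` makes the bound valid at the odd starting index `1` as well.
  have key : ∀ n, x n ≤ B / contr c * contr c ^ n ∧
      x (n + 1) ≤ B / contr c * contr c ^ (n + 1) := by
    intro n
    induction n with
    | zero =>
      refine ⟨?_, ?_⟩
      · rw [pow_zero, mul_one]
        exact h0.trans (le_div_self hB hp hl.le)
      · rw [zero_add, pow_one, div_mul_cancel₀ _ hp.ne']
        exact h1
    | succ n ih =>
      refine ⟨ih.2, ?_⟩
      have h2 := hx n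
      have h3 := a.contr_sq
      calc x (n + 2) = x (n + 2) * (1 + rate c) * contr c ^ 2 := by
            rw [mul_assoc, mul_comm (1 + rate c), h3, mul_one]
        _ ≤ B / contr c * contr c ^ n * contr c ^ 2 :=
            mul_le_mul_of_nonneg_right (h2.trans ih.1) (by positivity)
        _ = _ := by ring
  exact (key n).1

variable {N v u v' u' : ℕ → ℝ}

/-- Points with the same future approach each other exponentially fast. -/
theorem IsOrbit.asymptotic (a : Adm c k) (hN : IsWord k N) (h : IsOrbit c N v u)
    (h' : IsOrbit c N v' u') (n : ℕ) :
    |u n - u' n| ≤ 3 / contr c * contr c ^ n ∧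
      |v (n + 1) - v' (n + 1)| ≤ 3 / contr c / (2 * c) * contr c ^ n := by
  have hp := a.contr_pos
  have hc := a.c_pos
  by_cases hne : v 0 ≠ v' 0 ∨ u 0 ≠ u' 0
  · have b : ∀ i, |u i - u' i| ≤ 3 := fun i => by
      have := (h.config i).u_nonneg
      have := (h'.config i).u_nonneg
      have := (h.config i).u_le_bound a
      have := (h'.config i).u_le_bound a
      exact abs_le.2 ⟨by linarith, by linarith⟩
    have h1 := a.le_geometric (x := fun i => |u i - u' i|) (b 0) (b 1) (by norm_num)
      (stable_two_step a hN h h' hne) n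
    refine ⟨h1, ?_⟩
    have h2 := (stable_contraction a hN h h' hne n).2
    rw [div_mul_eq_mul_div, le_div_iff₀ (by positivity)]
    linarith
  · push Not at hne
    have key : ∀ i, v i = v' i ∧ u i = u' i ∧ v (i + 1) = v' (i + 1) := by
      have aux : ∀ i, v i = v' i → u i = u' i → v (i + 1) = v' (i + 1) := fun i h1 h2 => by
        have e1 := (h.config i).energy
        have e2 := (h'.config i).energy
        rw [h1, h2] at e1
        have : c * v (i + 1) ^ 2 = c * v' (i + 1) ^ 2 := by linarith
        have := mul_left_cancel₀ a.c_pos.ne' this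
        exact (pow_left_inj₀ (h.config i).w_nonneg (h'.config i).w_nonneg two_ne_zero).1 this
      intro i
      induction i with
      | zero => exact ⟨hne.1, hne.2, aux 0 hne.1 hne.2⟩
      | succ i ih =>
        have l1 := h.link i
        have l2 := h'.link i
        rw [ih.2.2, ih.2.1] at l1
        have : u (i + 1) = u' (i + 1) := by linarith
        exact ⟨ih.2.2, this, aux _ ih.2.2 this⟩
    rw [(key n).2.1, (key n).2.2]
    simp only [sub_self, abs_zero]
    constructor <;> positivity

end

/-! ### Configurations on the boundary -/

section Boundary

variable {c k v w u N v' u' : ℝ}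

/-- The image of a configuration on the left upper side is above the stable strips. -/
theorem Config.u_le_of_left_image (a : Adm c k) (h : Config c v w u) (h' : Config c w v' u')
    (hu : u + u' = 2 * c * N * w) (hN : k ≤ N) (hN' : N ≤ k + 1) (hl : v' = w + u') :
    u' < c * k * v' := by
  have hw := h.mid_pos a h' hu
  -- Here the virtual height after the last bump is zero and the one before the first is
  -- nonpositive, which forces `u ≥ cNw`, hence `u' ≤ cNw`.
  have h1 := height_eq₄ a.c_pos.ne' h.energy h'.energy hu
  have h2 := h.le_add_sq
  have h3 : v' ^ 2 - (w + u') ^ 2 = 0 := by rw [hl]; ring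
  have h5 : 0 < 4 * (N + 1) * w := by
    have : 0 < N + 1 := by linarith [a.one_le]
    positivity
  have h4 : 0 ≤ 4 * (N + 1) * w * (u - c * N * w) := by linarith
  have h6 := nonneg_of_mul_nonneg_right h4 h5
  have hc := a.c_pos
  have h7 : u' ≤ c * (k + 1) * w := by nlinarith [mul_pos hc hw]
  -- If `ck < 1`, the claim reduces to `(k + 1)(1 - ck) < k`, which is `1 < ck(k + 1)`.
  have ho := a.one_lt
  rw [hl]
  by_cases hck : 1 ≤ c * k
  · nlinarith [h'.u_nonneg]
  · have : u' * (1 - c * k) ≤ c * (k + 1) * w * (1 - c * k) :=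
      mul_le_mul_of_nonneg_right h7 (by linarith)
    have : c * (k + 1) * w * (1 - c * k) < c * k * w := by
      have : c * (k + 1) * (1 - c * k) < c * k := by nlinarith
      nlinarith
    nlinarith

/-- The image of a configuration on the right side is not in a stable strip. -/
theorem Config.right_image_false (a : Adm c k) (h : Config c v w u) (h' : Config c w v' u')
    (hu : u + u' = 2 * c * N * w) (hN : k ≤ N) (hN' : N ≤ k + 1) (hr : w ^ 2 = (v - u) ^ 2)
    (hlow : c * k * v ≤ u) (hup : u < 2 * v) (hv : 0 < v) : False := by
  have hw := h.mid_pos a h' hu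
  have hc := a.c_pos
  -- If `w = v - u`, the virtual heights give `u ≤ c(k + 1)(v - u)`, which together with `ckv ≤ u`
  -- contradicts `1 < ck(k + 1)`. If `w = u - v`, then `u ≤ 2w` contradicts `u < 2v`.
  rcases le_total u v with huv | huv
  · have e : w = v - u :=
      (pow_left_inj₀ h.w_nonneg (by linarith) two_ne_zero).1 hr
    have h1 := height_eq₄ a.c_pos.ne' h.energy h'.energy hu
    have h2 : v ^ 2 - (w + u) ^ 2 = 0 := by rw [e]; ring
    have h3 := h'.le_add_sq'
    have h5 : 0 < 4 * (N + 1) * w := by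
      have : 0 < N + 1 := by linarith [a.one_le]
      positivity
    have h4 : 4 * (N + 1) * w * (u - c * N * w) ≤ 0 := by linarith
    have h6 := nonpos_of_mul_nonpos_right h4 h5
    have h7 : u ≤ c * (k + 1) * w := by nlinarith [mul_pos hc hw]
    rw [e] at h7
    have ho := a.one_lt
    have hk := a.one_le
    have : c * k * v * (1 + c * (k + 1)) ≤ u * (1 + c * (k + 1)) :=
      mul_le_mul_of_nonneg_right hlow (by positivity)
    have : 0 < c * v * (c * k * (k + 1) - 1) := mul_pos (mul_pos hc hv) (by linarith)
    linarith
  · have e : w = u - v := by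
      refine (pow_left_inj₀ h.w_nonneg (by linarith) two_ne_zero).1 ?_
      rw [hr]; ring
    have := h.u_le_two_mul a h' hu hN hN'
    linarith

end Boundary

/-! ### Orbits and the boundary -/

namespace IsOrbit

variable {c k : ℝ} {N v u v' u' : ℕ → ℝ}

/-- The image of a configuration which is not on the right side is not on the right side. -/
theorem not_right_of_low (a : Adm c k) (hN : IsWord k N) (h : IsOrbit c N v u)
    (hr : v 2 ^ 2 = (v 1 - u 1) ^ 2) (hup : u 0 ≤ c * N 0 * v 1)
    (hlow : c * (N 0 - 1) * v 1 < u 0) : False := by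
  have hc := a.c_pos
  have l : u 0 + u 1 = 2 * c * N 0 * v 1 := h.link 0
  have hv : 0 < v 1 := h.v_pos a 0
  have hcv := mul_pos hc hv
  refine (h.config 1).right_image_false a (h.config 2) (h.link 1) (hN 1).1 (hN 1).2 hr ?_ ?_ hv
  · nlinarith [(hN 0).1]
  · have : c * (N 0 + 1) * v 1 ≤ c * (k + 2) * v 1 := by nlinarith [(hN 0).2]
    nlinarith [a.le_two]

theorem height₁ (a : Adm c k) (h : IsOrbit c N v u) (i : ℕ) :
    v (i + 2) ^ 2 - (v (i + 1) - u (i + 1)) ^ 2 = v i ^ 2 - (v (i + 1) - u i) ^ 2 +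
      4 * (N i - 1) * v (i + 1) * (u i - c * N i * v (i + 1)) :=
  height_eq₁ a.c_pos.ne' (h.config i).energy (h.config (i + 1)).energy (h.link i)

theorem height₂ (a : Adm c k) (h : IsOrbit c N v u) (i : ℕ) :
    v (i + 2) ^ 2 - (v (i + 1) - u (i + 1)) ^ 2 = v i ^ 2 - (v (i + 1) + u i) ^ 2 +
      4 * N i * v (i + 1) * (u i - c * (N i - 1) * v (i + 1)) :=
  height_eq₂ a.c_pos.ne' (h.config i).energy (h.config (i + 1)).energy (h.link i)

/-- The images of points with a regular future are not on the left upper side. -/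
theorem lt_of_succ (a : Adm c k) (hN : IsWord k N) (h : IsOrbit c N v u) :
    v 2 < v 1 + u 1 := by
  refine lt_of_le_of_ne (h.config 1).w_le fun hl => ?_
  have hlow : u 1 < c * k * v 2 :=
    (h.config 0).u_le_of_left_image a (h.config 1) (h.link 0) (hN 0).1 (hN 0).2 hl
  have hv : 0 < v 2 := h.v_pos a 1
  have hc := a.c_pos
  have hcv := mul_pos hc hv
  have e : v 3 ^ 2 - (v 2 - u 2) ^ 2 = _ := h.height₁ a 1
  have h1 : v 1 ^ 2 - (v 2 - u 1) ^ 2 = 0 := by rw [hl]; ring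
  have h2 : (v 2 - u 2) ^ 2 ≤ v 3 ^ 2 := (h.config 2).sub_sq_le'
  norm_num [h1] at e
  have h4 : 0 < v 2 * (c * N 1 * v 2 - u 1) := by
    refine mul_pos hv ?_
    nlinarith [(hN 1).1]
  have h6 : 0 ≤ N 1 - 1 := by linarith [(hN 1).1, a.one_le]
  -- The height at the first bump is zero, and would be negative at the last one unless the two
  -- bumps coincide. This leaves only `k = 1`.
  have h5 : N 1 = 1 := by nlinarith
  have l : u 1 + u 2 = 2 * c * N 1 * v 2 := h.link 1
  rw [h5] at e l
  have hk := a.one_le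
  have hk1 : k = 1 := by linarith [(hN 1).1]
  have h8 : v 3 ^ 2 = (v 2 - u 2) ^ 2 := by linarith
  refine (h.config 2).right_image_false a (h.config 3) (h.link 2) (hN 2).1 (hN 2).2 h8 ?_ ?_ hv
  · rw [hk1] at hlow ⊢
    linarith
  · have := (h.config 1).u_nonneg
    nlinarith [a.c_le]

/-- The images of points of the phase space with a regular future belong to the phase space. -/
theorem strict_succ (a : Adm c k) (hN : IsWord k N) (h : IsOrbit c N v u)
    (h1 : u 0 < v 0 + v 1) (h2 : v 0 < v 1 + u 0) (h3 : v 1 < v 0 + u 0) :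
    u 1 < v 1 + v 2 ∧ v 1 < v 2 + u 1 ∧ v 2 < v 1 + u 1 := by
  have hv : 0 < v 1 := h.v_pos a 0
  have hc := a.c_pos
  have hN0 := (hN 0).1
  have hk := a.one_le
  -- Either of the first two equalities to be excluded makes the height at the last bump zero. As it
  -- is positive at the first bump and negative at the virtual one before it, `u 0` lies strictly
  -- between `c(N - 1)w` and at most `cNw`, the range excluded by `not_right_of_low`.
  have key : v 2 ^ 2 ≠ (v 1 - u 1) ^ 2 := by
    intro hr
    have e : v 2 ^ 2 - (v 1 - u 1) ^ 2 = _ := h.height₁ a 0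
    have e' : v 2 ^ 2 - (v 1 - u 1) ^ 2 = _ := h.height₂ a 0
    norm_num [hr] at e e'
    have p1 : (v 1 - u 0) ^ 2 < v 0 ^ 2 := sq_lt_sq' (by linarith) (by linarith)
    have p2 : v 0 ^ 2 < (v 1 + u 0) ^ 2 := pow_lt_pow_left₀ h2 (h.config 0).v_nonneg two_ne_zero
    refine h.not_right_of_low a hN hr ?_ ?_
    · by_contra hcon
      have : 0 ≤ 4 * (N 0 - 1) * v 1 * (u 0 - c * N 0 * v 1) :=
        mul_nonneg (mul_nonneg (by linarith) hv.le) (by linarith)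
      linarith
    · by_contra hcon
      have : 0 ≤ 4 * N 0 * v 1 * (c * (N 0 - 1) * v 1 - u 0) :=
        mul_nonneg (mul_nonneg (by linarith) hv.le) (by linarith)
      linarith
  refine ⟨lt_of_le_of_ne (h.config 1).u_le fun hl => key ?_,
    lt_of_le_of_ne (h.config 1).v_le fun hl => key ?_, h.lt_of_succ a hN⟩
  · rw [hl]; ring
  · rw [hl]; ring

/-- The bottom of the phase space has no regular future. -/
theorem not_bottom (a : Adm c k) (hN : IsWord k N) (h : IsOrbit c N v u)
    (h0 : v 0 = v 1) (hu : u 0 = 2 * v 1) : False := by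
  have hv : 0 < v 1 := h.v_pos a 0
  have hc := a.c_pos
  have hN0 := (hN 0).1
  have hN1 := (hN 0).2
  have hk := a.one_le
  have e : v 2 ^ 2 - (v 1 + u 1) ^ 2 = _ :=
    height_eq₃ a.c_pos.ne' (h.config 0).energy (h.config 1).energy (h.link 0)
  norm_num [h0, hu] at e
  have h1 : v 2 < v 1 + u 1 := h.lt_of_succ a hN
  have h2 : v 2 ^ 2 < (v 1 + u 1) ^ 2 :=
    pow_lt_pow_left₀ h1 (h.config 1).w_nonneg two_ne_zero
  have h3 : c * (N 0 + 1) * v 1 ≤ 2 * v 1 := by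
    have : c * (N 0 + 1) ≤ 2 := by nlinarith [a.le_two]
    nlinarith
  have : 0 ≤ 4 * N 0 * v 1 * (2 * v 1 - c * (N 0 + 1) * v 1) :=
    mul_nonneg (mul_nonneg (by linarith) hv.le) (by linarith)
  nlinarith

/-- The top of the phase space has no regular future. -/
theorem not_top (a : Adm c k) (hN : IsWord k N) (h : IsOrbit c N v u)
    (h0 : v 0 = v 1) (hu : u 0 = 0) : False := by
  have hv : 0 < v 1 := h.v_pos a 0
  have hc := a.c_pos
  have hN0 := (hN 0).1
  have hk := a.one_le
  have l : u 0 + u 1 = 2 * c * N 0 * v 1 := h.link 0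
  have e : v 2 ^ 2 - (v 1 - u 1) ^ 2 = _ := h.height₁ a 0
  have h2 : (v 1 - u 1) ^ 2 ≤ v 2 ^ 2 := (h.config 1).sub_sq_le'
  norm_num [h0, hu] at e
  have hN1 : N 0 = 1 := by
    have p : 0 < v 1 * (c * N 0 * v 1) := by
      have : 0 < N 0 := by linarith
      positivity
    have : 0 ≤ N 0 - 1 := by linarith
    nlinarith
  rw [hN1] at e l
  have hk1 : k = 1 := by linarith
  have hr : v 2 ^ 2 = (v 1 - u 1) ^ 2 := by linarith
  have hcv := mul_pos hc hv
  refine (h.config 1).right_image_false a (h.config 2) (h.link 1) (hN 1).1 (hN 1).2 hr ?_ ?_ hv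
  · rw [hk1]; linarith
  · nlinarith [a.c_le]

/-! ### The sides of the phase space -/

/-- At points of the left upper side with a regular future, the side is less steep than the
stable curves. -/
theorem left_upper_ge (a : Adm c k) (hN : IsWord k N) (h : IsOrbit c N v u)
    (hl : v 1 = v 0 + u 0) : c * N 0 * v 1 ≤ u 0 := by
  have hv : 0 < v 1 := h.v_pos a 0
  have hc := a.c_pos
  have hcv := mul_pos hc hv
  have hN0 := (hN 0).1
  have hk := a.one_le
  have l : u 0 + u 1 = 2 * c * N 0 * v 1 := h.link 0
  have e : v 2 ^ 2 - (v 1 - u 1) ^ 2 = _ := h.height₁ a 0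
  have h1 : v 0 ^ 2 - (v 1 - u 0) ^ 2 = 0 := by rw [hl]; ring
  have h2 : (v 1 - u 1) ^ 2 ≤ v 2 ^ 2 := (h.config 1).sub_sq_le'
  norm_num [h1] at e
  by_contra hcon
  have hN1 : N 0 = 1 := by
    have p : 0 < v 1 * (c * N 0 * v 1 - u 0) := mul_pos hv (by linarith)
    have : 0 ≤ N 0 - 1 := by linarith
    nlinarith
  rw [hN1] at e l hcon
  have hk1 : k = 1 := by linarith
  have hr : v 2 ^ 2 = (v 1 - u 1) ^ 2 := by linarith
  refine (h.config 1).right_image_false a (h.config 2) (h.link 1) (hN 1).1 (hN 1).2 hr ?_ ?_ hv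
  · rw [hk1]; linarith
  · have := (h.config 0).u_nonneg
    nlinarith [a.c_le]

/-- A point on the left side is to the left of the points with the same future. -/
theorem left_le (a : Adm c k) (hN : IsWord k N) (h : IsOrbit c N v u) (h' : IsOrbit c N v' u')
    (hl : v 1 = v 0 + u 0 ∨ u 0 = v 0 + v 1) : v 0 ≤ v' 0 := by
  by_contra! hlt
  have hne : v 0 ≠ v' 0 ∨ u 0 ≠ u' 0 := Or.inl hlt.ne'
  have s1 := stable_cone_all a hN h h' hne 0
  have s2 : 0 < (v 1 - v' 1) * (u 0 - u' 0) := stable_cone_succ a hN h h' hne 0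
  have hdu : u 0 - u' 0 < 0 := by nlinarith
  have hdw : v 1 - v' 1 < 0 := by nlinarith
  have hc := a.c_pos
  have hc1 : 0 < 1 - c := by linarith [a.c_le]
  have e1 : c * (v 0 ^ 2 + v 1 ^ 2) + (1 - c) * u 0 ^ 2 = 2 * c := (h.config 0).energy
  have e2 : c * (v' 0 ^ 2 + v' 1 ^ 2) + (1 - c) * u' 0 ^ 2 = 2 * c := (h'.config 0).energy
  -- The drop in `v` must pay for the increase of both `w` and `u`. On either piece of the side, the
  -- triangle inequality for the second orbit bounds this drop too strongly.
  have e : c * ((v 0 + v' 0) * (v 0 - v' 0)) = c * ((v 1 + v' 1) * (v' 1 - v 1)) +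
      (1 - c) * ((u 0 + u' 0) * (u' 0 - u 0)) := by linear_combination e1 - e2
  have hv : 0 < v 1 := h.v_pos a 0
  have p0 := (h.config 0).v_nonneg
  have p0' := (h'.config 0).v_nonneg
  have q0 := (h.config 0).u_nonneg
  have q0' := (h'.config 0).u_nonneg
  rcases hl with hl | hl
  · have hge := left_upper_ge a hN h hl
    have hk : c * v 0 ≤ (1 - c) * u 0 := by
      have hN0 := (hN 0).1
      have hk := a.one_le
      have hcv := mul_pos hc hv
      nlinarith
    have t1 : v 0 - v' 0 ≤ (u' 0 - u 0) - (v' 1 - v 1) := by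
      have : v' 1 ≤ v' 0 + u' 0 := (h'.config 0).w_le
      linarith
    have t2 : (v 0 + v' 0) * (v 0 - v' 0) < (v 0 + v' 0) * (u' 0 - u 0) :=
      mul_lt_mul_of_pos_left (by linarith) (by linarith)
    have t3 : c * (v 0 + v' 0) ≤ (1 - c) * (u 0 + u' 0) := by nlinarith
    have t4 : c * (v 0 + v' 0) * (u' 0 - u 0) ≤ (1 - c) * (u 0 + u' 0) * (u' 0 - u 0) :=
      mul_le_mul_of_nonneg_right t3 (by linarith)
    have t5 : 0 < c * ((v 1 + v' 1) * (v' 1 - v 1)) :=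
      mul_pos hc (mul_pos (by linarith) (by linarith))
    nlinarith
  · have hle : v 0 ≤ v 1 := by
      have : u 0 ≤ 2 * v 1 := h.u_le_two_mul a hN 0
      linarith
    have t1 : v 0 - v' 0 < v' 1 - v 1 := by
      have : u' 0 ≤ v' 0 + v' 1 := (h'.config 0).u_le
      linarith
    have t2 : (v 0 + v' 0) * (v 0 - v' 0) < (v 1 + v' 1) * (v' 1 - v 1) :=
      mul_lt_mul'' (by linarith) t1 (by linarith) (by linarith)
    have t3 : 0 ≤ (1 - c) * ((u 0 + u' 0) * (u' 0 - u 0)) :=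
      mul_nonneg hc1.le (mul_nonneg (by linarith) (by linarith))
    nlinarith

/-- A point on the right side is to the right of the points with the same future. -/
theorem le_right (a : Adm c k) (hN : IsWord k N) (h : IsOrbit c N v u) (h' : IsOrbit c N v' u')
    (hl : v 0 = v 1 + u 0) : v' 0 ≤ v 0 := by
  by_contra! hlt
  have hne : v 0 ≠ v' 0 ∨ u 0 ≠ u' 0 := Or.inl hlt.ne
  have s1 := stable_cone_all a hN h h' hne 0
  have s2 : 0 < (v 1 - v' 1) * (u 0 - u' 0) := stable_cone_succ a hN h h' hne 0
  have hdu : 0 < u 0 - u' 0 := by nlinarith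
  have hdw : 0 < v 1 - v' 1 := by nlinarith
  have : v' 0 ≤ v' 1 + u' 0 := (h'.config 0).v_le
  linarith

end IsOrbit

/-- One reversed step of the past is prepended to the future. The given point thereby becomes an
image, to which `lt_of_succ` applies. -/
theorem IsOrbit.lt_of_two_sided {c k : ℝ} {N v u N' v' u' : ℕ → ℝ} (a : Adm c k)
    (hN : IsWord k N) (hN' : IsWord k N') (h : IsOrbit c N v u) (h' : IsOrbit c N' v' u')
    (hv : v' 1 = v 0) (hu : u' 0 = u 0) : v 1 < v 0 + u 0 := by
  have o : IsOrbit c (fun i => Nat.casesOn i (N' 0) N) (fun i => Nat.casesOn i (v' 2) v)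
      (fun i => Nat.casesOn i (u' 1) u) := by
    constructor
    · rintro (_ | i)
      · have := (h'.config 1).symm
        rw [hv] at this
        exact this
      · exact h.config i
    · rintro (_ | i)
      · have : u' 0 + u' 1 = 2 * c * N' 0 * v' 1 := h'.link 0
        rw [hv, hu, add_comm] at this
        exact this
      · exact h.link i
  refine o.lt_of_succ a ?_
  rintro (_ | i)
  · exact hN' 0
  · exact hN i

/-- A two-sided orbit in the closure of the phase space does not hit the boundary. -/
theorem IsOrbit.strict_of_two_sided {c k : ℝ} {N v u N' v' u' : ℕ → ℝ} (a : Adm c k)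
    (hN : IsWord k N) (hN' : IsWord k N') (h : IsOrbit c N v u) (h' : IsOrbit c N' v' u')
    (hv : v' 0 = v 1) (hv' : v' 1 = v 0) (hu : u' 0 = u 0) :
    u 0 < v 0 + v 1 ∧ v 0 < v 1 + u 0 ∧ v 1 < v 0 + u 0 := by
  have h1 := h.lt_of_two_sided a hN hN' h' hv' hu
  have h2 := h'.lt_of_two_sided a hN' hN h hv.symm hu.symm
  rw [hv, hv', hu] at h2
  -- The bounds `u ≤ 2w` and, from the reversed orbit, `u ≤ 2v` leave only the bottom vertex when `u
  -- = v + w`.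
  refine ⟨lt_of_le_of_ne (h.config 0).u_le fun hb => ?_, h2, h1⟩
  have hb' : u 0 = v 0 + v 1 := hb
  have h3 : u 0 ≤ 2 * v 1 := h.u_le_two_mul a hN 0
  have h4 : u' 0 ≤ 2 * v' 1 := h'.u_le_two_mul a hN' 0
  rw [hu, hv'] at h4
  exact h.not_bottom a hN (by linarith) (by linarith)

/-! ### The map in the rescaled coordinates -/

/-- The third side of the triangle with the sides `Q.1` and `Q.2`. -/
noncomputable def third (c : ℝ) (Q : ℝ × ℝ) : ℝ := √(2 - Q.1 ^ 2 - (1 - c) / c * Q.2 ^ 2)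

/-- The closure of the phase space. -/
def triangles (c : ℝ) : Set (ℝ × ℝ) := {Q | Config c Q.1 (third c Q) Q.2}

/-- The map that returns to the floor after `N` bumps. -/
noncomputable def step (c N : ℝ) (Q : ℝ × ℝ) : ℝ × ℝ := (third c Q, 2 * c * N * third c Q - Q.2)

/-- The time reversal. -/
noncomputable def reversal (c : ℝ) (Q : ℝ × ℝ) : ℝ × ℝ := (third c Q, Q.2)

/-- The orbit with prescribed numbers of bumps. -/
noncomputable def orb (c : ℝ) (N : ℕ → ℝ) (Q : ℝ × ℝ) : ℕ → ℝ × ℝ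
  | 0 => Q
  | i + 1 => step c (N i) (orb c N Q i)

/-- The points whose first `n` iterates are in the closure of the phase space. -/
def partialFuture (c : ℝ) (N : ℕ → ℝ) (n : ℕ) : Set (ℝ × ℝ) :=
  {Q | ∀ i ≤ n, orb c N Q i ∈ triangles c}

/-- The points all of whose iterates are in the closure of the phase space. -/
def closedFuture (c : ℝ) (N : ℕ → ℝ) : Set (ℝ × ℝ) := {Q | ∀ i, orb c N Q i ∈ triangles c}

variable {c k : ℝ}

theorem continuous_third : Continuous (third c) := by
  unfold third
  fun_prop

theorem continuous_step (N : ℝ) : Continuous (step c N) := by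
  have := continuous_third (c := c)
  unfold step
  fun_prop

theorem continuous_reversal : Continuous (reversal c) := by
  have := continuous_third (c := c)
  unfold reversal
  fun_prop

theorem continuous_orb (N : ℕ → ℝ) (i : ℕ) : Continuous fun Q => orb c N Q i := by
  induction i with
  | zero => exact continuous_id
  | succ i ih => exact (continuous_step (N i)).comp ih

theorem third_eq {v w u : ℝ} (hc : 0 < c) (h : c * (v ^ 2 + w ^ 2) + (1 - c) * u ^ 2 = 2 * c)
    (hw : 0 ≤ w) : third c (v, u) = w := by
  have : 2 - v ^ 2 - (1 - c) / c * u ^ 2 = w ^ 2 := by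
    field_simp
    linarith
  rw [third, this, Real.sqrt_sq hw]

theorem Config.third_eq {v w u : ℝ} (hc : 0 < c) (h : Config c v w u) : third c (v, u) = w :=
  FallingBalls.third_eq hc h.energy h.w_nonneg

theorem Config.mem_triangles {v w u : ℝ} (hc : 0 < c) (h : Config c v w u) :
    (v, u) ∈ triangles c := by
  change Config c v (third c (v, u)) u
  rwa [h.third_eq hc]

/-- The sign hypothesis is essential: the real square root is `0` on negative numbers, where the
energy identity fails. This is why membership in `triangles` includes that identity. -/
theorem third_energy {Q : ℝ × ℝ} (hc : 0 < c) (h : 0 ≤ 2 - Q.1 ^ 2 - (1 - c) / c * Q.2 ^ 2) :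
    c * (Q.1 ^ 2 + third c Q ^ 2) + (1 - c) * Q.2 ^ 2 = 2 * c := by
  rw [third, Real.sq_sqrt h]
  field_simp
  ring

theorem isClosed_triangles : IsClosed (triangles c) := by
  have := continuous_third (c := c)
  have e : triangles c = {Q | c * (Q.1 ^ 2 + third c Q ^ 2) + (1 - c) * Q.2 ^ 2 = 2 * c} ∩
      ({Q | Q.2 ≤ Q.1 + third c Q} ∩ ({Q | Q.1 ≤ third c Q + Q.2} ∩
        {Q | third c Q ≤ Q.1 + Q.2})) := by
    ext Q
    exact ⟨fun h => ⟨h.energy, h.u_le, h.v_le, h.w_le⟩, fun h => ⟨h.1, h.2.1, h.2.2.1, h.2.2.2⟩⟩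
  rw [e]
  exact (isClosed_eq (by fun_prop) (by fun_prop)).inter
    ((isClosed_le (by fun_prop) (by fun_prop)).inter
      ((isClosed_le (by fun_prop) (by fun_prop)).inter
        (isClosed_le (by fun_prop) (by fun_prop))))

theorem Adm.isCompact_triangles (a : Adm c k) : IsCompact (triangles c) := by
  refine (isCompact_Icc (a := ((0 : ℝ), (0 : ℝ))) (b := (3 / 2, 3))).of_isClosed_subset
    isClosed_triangles fun Q hQ => ?_
  have h : Config c Q.1 (third c Q) Q.2 := hQ
  exact ⟨⟨h.v_nonneg, h.u_nonneg⟩, h.v_le_bound a, h.u_le_bound a⟩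

theorem isClosed_partialFuture (N : ℕ → ℝ) (n : ℕ) : IsClosed (partialFuture c N n) := by
  have : partialFuture c N n = ⋂ i, ⋂ (_ : i ≤ n), (fun Q => orb c N Q i) ⁻¹' triangles c := by
    ext Q
    simp [partialFuture]
  rw [this]
  exact isClosed_iInter fun i => isClosed_iInter fun _ =>
    isClosed_triangles.preimage (continuous_orb N i)

theorem partialFuture_anti (N : ℕ → ℝ) (n : ℕ) :
    partialFuture c N (n + 1) ⊆ partialFuture c N n :=
  fun _ h i hi => h i (hi.trans n.le_succ)

theorem partialFuture_subset (N : ℕ → ℝ) (n : ℕ) : partialFuture c N n ⊆ triangles c :=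
  fun _ h => h 0 n.zero_le

theorem mem_closedFuture_iff {N : ℕ → ℝ} {Q : ℝ × ℝ} :
    Q ∈ closedFuture c N ↔ ∀ n, Q ∈ partialFuture c N n :=
  ⟨fun h _ i _ => h i, fun h i => h i i le_rfl⟩

theorem orb_succ (N : ℕ → ℝ) (Q : ℝ × ℝ) (i : ℕ) :
    orb c N Q (i + 1) = orb c (fun i => N (i + 1)) (step c (N 0) Q) i := by
  induction i with
  | zero => rfl
  | succ i ih =>
    change step c (N (i + 1)) (orb c N Q (i + 1)) = _
    rw [ih]
    rfl

theorem closedFuture_isOrbit {N : ℕ → ℝ} {Q : ℝ × ℝ} (h : Q ∈ closedFuture c N) :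
    IsOrbit c N (fun i => (orb c N Q i).1) fun i => (orb c N Q i).2 := by
  refine ⟨fun i => h i, fun i => ?_⟩
  simp only [orb, step]
  ring

/-- Reversibility: conjugating by the reversal inverts the map, so pasts can be treated as futures.
-/
theorem step_reversal_step (a : Adm c k) {N : ℝ} {Q : ℝ × ℝ} (hQ : Q ∈ triangles c)
    (hs : step c N Q ∈ triangles c) :
    step c N (reversal c (step c N Q)) = reversal c Q := by
  have h : Config c Q.1 (third c Q) Q.2 := hQ
  have h' : Config c (step c N Q).1 (third c (step c N Q)) (step c N Q).2 := hs
  have h1 : third c (reversal c (step c N Q)) = third c Q := h'.symm.third_eq a.c_pos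
  rw [step, h1]
  simp [reversal, step]

theorem reversal_mem (a : Adm c k) {Q : ℝ × ℝ} (hQ : Q ∈ triangles c) :
    reversal c Q ∈ triangles c :=
  Config.mem_triangles a.c_pos (Config.symm hQ)

/-! ### Crossing the strips -/

/-- The part of the left upper side above the stable strips. -/
def aboveStrips (c k : ℝ) : Set (ℝ × ℝ) :=
  {Q | third c Q = Q.1 + Q.2 ∧ Q.2 ≤ c * k * third c Q}

/-- The part of the right side below the stable strips. -/
def belowStrips (c k : ℝ) : Set (ℝ × ℝ) :=
  {Q | third c Q ^ 2 = (Q.1 - Q.2) ^ 2 ∧ third c Q ≤ Q.1 ∧ c * (k + 1) * third c Q ≤ Q.2}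

section Crossing

variable {v w u N : ℝ}

/-- The hypotheses `hf` and `hg` state that the height is nonnegative at the last bump and
nonpositive at the virtual one after it: these are the squared triangle inequalities of the image.
The bound on `u` makes the new side nonnegative. -/
theorem Config.exists_image (a : Adm c k) (h : Config c v w u) (hN : k ≤ N)
    (hu : u ≤ c * (N + 1) * w)
    (hf : 0 ≤ v ^ 2 - (w - u) ^ 2 + 4 * (N - 1) * w * (u - c * N * w))
    (hg : v ^ 2 - (w - u) ^ 2 + 4 * N * w * (u - c * (N + 1) * w) ≤ 0) :
    Config c w (third c (w, 2 * c * N * w - u)) (2 * c * N * w - u) := by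
  have hc := a.c_pos
  have hN1 : 1 ≤ N := a.one_le.trans hN
  have hcw := mul_nonneg hc.le h.w_nonneg
  have hu' : 0 ≤ 2 * c * N * w - u := by nlinarith
  set u' := 2 * c * N * w - u with hu'_def
  set r := 2 - w ^ 2 - (1 - c) / c * u' ^ 2 with hr
  have hE : c * (w ^ 2 + r) + (1 - c) * u' ^ 2 = 2 * c := by
    rw [hr]; field_simp; ring
  have hlink : u + u' = 2 * c * N * w := by rw [hu'_def]; ring
  have e1 : r - (w - u') ^ 2 = v ^ 2 - (w - u) ^ 2 + 4 * (N - 1) * w * (u - c * N * w) := by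
    apply mul_left_cancel₀ hc.ne'
    rw [hu'_def] at hE ⊢
    linear_combination hE - h.energy
  have e2 : r - (w + u') ^ 2 = v ^ 2 - (w - u) ^ 2 + 4 * N * w * (u - c * (N + 1) * w) := by
    linear_combination e1 - 4 * w * hlink
  have hr0 : 0 ≤ r := by nlinarith [sq_nonneg (w - u')]
  have hw' : third c (w, u') ^ 2 = r := Real.sq_sqrt hr0
  have hw'0 : 0 ≤ third c (w, u') := Real.sqrt_nonneg _
  have b1 : |w - u'| ≤ third c (w, u') := abs_le_of_sq_le_sq (by linarith) hw'0
  have b2 : third c (w, u') ≤ w + u' :=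
    (sq_le_sq₀ hw'0 (add_nonneg h.w_nonneg hu')).1 (by linarith)
  rw [abs_le] at b1
  exact ⟨by rw [hw']; exact hE, by linarith, by linarith, b2⟩

/-- The sign of the height at the virtual bump before the first, together with `hup`, puts `u'`
between `ckw` and `2w`. On this range both branches of `|w - u'|` lie below the strips, by `1 < ck(k
+ 1)` for `u' ≤ w`, and by `c(k + 1) ≤ 2` otherwise. -/
theorem Config.image_mem_belowStrips (a : Adm c k) {v' u' : ℝ} (h : Config c v w u)
    (h' : Config c w v' u') (hu : u + u' = 2 * c * N * w) (hN : k ≤ N) (hN' : N ≤ k + 1)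
    (hup : u ≤ c * N * w) (hr : v' ^ 2 = (w - u') ^ 2) : v' ≤ w ∧ c * (k + 1) * v' ≤ u' := by
  have hw := h.mid_pos a h' hu
  have hc := a.c_pos
  have hk := a.one_le
  have hcw := mul_pos hc hw
  have e := height_eq₂ hc.ne' h.energy h'.energy hu
  have hge : c * (N - 1) * w ≤ u := by
    have h1 := h.le_add_sq
    have h2 : 0 ≤ 4 * N * w * (u - c * (N - 1) * w) := by linarith
    have : 0 < N := by linarith
    linarith [nonneg_of_mul_nonneg_right h2 (by positivity : 0 < 4 * N * w)]
  have h1 : u' ≤ 2 * w := by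
    have : c * (N + 1) ≤ 2 := by nlinarith [a.le_two]
    nlinarith
  have h2 : c * k * w ≤ u' := by nlinarith
  rcases le_total u' w with h3 | h3
  · have e' : v' = w - u' := (pow_left_inj₀ h'.w_nonneg (by linarith) two_ne_zero).1 hr
    refine ⟨by linarith [h'.u_nonneg], ?_⟩
    have : c * k * w * (1 + c * (k + 1)) ≤ u' * (1 + c * (k + 1)) :=
      mul_le_mul_of_nonneg_right h2 (by positivity)
    have : 0 ≤ c * w * (c * k * (k + 1) - 1) := mul_nonneg hcw.le (by linarith [a.one_lt])
    rw [e']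
    linarith
  · have e' : v' = u' - w := by
      refine (pow_left_inj₀ h'.w_nonneg (by linarith) two_ne_zero).1 ?_
      rw [hr]; ring
    have : c * (k + 1) ≤ 2 := by nlinarith [a.le_two]
    have h5 := h'.w_nonneg
    refine ⟨by linarith, ?_⟩
    have : c * (k + 1) * v' ≤ 2 * v' := mul_le_mul_of_nonneg_right this h5
    linarith

theorem exists_first_zero {g : ℝ → ℝ} {b : ℝ} (hb : 0 ≤ b) (hg : ContinuousOn g (Icc 0 b))
    (h0 : g 0 ≤ 0) (h1 : 0 ≤ g b) : ∃ t ∈ Icc 0 b, g t = 0 ∧ ∀ s ∈ Ico 0 t, g s < 0 := by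
  have hne : (Icc 0 b ∩ g ⁻¹' {0}).Nonempty := by
    obtain ⟨t, ht, e⟩ := intermediate_value_Icc hb hg ⟨h0, h1⟩
    exact ⟨t, ht, e⟩
  have hcl : IsCompact (Icc 0 b ∩ g ⁻¹' {0}) :=
    isCompact_Icc.of_isClosed_subset (hg.preimage_isClosed_of_isClosed isClosed_Icc
      isClosed_singleton) inter_subset_left
  obtain ⟨t, ⟨ht, e⟩, hmin⟩ := hcl.exists_isLeast hne
  refine ⟨t, ht, e, fun s hs => ?_⟩
  by_contra! hcon
  obtain ⟨r, hr, e'⟩ := intermediate_value_Icc hs.1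
    (hg.mono (Icc_subset_Icc_right (hs.2.le.trans ht.2))) ⟨h0, hcon⟩
  have := hmin ⟨⟨hr.1, hr.2.trans (hs.2.le.trans ht.2)⟩, e'⟩
  linarith [hr.2, hs.2]

theorem exists_last_zero {g : ℝ → ℝ} {b : ℝ} (hb : 0 ≤ b) (hg : ContinuousOn g (Icc 0 b))
    (h0 : g 0 ≤ 0) (h1 : 0 ≤ g b) : ∃ t ∈ Icc 0 b, g t = 0 ∧ ∀ s ∈ Ioc t b, 0 < g s := by
  have hm : MapsTo (fun t => b - t) (Icc 0 b) (Icc 0 b) :=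
    fun t ht => ⟨by linarith [ht.2], by linarith [ht.1]⟩
  obtain ⟨t, ht, e, h⟩ := exists_first_zero (g := fun t => -g (b - t)) hb
    (hg.comp (by fun_prop) hm).neg (by simpa using h1) (by simpa using h0)
  refine ⟨b - t, hm ht, by simpa using e, fun s hs => ?_⟩
  have := h (b - s) ⟨by linarith [hs.2], by linarith [hs.1]⟩
  simpa using this

/-- A path from above the stable strips to below them contains a path whose image is such a path
(in the opposite direction). -/
theorem exists_image_path (a : Adm c k) {γ : ℝ → ℝ × ℝ} (hγ : ContinuousOn γ (Icc 0 1))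
    (hK : ∀ t ∈ Icc (0 : ℝ) 1, γ t ∈ triangles c) (h0 : γ 0 ∈ aboveStrips c k)
    (h1 : γ 1 ∈ belowStrips c k) (hN : k ≤ N) (hN' : N ≤ k + 1) :
    ∃ τ : ℝ → ℝ, Continuous τ ∧ MapsTo τ (Icc 0 1) (Icc 0 1) ∧
      (∀ t ∈ Icc (0 : ℝ) 1, step c N (γ (τ t)) ∈ triangles c) ∧
      step c N (γ (τ 0)) ∈ aboveStrips c k ∧ step c N (γ (τ 1)) ∈ belowStrips c k := by
  have hc := a.c_pos
  have hN1 : 1 ≤ N := a.one_le.trans hN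
  have hct := continuous_third (c := c)
  set v : ℝ → ℝ := fun t => (γ t).1
  set u : ℝ → ℝ := fun t => (γ t).2
  set w : ℝ → ℝ := fun t => third c (γ t)
  have hK' : ∀ t ∈ Icc (0 : ℝ) 1, Config c (v t) (w t) (u t) := hK
  have cv : ContinuousOn v (Icc 0 1) := continuous_fst.comp_continuousOn hγ
  have cu : ContinuousOn u (Icc 0 1) := continuous_snd.comp_continuousOn hγ
  have cw : ContinuousOn w (Icc 0 1) := hct.comp_continuousOn hγ
  -- Along the path, `f` is the height at the last bump and `g` the height at the virtual bump after
  -- it. The image stays in the closed phase space where `g ≤ 0 ≤ f`.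
  set g : ℝ → ℝ := fun t => v t ^ 2 - (w t - u t) ^ 2 + 4 * N * w t * (u t - c * (N + 1) * w t)
  set f : ℝ → ℝ := fun t => v t ^ 2 - (w t - u t) ^ 2 + 4 * (N - 1) * w t * (u t - c * N * w t)
  have cg : ContinuousOn g (Icc 0 1) := by fun_prop
  have cf : ContinuousOn f (Icc 0 1) := by fun_prop
  have z0 : (0 : ℝ) ∈ Icc (0 : ℝ) 1 := ⟨le_rfl, zero_le_one⟩
  have z1 : (1 : ℝ) ∈ Icc (0 : ℝ) 1 := ⟨zero_le_one, le_rfl⟩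
  have w0 := (hK' 0 z0).w_nonneg
  have h0' : w 0 = v 0 + u 0 ∧ u 0 ≤ c * k * w 0 := h0
  have hq0 : v 0 ^ 2 - (w 0 - u 0) ^ 2 = 0 := by rw [h0'.1]; ring
  have hu0 : u 0 ≤ c * N * w 0 := by nlinarith [mul_nonneg hc.le w0, h0'.2]
  have g0 : g 0 ≤ 0 := by
    simp only [g, hq0, zero_add]
    refine mul_nonpos_of_nonneg_of_nonpos (by positivity) ?_
    nlinarith [mul_nonneg hc.le w0]
  have f0 : f 0 ≤ 0 := by
    simp only [f, hq0, zero_add]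
    exact mul_nonpos_of_nonneg_of_nonpos (mul_nonneg (by linarith) w0) (by linarith)
  have g1 : 0 ≤ g 1 := by
    have h1' : w 1 ^ 2 = (v 1 - u 1) ^ 2 ∧ w 1 ≤ v 1 ∧ c * (k + 1) * w 1 ≤ u 1 := h1
    have w1 := (hK' 1 z1).w_nonneg
    have hcw := mul_nonneg hc.le w1
    rcases le_total (u 1) (v 1) with huv | huv
    · have e : w 1 = v 1 - u 1 := (pow_left_inj₀ w1 (by linarith) two_ne_zero).1 h1'.1
      have : g 1 = 4 * (N + 1) * w 1 * (u 1 - c * N * w 1) := by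
        have : v 1 = w 1 + u 1 := by linarith
        simp only [g, this]; ring
      rw [this]
      exact mul_nonneg (by positivity) (by nlinarith)
    · have e : w 1 = u 1 - v 1 := by
        refine (pow_left_inj₀ w1 (by linarith) two_ne_zero).1 ?_
        rw [h1'.1]; ring
      have : g 1 = 4 * N * w 1 * (u 1 - c * (N + 1) * w 1) := by
        have : v 1 = u 1 - w 1 := by linarith
        simp only [g, this]; ring
      rw [this]
      refine mul_nonneg (by positivity) ?_
      have : c * (N + 1) ≤ 2 := by nlinarith [a.le_two]
      nlinarith
  obtain ⟨t₂, ht₂, gt₂, hlt⟩ := exists_first_zero zero_le_one cg g0 g1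
  have sub : Icc 0 t₂ ⊆ Icc 0 1 := Icc_subset_Icc_right ht₂.2
  have hule : ∀ t ∈ Icc 0 t₂, u t ≤ c * (N + 1) * w t := by
    intro t ht
    rcases ht₂.1.eq_or_lt with e | e
    · obtain rfl : t = 0 := le_antisymm (ht.2.trans e.symm.le) ht.1
      nlinarith [mul_nonneg hc.le w0]
    · have hcl : closure (Ico 0 t₂) = Icc 0 t₂ := closure_Ico e.ne
      refine le_on_closure (s := Ico 0 t₂) (f := u) (g := fun t => c * (N + 1) * w t) ?_ ?_ ?_
        (by rwa [hcl])
      · intro s hs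
        have h2 := hK' s (sub ⟨hs.1, hs.2.le⟩)
        have h3 := hlt s hs
        have h4 := h2.sub_sq_le
        have h5 : 4 * N * w s * (u s - c * (N + 1) * w s) ≤ 0 := by
          simp only [g] at h3; linarith
        rcases h2.w_nonneg.lt_or_eq with h6 | h6
        · have h7 : 0 < 4 * N * w s := by positivity
          linarith [nonpos_of_mul_nonpos_right h5 h7]
        · simp only [g, ← h6] at h3
          rw [← h6] at h4
          nlinarith
      · rw [hcl]; exact cu.mono sub
      · rw [hcl]; exact (cw.mono sub).const_mul _ |>.congr fun _ _ => rfl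
  have hwpos : ∀ t ∈ Icc 0 t₂, 0 < w t := by
    intro t ht
    have h2 := hK' t (sub ht)
    rcases h2.w_nonneg.lt_or_eq with h3 | h3
    · exact h3
    · have h4 := hule t ht
      rw [← h3, mul_zero] at h4
      have h5 : u t = 0 := le_antisymm h4 h2.u_nonneg
      have h6 : v t = 0 := by linarith [h2.v_le, h2.v_nonneg]
      have h7 := h2.energy
      rw [← h3, h5, h6] at h7
      linarith
  have f2 : 0 ≤ f t₂ := by
    have e : f t₂ = g t₂ + 4 * w t₂ * (2 * c * N * w t₂ - u t₂) := by simp only [f, g]; ring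
    have h3 := hule t₂ ⟨ht₂.1, le_rfl⟩
    have h4 := hwpos t₂ ⟨ht₂.1, le_rfl⟩
    rw [e, gt₂, zero_add]
    refine mul_nonneg (by positivity) ?_
    nlinarith [mul_pos hc h4]
  obtain ⟨t₁, ht₁, ft₁, hut₁, hf⟩ : ∃ t₁ ∈ Icc 0 t₂, f t₁ = 0 ∧ u t₁ ≤ c * N * w t₁ ∧
      ∀ t ∈ Icc t₁ t₂, 0 ≤ f t := by
    -- For `N = 1` the last bump is also the first, so `f` is nonnegative throughout and vanishes at
    -- `0`. For `N > 1` the last zero of `f` before `t₂` is taken.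
    rcases hN1.eq_or_lt with rfl | hN1
    · refine ⟨0, ⟨le_rfl, ht₂.1⟩, ?_, hu0, fun t ht => ?_⟩
      · simp only [f, hq0]; ring
      · have := (hK' t (sub ht)).sub_sq_le
        simp only [f, sub_self, mul_zero, zero_mul, add_zero]
        linarith
    · obtain ⟨t₁, ht₁, e, h⟩ := exists_last_zero ht₂.1 (cf.mono sub) f0 f2
      refine ⟨t₁, ht₁, e, ?_, fun t ht => ?_⟩
      · have h3 := (hK' t₁ (sub ht₁)).sub_sq_le
        have h4 : 4 * (N - 1) * w t₁ * (u t₁ - c * N * w t₁) ≤ 0 := by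
          simp only [f] at e; linarith
        have h5 : 0 < 4 * (N - 1) * w t₁ :=
          mul_pos (by linarith) (hwpos t₁ ht₁)
        linarith [nonpos_of_mul_nonpos_right h4 h5]
      · rcases ht.1.eq_or_lt with rfl | h3
        · exact e.ge
        · exact (h t ⟨h3, ht.2⟩).le
  have hgle : ∀ t ∈ Icc 0 t₂, g t ≤ 0 := by
    intro t ht
    rcases ht.2.eq_or_lt with rfl | h
    · exact gt₂.le
    · exact (hlt t ⟨ht.1, h⟩).le
  have himg : ∀ t ∈ Icc t₁ t₂, Config c (w t) (third c (step c N (γ t))) (2 * c * N * w t - u t) :=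
    fun t ht => by
      have ht' : t ∈ Icc 0 t₂ := ⟨ht₁.1.trans ht.1, ht.2⟩
      exact (hK' t (sub ht')).exists_image a hN (hule t ht') (hf t ht) (hgle t ht')
  -- The piece is run backwards: its end at `t₂` maps above the strips and its end at `t₁` below
  -- them.
  refine ⟨fun t => t₂ + t * (t₁ - t₂), by fun_prop, fun t ht => ?_, fun t ht => ?_, ?_, ?_⟩
  · have := ht₁.2
    exact ⟨by nlinarith [ht.1, ht.2, ht₁.1], by nlinarith [ht.1, ht.2, ht₂.2]⟩
  · have := ht₁.2
    exact himg _ ⟨by nlinarith [ht.1, ht.2, ht₁.1], by nlinarith [ht.1, ht.2, ht₂.2]⟩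
  · have hm : t₂ ∈ Icc t₁ t₂ := ⟨ht₁.2, le_rfl⟩
    have hi := himg t₂ hm
    have hk := hK' t₂ ht₂
    have hlink : u t₂ + (2 * c * N * w t₂ - u t₂) = 2 * c * N * w t₂ := by ring
    have e := height_eq₃ hc.ne' hk.energy hi.energy hlink
    have e' : third c (step c N (γ t₂)) ^ 2 = (w t₂ + (2 * c * N * w t₂ - u t₂)) ^ 2 := by
      have : v t₂ ^ 2 - (w t₂ - u t₂) ^ 2 + 4 * N * w t₂ * (u t₂ - c * (N + 1) * w t₂) = 0 := gt₂
      linarith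
    have e'' := (pow_left_inj₀ hi.w_nonneg (add_nonneg hi.v_nonneg hi.u_nonneg) two_ne_zero).1 e'
    simp only [zero_mul, add_zero]
    exact ⟨e'', (hk.u_le_of_left_image a hi hlink hN hN' e'').le⟩
  · have hm : t₁ ∈ Icc t₁ t₂ := ⟨le_rfl, ht₁.2⟩
    have hi := himg t₁ hm
    have hk := hK' t₁ (sub ht₁)
    have hlink : u t₁ + (2 * c * N * w t₁ - u t₁) = 2 * c * N * w t₁ := by ring
    have e := height_eq₁ hc.ne' hk.energy hi.energy hlink
    have e' : third c (step c N (γ t₁)) ^ 2 = (w t₁ - (2 * c * N * w t₁ - u t₁)) ^ 2 := by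
      have : v t₁ ^ 2 - (w t₁ - u t₁) ^ 2 + 4 * (N - 1) * w t₁ * (u t₁ - c * N * w t₁) = 0 := ft₁
      linarith
    have h3 := hk.image_mem_belowStrips a hi hlink hN hN' hut₁ e'
    have e4 : t₂ + 1 * (t₁ - t₂) = t₁ := by ring
    simp only [e4]
    exact ⟨e', h3.1, h3.2⟩

/-- The partial futures contain paths from the left to the right side. -/
theorem exists_path_partialFuture (a : Adm c k) (n : ℕ) {N : ℕ → ℝ} (hN : IsWord k N) :
    ∃ γ : ℝ → ℝ × ℝ, ContinuousOn γ (Icc 0 1) ∧ (∀ t ∈ Icc (0 : ℝ) 1, γ t ∈ triangles c) ∧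
      γ 0 ∈ aboveStrips c k ∧ γ 1 ∈ belowStrips c k ∧
      ∀ t ∈ Icc (0 : ℝ) 1, reversal c (γ t) ∈ partialFuture c N n := by
  have hc := a.c_pos
  induction n generalizing N with
  | zero =>
    -- The initial path is the symmetry line `v = w`, from the top `u = 0` to the bottom `u = 2v`;
    -- energy at the bottom gives `u = b`.
    set b : ℝ := √(4 * c / (2 - c)) with hb
    have h2c : 0 < 2 - c := by linarith [a.c_le]
    have hb2 : b ^ 2 = 4 * c / (2 - c) := Real.sq_sqrt (by positivity)
    have hb0 : 0 ≤ b := Real.sqrt_nonneg _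
    set s : ℝ → ℝ := fun t => √(1 - (1 - c) / c * (t * b) ^ 2 / 2) with hs
    have hs2 : ∀ t ∈ Icc (0 : ℝ) 1, s t ^ 2 = 1 - (1 - c) / c * (t * b) ^ 2 / 2 ∧
        (t * b) ^ 2 ≤ 4 * s t ^ 2 := by
      intro t ht
      have ht2 : t ^ 2 ≤ 1 := pow_le_one₀ ht.1 ht.2
      have hk : 4 * (1 - (1 - c) / c * (t * b) ^ 2 / 2) - (t * b) ^ 2 = 4 * (1 - t ^ 2) := by
        rw [mul_pow, hb2]; field_simp; ring
      have h0 : 0 ≤ 1 - (1 - c) / c * (t * b) ^ 2 / 2 := by nlinarith [sq_nonneg (t * b)]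
      have h1 : s t ^ 2 = 1 - (1 - c) / c * (t * b) ^ 2 / 2 := Real.sq_sqrt h0
      exact ⟨h1, by rw [h1]; linarith⟩
    have hconf : ∀ t ∈ Icc (0 : ℝ) 1, Config c (s t) (s t) (t * b) := by
      intro t ht
      obtain ⟨h1, h2⟩ := hs2 t ht
      have hs0 : 0 ≤ s t := Real.sqrt_nonneg _
      have htb : 0 ≤ t * b := mul_nonneg ht.1 hb0
      refine ⟨?_, ?_, by linarith, by linarith⟩
      · rw [h1]; field_simp; ring
      · exact (sq_le_sq₀ htb (by linarith)).1 (by linarith)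
    have z0 : (0 : ℝ) ∈ Icc (0 : ℝ) 1 := ⟨le_rfl, zero_le_one⟩
    have z1 : (1 : ℝ) ∈ Icc (0 : ℝ) 1 := ⟨zero_le_one, le_rfl⟩
    refine ⟨fun t => (s t, t * b), ?_, fun t ht => (hconf t ht).mem_triangles hc, ?_, ?_, ?_⟩
    · apply Continuous.continuousOn
      simp only [hs]
      fun_prop
    · have h3 := (hconf 0 z0).third_eq hc
      have hk := a.one_le
      simp only [aboveStrips, mem_ofPred_eq, h3]
      have hs0 : 0 ≤ s 0 := Real.sqrt_nonneg _
      exact ⟨by ring, by rw [zero_mul]; positivity⟩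
    · have h3 := (hconf 1 z1).third_eq hc
      simp only [belowStrips, mem_ofPred_eq, h3]
      have hs0 : 0 ≤ s 1 := Real.sqrt_nonneg _
      have h4 : 1 * b = 2 * s 1 := by
        have h1 := (hs2 1 z1).1
        refine (pow_left_inj₀ (by linarith) (by linarith) two_ne_zero).1 ?_
        rw [mul_pow, mul_pow, h1, one_mul, hb2]
        field_simp
        ring
      rw [h4]
      refine ⟨by ring, le_rfl, ?_⟩
      have : c * (k + 1) ≤ 2 := by nlinarith [a.le_two]
      nlinarith
    · intro t ht i hi
      obtain rfl : i = 0 := by omega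
      exact reversal_mem a ((hconf t ht).mem_triangles hc)
  | succ n ih =>
    -- The path for the shifted word is pushed forward with symbol `N 0`. By reversibility, one step
    -- from the reversal of the image leads back to the reversed old path.
    obtain ⟨γ, hγ, hK, h0, h1, hF⟩ := ih hN.shift
    obtain ⟨τ, hτ, hm, hK', h0', h1'⟩ := exists_image_path a hγ hK h0 h1 (hN 0).1 (hN 0).2
    refine ⟨fun t => step c (N 0) (γ (τ t)),
      (continuous_step _).comp_continuousOn (hγ.comp hτ.continuousOn hm), hK', h0', h1', ?_⟩
    intro t ht i hi
    rcases i with _ | i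
    · exact reversal_mem a (hK' t ht)
    · rw [orb_succ, step_reversal_step a (hK _ (hm ht)) (hK' t ht)]
      exact hF _ (hm ht) i (by omega)

end Crossing

/-! ### Continued fractions -/

/-- The continued fraction `1 / (G 0 + 1 / (B 0 + 1 / (G 1 + 1 / (B 1 + ⋯))))` of depth `n` with
the tail `t`. -/
noncomputable def contFrac (G B : ℕ → ℝ) : ℕ → ℝ → ℝ
  | 0, t => t
  | n + 1, t => (contFrac (fun i => G (i + 1)) (fun i => B (i + 1)) n t + B 0) /
      (1 + G 0 * (contFrac (fun i => G (i + 1)) (fun i => B (i + 1)) n t + B 0))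

/-- The value of an infinite continued fraction. -/
noncomputable def contFracLim (G B : ℕ → ℝ) : ℝ := limUnder atTop fun n => contFrac G B n 0

/-- Coefficients for which the continued fraction converges. -/
structure ContractingCoeffs (c b : ℝ) (G B : ℕ → ℝ) : Prop where
  G_nonneg : ∀ i, 0 ≤ G i
  B_pos : ∀ i, 0 < B i
  B_le : ∀ i, B i ≤ b
  two_step : ∀ i, 1 + rate c ≤ (1 + G i * B i) * (1 + G (i + 1) * B (i + 1))

theorem abs_moebius_sub_le {G B x y : ℝ} (hG : 0 ≤ G) (hB : 0 < B) (hx : 0 ≤ x) (hy : 0 ≤ y) :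
    |(x + B) / (1 + G * (x + B)) - (y + B) / (1 + G * (y + B))| * (1 + G * B) ≤ |x - y| := by
  have h1 : 0 < 1 + G * (x + B) := by positivity
  have h2 : 0 < 1 + G * (y + B) := by positivity
  have e : (x + B) / (1 + G * (x + B)) - (y + B) / (1 + G * (y + B)) =
      (x - y) / ((1 + G * (x + B)) * (1 + G * (y + B))) := by
    field_simp
    ring
  rw [e, abs_div, abs_of_pos (mul_pos h1 h2), div_mul_eq_mul_div, div_le_iff₀ (mul_pos h1 h2)]
  refine mul_le_mul_of_nonneg_left ?_ (abs_nonneg _)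
  have h3 : 1 + G * B ≤ 1 + G * (x + B) := by nlinarith
  have h4 : 1 ≤ 1 + G * (y + B) := by
    have : 0 ≤ G * (y + B) := by positivity
    linarith
  nlinarith [mul_nonneg hG hB.le]

namespace ContractingCoeffs

variable {c k b : ℝ} {G B : ℕ → ℝ}

theorem shift (h : ContractingCoeffs c b G B) :
    ContractingCoeffs c b (fun i => G (i + 1)) fun i => B (i + 1) :=
  ⟨fun _ => h.G_nonneg _, fun _ => h.B_pos _, fun _ => h.B_le _, fun _ => h.two_step _⟩

theorem contFrac_nonneg (h : ContractingCoeffs c b G B) (n : ℕ) {t : ℝ} (ht : 0 ≤ t) :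
    0 ≤ contFrac G B n t := by
  induction n generalizing G B with
  | zero => exact ht
  | succ n ih =>
    have h1 := ih h.shift
    have h2 := h.G_nonneg 0
    have h3 := h.B_pos 0
    rw [contFrac]
    positivity

theorem contFrac_succ_sub_le (h : ContractingCoeffs c b G B) (n : ℕ) {s t : ℝ} (hs : 0 ≤ s)
    (ht : 0 ≤ t) : |contFrac G B (n + 1) s - contFrac G B (n + 1) t| * (1 + G 0 * B 0) ≤
      |contFrac (fun i => G (i + 1)) (fun i => B (i + 1)) n s -
        contFrac (fun i => G (i + 1)) (fun i => B (i + 1)) n t| :=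
  abs_moebius_sub_le (h.G_nonneg 0) (h.B_pos 0) (h.shift.contFrac_nonneg n hs)
    (h.shift.contFrac_nonneg n ht)

/-- Only products of two consecutive contraction factors are uniformly bounded, hence the two-step
induction. -/
theorem abs_contFrac_sub_le (a : Adm c k) (h : ContractingCoeffs c b G B) (n : ℕ) {s t : ℝ}
    (hs : 0 ≤ s) (ht : 0 ≤ t) :
    |contFrac G B n s - contFrac G B n t| ≤ |s - t| / contr c * contr c ^ n := by
  have hp := a.contr_pos
  induction n using Nat.twoStepInduction generalizing G B with
  | zero =>
    rw [pow_zero, mul_one]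
    exact le_div_self (abs_nonneg _) hp a.contr_lt_one.le
  | one =>
    rw [pow_one, div_mul_cancel₀ _ hp.ne']
    have h1 := h.contFrac_succ_sub_le 0 hs ht
    have h2 : 1 ≤ 1 + G 0 * B 0 := by
      have := mul_nonneg (h.G_nonneg 0) (h.B_pos 0).le
      linarith
    exact (le_mul_of_one_le_right (abs_nonneg _) h2).trans h1
  | more n ih _ =>
    have h1 := h.contFrac_succ_sub_le (n + 1) hs ht
    have h2 := h.shift.contFrac_succ_sub_le n hs ht
    have h3 := ih h.shift.shift
    have h4 := h.two_step 0
    have h5 : 0 ≤ 1 + G (0 + 1) * B (0 + 1) := by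
      have := mul_nonneg (h.G_nonneg (0 + 1)) (h.B_pos (0 + 1)).le
      linarith
    have h6 := mul_le_mul_of_nonneg_right h1 h5
    have h7 := mul_le_mul_of_nonneg_left h4
      (abs_nonneg (contFrac G B (n + 2) s - contFrac G B (n + 2) t))
    have hq := a.contr_sq
    set D := |contFrac G B (n + 2) s - contFrac G B (n + 2) t| with hD
    calc D = D * (1 + rate c) * contr c ^ 2 := by
          rw [mul_assoc, mul_comm (1 + rate c), hq, mul_one]
      _ ≤ |s - t| / contr c * contr c ^ n * contr c ^ 2 := by
          refine mul_le_mul_of_nonneg_right ?_ (by positivity)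
          refine h7.trans (le_trans ?_ (h2.trans h3))
          rw [← mul_assoc]
          exact h6
      _ = _ := by ring

/-- The definition adds a level at the head; here it is absorbed into the tail, as needed to compare
consecutive depths. -/
theorem contFrac_succ_eq (n : ℕ) (t : ℝ) :
    contFrac G B (n + 1) t = contFrac G B n ((t + B n) / (1 + G n * (t + B n))) := by
  induction n generalizing G B with
  | zero => rfl
  | succ n ih =>
    rw [contFrac, ih]
    rfl

theorem dist_contFrac_succ_le (a : Adm c k) (h : ContractingCoeffs c b G B) (n : ℕ) :
    dist (contFrac G B n 0) (contFrac G B (n + 1) 0) ≤ b / contr c * contr c ^ n := by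
  have hp := a.contr_pos
  have h1 := h.G_nonneg n
  have h2 := h.B_pos n
  have h3 : 0 ≤ (0 + B n) / (1 + G n * (0 + B n)) := by positivity
  have h4 : (0 + B n) / (1 + G n * (0 + B n)) ≤ b := by
    rw [zero_add]
    refine (div_le_self h2.le ?_).trans (h.B_le n)
    have := mul_nonneg h1 h2.le
    linarith
  rw [contFrac_succ_eq, Real.dist_eq]
  refine (h.abs_contFrac_sub_le a n le_rfl h3).trans ?_
  rw [zero_sub, abs_neg, abs_of_nonneg h3]
  gcongr

theorem tendsto_contFrac (a : Adm c k) (h : ContractingCoeffs c b G B) :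
    Tendsto (fun n => contFrac G B n 0) atTop (𝓝 (contFracLim G B)) :=
  (cauchySeq_of_le_geometric _ _ a.contr_lt_one (h.dist_contFrac_succ_le a)).tendsto_limUnder

theorem dist_contFracLim_le (a : Adm c k) (h : ContractingCoeffs c b G B) (n : ℕ) :
    dist (contFrac G B n 0) (contFracLim G B) ≤ b / contr c * contr c ^ n / (1 - contr c) :=
  dist_le_of_le_geometric_of_tendsto _ _ a.contr_lt_one (h.dist_contFrac_succ_le a)
    (h.tendsto_contFrac a) n

theorem contFracLim_nonneg (a : Adm c k) (h : ContractingCoeffs c b G B) : 0 ≤ contFracLim G B :=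
  ge_of_tendsto' (h.tendsto_contFrac a) fun n => h.contFrac_nonneg n le_rfl

theorem contFracLim_eq (a : Adm c k) (h : ContractingCoeffs c b G B) : contFracLim G B =
    (contFracLim (fun i => G (i + 1)) (fun i => B (i + 1)) + B 0) /
      (1 + G 0 * (contFracLim (fun i => G (i + 1)) (fun i => B (i + 1)) + B 0)) := by
  have h1 := (tendsto_add_atTop_iff_nat 1).2 (h.tendsto_contFrac a)
  refine tendsto_nhds_unique h1 ?_
  have h2 := (h.shift.tendsto_contFrac a).add_const (B 0)
  have h3 := h.shift.contFracLim_nonneg a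
  have h4 := h.G_nonneg 0
  have h5 := h.B_pos 0
  exact h2.div ((h2.const_mul (G 0)).const_add 1) (by positivity)

/-- Positivity gives the direction of the stable curves; the second bound gives that of their time
reversals. -/
theorem contFracLim_pos (a : Adm c k) (h : ContractingCoeffs c b G B) :
    0 < contFracLim G B ∧ G 0 * contFracLim G B < 1 := by
  rw [h.contFracLim_eq a]
  have h3 := h.shift.contFracLim_nonneg a
  have h4 := h.G_nonneg 0
  have h5 := h.B_pos 0
  refine ⟨by positivity, ?_⟩
  rw [← mul_div_assoc, div_lt_one (by positivity)]
  linarith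

/-- A bounded sequence satisfying the recursion is given by the continued fraction. -/
theorem eq_contFracLim (a : Adm c k) (h : ContractingCoeffs c b G B) {τ : ℕ → ℝ} {M : ℝ}
    (h0 : ∀ i, 0 ≤ τ i) (hM : ∀ i, τ i ≤ M)
    (hτ : ∀ i, τ i = (τ (i + 1) + B i) / (1 + G i * (τ (i + 1) + B i))) :
    τ 0 = contFracLim G B := by
  have hp := a.contr_pos
  have key : ∀ n, τ 0 = contFrac G B n (τ n) := by
    intro n
    induction n with
    | zero => rfl
    | succ n ih => rw [contFrac_succ_eq, ← hτ, ← ih]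
  refine tendsto_nhds_unique ?_ (h.tendsto_contFrac a)
  have hM0 : 0 ≤ M := (h0 0).trans (hM 0)
  have hl : Tendsto (fun n => M / contr c * contr c ^ n) atTop (𝓝 0) := by
    have := (tendsto_pow_atTop_nhds_zero_of_lt_one hp.le a.contr_lt_one).const_mul (M / contr c)
    rwa [mul_zero] at this
  rw [tendsto_iff_dist_tendsto_zero]
  refine squeeze_zero (fun n => dist_nonneg) (fun n => ?_) hl
  rw [key n, Real.dist_eq]
  refine (h.abs_contFrac_sub_le a n le_rfl (h0 n)).trans ?_
  rw [zero_sub, abs_neg, abs_of_nonneg (h0 n)]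
  have := hM n
  gcongr

/-- The error at depth `n` depends only on `b` and `c`, so the limit is a uniform limit of
continuous functions. -/
theorem continuous_contFracLim {Y : Type*} [TopologicalSpace Y] (a : Adm c k) {G B : Y → ℕ → ℝ}
    (hG : ∀ i, Continuous fun y => G y i) (hB : ∀ i, Continuous fun y => B y i)
    (h : ∀ y, ContractingCoeffs c b (G y) (B y)) :
    Continuous fun y => contFracLim (G y) (B y) := by
  have hp := a.contr_pos
  have hn : ∀ (n : ℕ) (G B : Y → ℕ → ℝ), (∀ i, Continuous fun y => G y i) →
      (∀ i, Continuous fun y => B y i) → (∀ y, ContractingCoeffs c b (G y) (B y)) →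
      Continuous fun y => contFrac (G y) (B y) n 0 := by
    intro n
    induction n with
    | zero => exact fun _ _ _ _ _ => continuous_const
    | succ n ih =>
      intro G B hG hB h
      have h1 := (ih (fun y i => G y (i + 1)) (fun y i => B y (i + 1)) (fun i => hG _)
        (fun i => hB _) fun y => (h y).shift).add (hB 0)
      refine h1.div (continuous_const.add ((hG 0).mul h1)) fun y => ?_
      have h2 := (h y).shift.contFrac_nonneg n le_rfl
      have h4 := (h y).G_nonneg 0
      have h5 := (h y).B_pos 0
      positivity
  have hu : TendstoUniformly (fun n y => contFrac (G y) (B y) n 0)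
      (fun y => contFracLim (G y) (B y)) atTop := by
    rw [Metric.tendstoUniformly_iff]
    intro ε hε
    have hl : Tendsto (fun n => b / contr c * contr c ^ n / (1 - contr c)) atTop (𝓝 0) := by
      have := ((tendsto_pow_atTop_nhds_zero_of_lt_one hp.le a.contr_lt_one).const_mul
        (b / contr c)).div_const (1 - contr c)
      rwa [mul_zero, zero_div] at this
    filter_upwards [hl.eventually (gt_mem_nhds hε)] with n hn y
    rw [dist_comm]
    exact ((h y).dist_contFracLim_le a n).trans_lt hn
  exact hu.continuous (Frequently.of_forall fun n => hn n G B hG hB h)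

end ContractingCoeffs

/-! ### The slopes of the stable curves -/

section Slope

variable {c k : ℝ} {N v u v' u' : ℕ → ℝ}

/-- Since `v + v' ≤ 3` and `N ≥ 1`, the product of the `i`-th coefficients is at least `2/3 (1 -
c)(u + u')`, so `two_step_le` applies. The upper bound comes from `v_ge`. -/
theorem IsOrbit.contractingCoeffs (a : Adm c k) (hN : IsWord k N) (h : IsOrbit c N v u)
    (h' : IsOrbit c N v' u') : ContractingCoeffs c (5 * (k + 1))
      (fun i => (1 - c) / c * (u i + u' i)) fun i => 2 * c * N i / (v (i + 1) + v' (i + 1)) := by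
  have hc := a.c_pos
  have hc1 : 0 < 1 - c := by linarith [a.c_le]
  have hk := a.one_le
  have hU : ∀ i, 0 ≤ u i + u' i := fun i =>
    add_nonneg (h.config i).u_nonneg (h'.config i).u_nonneg
  have hV : ∀ i, 2 * c / 5 ≤ v (i + 1) + v' (i + 1) := fun i => by
    linarith [h.v_ge a hN i, h'.v_ge a hN i]
  have hV' : ∀ i, v (i + 1) + v' (i + 1) ≤ 3 := fun i => by
    linarith [(h.config i).w_le_bound a, (h'.config i).w_le_bound a]
  have hV0 : ∀ i, 0 < v (i + 1) + v' (i + 1) := fun i =>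
    lt_of_lt_of_le (by positivity) (hV i)
  have hN0 : ∀ i, 1 ≤ N i := fun i => hk.trans (hN i).1
  have hge : ∀ i, 1 + 2 / 3 * (1 - c) * (u i + u' i) ≤
      1 + (1 - c) / c * (u i + u' i) * (2 * c * N i / (v (i + 1) + v' (i + 1))) := by
    intro i
    have : 2 * c / 3 ≤ 2 * c * N i / (v (i + 1) + v' (i + 1)) := by
      rw [div_le_div_iff₀ (by norm_num) (hV0 i)]
      have := mul_le_mul (hV' i) (hN0 i) zero_le_one (by norm_num)
      have := hV' i
      have := hN0 i
      nlinarith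
    have h2 : 0 ≤ (1 - c) / c * (u i + u' i) := mul_nonneg (by positivity) (hU i)
    have h3 := mul_le_mul_of_nonneg_left this h2
    have h4 : (1 - c) / c * (u i + u' i) * (2 * c / 3) = 2 / 3 * (1 - c) * (u i + u' i) := by
      field_simp
    linarith
  refine ⟨fun i => mul_nonneg (by positivity) (hU i), fun i => ?_, fun i => ?_, fun i => ?_⟩
  · have := hV0 i
    have := hN0 i
    positivity
  · rw [div_le_iff₀ (hV0 i)]
    have h1 : 5 * (k + 1) * (2 * c / 5) ≤ 5 * (k + 1) * (v (i + 1) + v' (i + 1)) :=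
      mul_le_mul_of_nonneg_left (hV i) (by positivity)
    have h2 : c * N i ≤ c * (k + 1) := mul_le_mul_of_nonneg_left (hN i).2 hc.le
    linarith
  · refine (IsOrbit.two_step_le a hN h h' i).trans ?_
    have h1 : 0 ≤ 1 + 2 / 3 * (1 - c) * (u i + u' i) := by have := hU i; positivity
    have h2 : 0 ≤ 1 + 2 / 3 * (1 - c) * (u (i + 1) + u' (i + 1)) := by
      have := hU (i + 1); positivity
    exact mul_le_mul (hge i) (hge (i + 1)) h2 (h1.trans (hge i))

/-- A bound for the slopes. -/
noncomputable def slopeBound (c k : ℝ) : ℝ := 5 * (k + 1) + 2 / ((1 - c) / c * (4 * c ^ 2 / 5))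

/-- With `τ i = -Δu i / Δ(v i ²)`, the link turns `τ (i + 1) + B i` into `Δu i / Δ(v (i + 1) ²)`,
and energy turns `1 + G i (τ (i + 1) + B i)` into `-Δ(v i ²) / Δ(v (i + 1) ²)`. Their quotient is `τ
i`: the continued fraction recursion. Using `v²` makes the energy relation linear. -/
theorem IsOrbit.slope_eq (a : Adm c k) (hN : IsWord k N) (h : IsOrbit c N v u)
    (h' : IsOrbit c N v' u') (hne : v 0 ≠ v' 0) :
    u' 0 - u 0 = -contFracLim (fun i => (1 - c) / c * (u i + u' i))
        (fun i => 2 * c * N i / (v (i + 1) + v' (i + 1))) * (v' 0 ^ 2 - v 0 ^ 2) ∧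
      contFracLim (fun i => (1 - c) / c * (u i + u' i))
        (fun i => 2 * c * N i / (v (i + 1) + v' (i + 1))) ≤ slopeBound c k := by
  have hc := a.c_pos
  have hc1 : 0 < 1 - c := by linarith [a.c_le]
  have hk := a.one_le
  have hcoef := h.contractingCoeffs a hN h'
  set G : ℕ → ℝ := fun i => (1 - c) / c * (u i + u' i) with hG
  set B : ℕ → ℝ := fun i => 2 * c * N i / (v (i + 1) + v' (i + 1)) with hB
  have cone := stable_cone_all a hN h h' (Or.inl hne)
  have hvne : ∀ i, v i - v' i ≠ 0 := fun i h0 => by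
    have := cone i
    rw [h0, zero_mul] at this
    exact lt_irrefl _ this
  have hVpos : ∀ i, 0 < v i + v' i := fun i => by
    have h1 := (h.config i).v_nonneg
    have h2 := (h'.config i).v_nonneg
    refine lt_of_le_of_ne (by linarith) fun h0 => hvne i ?_
    linarith
  have hp : ∀ i, v i ^ 2 - v' i ^ 2 ≠ 0 := fun i => by
    rw [sq_sub_sq]
    exact mul_ne_zero (hVpos i).ne' (hvne i)
  set τ : ℕ → ℝ := fun i => -(u i - u' i) / (v i ^ 2 - v' i ^ 2) with hτ
  have hτ0 : ∀ i, 0 ≤ τ i := by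
    intro i
    have : τ i = -((v i - v' i) * (u i - u' i)) / ((v i + v' i) * (v i - v' i) ^ 2) := by
      simp only [hτ]
      rw [div_eq_div_iff (hp i) (mul_ne_zero (hVpos i).ne' (pow_ne_zero 2 (hvne i)))]
      ring
    rw [this]
    have := hVpos i
    exact div_nonneg (by linarith [cone i]) (by positivity)
  have hrec : ∀ i, τ i = (τ (i + 1) + B i) / (1 + G i * (τ (i + 1) + B i)) := by
    intro i
    have hx : τ (i + 1) + B i = (u i - u' i) / (v (i + 1) ^ 2 - v' (i + 1) ^ 2) := by
      have hl : u i - u' i = 2 * c * N i * (v (i + 1) - v' (i + 1)) - (u (i + 1) - u' (i + 1)) := by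
        linarith [h.link i, h'.link i]
      have h1 := (hVpos (i + 1)).ne'
      have h2 := hvne (i + 1)
      simp only [hτ, hB]
      rw [hl, sq_sub_sq]
      field_simp
      ring
    have hy : 1 + G i * (τ (i + 1) + B i) =
        -(v i ^ 2 - v' i ^ 2) / (v (i + 1) ^ 2 - v' (i + 1) ^ 2) := by
      rw [hx, eq_div_iff (hp (i + 1))]
      have h3 := hp (i + 1)
      have e1 := (h.config i).energy
      have e2 := (h'.config i).energy
      simp only [hG]
      rw [add_mul, mul_assoc, div_mul_cancel₀ _ h3]
      field_simp
      linear_combination e1 - e2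
    rw [hy, hx]
    simp only [hτ]
    have h3 := hp (i + 1)
    have h4 := hp i
    field_simp
  have hη : 0 < (1 - c) / c * (4 * c ^ 2 / 5) := by positivity
  have hGsum : ∀ i, (1 - c) / c * (4 * c ^ 2 / 5) ≤ G i + G (i + 1) := by
    intro i
    have h1 := h.add_ge a hN i
    have h2 := h'.add_ge a hN i
    simp only [hG]
    rw [← mul_add]
    refine mul_le_mul_of_nonneg_left (by linarith) (by positivity)
  set η := (1 - c) / c * (4 * c ^ 2 / 5) with hη_def
  -- Of two consecutive `G`, one is at least `η / 2`, which bounds `τ` there by `2 / η`. If this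
  -- happens only at `i + 1`, the recursion costs at most one extra `B i`.
  have hM : ∀ i, τ i ≤ slopeBound c k := by
    have b1 : ∀ i, η / 2 ≤ G i → τ i ≤ 2 / η := by
      intro i hi
      have h1 := hcoef.B_pos i
      have h2 := hτ0 (i + 1)
      have h3 := hcoef.G_nonneg i
      rw [hrec i, div_le_div_iff₀ (by positivity) hη]
      have : η / 2 * (τ (i + 1) + B i) ≤ G i * (τ (i + 1) + B i) :=
        mul_le_mul_of_nonneg_right hi (by positivity)
      linarith
    intro i
    unfold slopeBound
    rw [← hη_def]
    by_cases hi : η / 2 ≤ G i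
    · have := b1 i hi
      linarith
    · have h0 := b1 (i + 1) (by linarith [hGsum i])
      have h1 := hcoef.B_pos i
      have h2 := hτ0 (i + 1)
      have h3 := hcoef.G_nonneg i
      have h4 := hcoef.B_le i
      rw [hrec i]
      refine (div_le_self (by positivity) ?_).trans (by linarith)
      have : 0 ≤ G i * (τ (i + 1) + B i) := by positivity
      linarith
  have hlim := hcoef.eq_contFracLim a hτ0 hM hrec
  rw [← hlim]
  refine ⟨?_, hM 0⟩
  simp only [hτ]
  have := hp 0
  field_simp
  ring

end Slope

/-! ### The stable curves -/

/-- The left side of the phase space. -/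
def leftEdge (c : ℝ) : Set (ℝ × ℝ) := {Q | Q.1 ^ 2 = (third c Q - Q.2) ^ 2 ∧ Q.1 ≤ third c Q}

/-- The right upper side of the phase space. -/
def rightEdge (c : ℝ) : Set (ℝ × ℝ) := {Q | Q.1 = third c Q + Q.2}

section Curve

variable {c k : ℝ} {N : ℕ → ℝ}

theorem isClosed_leftEdge : IsClosed (leftEdge c) := by
  have := continuous_third (c := c)
  have e : leftEdge c = {Q | Q.1 ^ 2 = (third c Q - Q.2) ^ 2} ∩ {Q | Q.1 ≤ third c Q} := rfl
  rw [e]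
  exact (isClosed_eq (by fun_prop) (by fun_prop)).inter (isClosed_le (by fun_prop) (by fun_prop))

theorem isClosed_rightEdge : IsClosed (rightEdge c) := by
  have := continuous_third (c := c)
  exact isClosed_eq (by fun_prop) (by fun_prop)

theorem closedFuture_nonempty_inter (a : Adm c k) {C : Set (ℝ × ℝ)} (hC : IsClosed C)
    (h : ∀ n, (partialFuture c N n ∩ C).Nonempty) : (closedFuture c N ∩ C).Nonempty := by
  obtain ⟨Q, hQ⟩ := IsCompact.nonempty_iInter_of_sequence_nonempty_isCompact_isClosed
    (fun n => partialFuture c N n ∩ C)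
    (fun n => inter_subset_inter_left _ (partialFuture_anti N n)) h
    (a.isCompact_triangles.of_isClosed_subset ((isClosed_partialFuture N 0).inter hC)
      (inter_subset_left.trans (partialFuture_subset N 0)))
    fun n => (isClosed_partialFuture N n).inter hC
  rw [mem_iInter] at hQ
  exact ⟨Q, mem_closedFuture_iff.2 fun n => (hQ n).1, (hQ 0).2⟩

theorem exists_path_edges (a : Adm c k) (hN : IsWord k N) (n : ℕ) :
    ∃ γ : ℝ → ℝ × ℝ, ContinuousOn γ (Icc 0 1) ∧
      (∀ t ∈ Icc (0 : ℝ) 1, γ t ∈ partialFuture c N n) ∧ γ 0 ∈ rightEdge c ∧ γ 1 ∈ leftEdge c := by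
  obtain ⟨γ, hγ, hK, h0, h1, hF⟩ := exists_path_partialFuture a n hN
  have ht : ∀ t ∈ Icc (0 : ℝ) 1, third c (reversal c (γ t)) = (γ t).1 :=
    fun t ht => Config.third_eq a.c_pos (Config.symm (hK t ht))
  refine ⟨fun t => reversal c (γ t), continuous_reversal.comp_continuousOn hγ, hF, ?_, ?_⟩
  · change third c (γ 0) = third c (reversal c (γ 0)) + (γ 0).2
    rw [ht 0 ⟨le_rfl, zero_le_one⟩]
    exact h0.1
  · change third c (γ 1) ^ 2 = (third c (reversal c (γ 1)) - (γ 1).2) ^ 2 ∧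
      third c (γ 1) ≤ third c (reversal c (γ 1))
    rw [ht 1 ⟨zero_le_one, le_rfl⟩]
    exact ⟨h1.1, h1.2.1⟩

/-- A vertical difference belongs to the unstable cone. -/
theorem eq_of_fst_eq (a : Adm c k) (hN : IsWord k N) {Q Q' : ℝ × ℝ} (hQ : Q ∈ closedFuture c N)
    (hQ' : Q' ∈ closedFuture c N) (h : Q.1 = Q'.1) : Q = Q' := by
  have := (closedFuture_isOrbit hQ).eq_of_unstable a hN (closedFuture_isOrbit hQ') (by
    change 0 ≤ (Q.1 - Q'.1) * (Q.2 - Q'.2)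
    rw [h, sub_self, zero_mul])
  exact Prod.ext this.1 this.2

theorem leftEdge_le (a : Adm c k) (hN : IsWord k N) {Q Q' : ℝ × ℝ} (hQ : Q ∈ closedFuture c N)
    (hQ' : Q' ∈ closedFuture c N) (h : Q.1 ^ 2 = (third c Q - Q.2) ^ 2) : Q.1 ≤ Q'.1 := by
  refine (closedFuture_isOrbit hQ).left_le a hN (closedFuture_isOrbit hQ') ?_
  change third c Q = Q.1 + Q.2 ∨ Q.2 = Q.1 + third c Q
  rcases sq_eq_sq_iff_eq_or_eq_neg.1 h with h | h
  · exact Or.inl (by linarith)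
  · exact Or.inr (by linarith)

theorem le_rightEdge (a : Adm c k) (hN : IsWord k N) {Q Q' : ℝ × ℝ} (hQ : Q ∈ closedFuture c N)
    (hQ' : Q' ∈ closedFuture c N) (h : Q ∈ rightEdge c) : Q'.1 ≤ Q.1 :=
  (closedFuture_isOrbit hQ).le_right a hN (closedFuture_isOrbit hQ') h

theorem left_lt_third (a : Adm c k) (hN : IsWord k N) {Q : ℝ × ℝ} (hQ : Q ∈ closedFuture c N)
    (h : Q ∈ leftEdge c) : Q.1 < third c Q := by
  have o := closedFuture_isOrbit hQ
  refine lt_of_le_of_ne h.2 fun e => ?_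
  rcases sq_eq_sq_iff_eq_or_eq_neg.1 h.1 with h' | h'
  · exact o.not_top a hN e (show Q.2 = 0 by linarith)
  · exact o.not_bottom a hN e (show Q.2 = 2 * third c Q by linarith)

theorem third_lt_right (a : Adm c k) (hN : IsWord k N) {Q : ℝ × ℝ} (hQ : Q ∈ closedFuture c N)
    (h : Q ∈ rightEdge c) : third c Q < Q.1 := by
  have o := closedFuture_isOrbit hQ
  have h' : Q.1 = third c Q + Q.2 := h
  have hu : 0 ≤ Q.2 := (o.config 0).u_nonneg
  refine lt_of_le_of_ne (by linarith) fun e => ?_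
  exact o.not_top a hN e.symm (show Q.2 = 0 by linarith)

/-- The points with a given future are the graph of a function on an interval. -/
theorem exists_graph (a : Adm c k) (hN : IsWord k N) : ∃ (α β : ℝ) (g : ℝ → ℝ), α < β ∧ 0 ≤ α ∧
    (∀ v ∈ Icc α β, (v, g v) ∈ closedFuture c N) ∧
    (∀ Q ∈ closedFuture c N, Q.1 ∈ Icc α β ∧ Q.2 = g Q.1) ∧
    (α, g α) ∈ leftEdge c ∧ (β, g β) ∈ rightEdge c := by
  obtain ⟨l, hl, hlE⟩ := closedFuture_nonempty_inter a isClosed_leftEdge fun n => by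
    obtain ⟨γ, -, h, -, h1⟩ := exists_path_edges a hN n
    exact ⟨γ 1, h 1 ⟨zero_le_one, le_rfl⟩, h1⟩
  obtain ⟨r, hr, hrE⟩ := closedFuture_nonempty_inter a isClosed_rightEdge fun n => by
    obtain ⟨γ, -, h, h1, -⟩ := exists_path_edges a hN n
    exact ⟨γ 0, h 0 ⟨le_rfl, zero_le_one⟩, h1⟩
  have hbound : ∀ Q ∈ closedFuture c N, Q.1 ∈ Icc l.1 r.1 := fun Q hQ =>
    ⟨leftEdge_le a hN hl hQ hlE.1, le_rightEdge a hN hr hQ hrE⟩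
  have hlr : l.1 < r.1 := by
    refine lt_of_le_of_ne (hbound r hr).1 fun e => ?_
    have h1 := left_lt_third a hN hl hlE
    rw [eq_of_fst_eq a hN hl hr e] at h1
    exact h1.not_gt (third_lt_right a hN hr hrE)
  have hfib : ∀ v ∈ Icc l.1 r.1, ∃ u, (v, u) ∈ closedFuture c N := by
    intro v hv
    rcases hv.1.eq_or_lt with rfl | hlv
    · exact ⟨l.2, hl⟩
    rcases hv.2.eq_or_lt with rfl | hvr
    · exact ⟨r.2, hr⟩
    -- A path for finite `n` may end before reaching the vertical line at `v`. The enlarged closed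
    -- set also admits such misplaced ends; in the limit they contradict the extremality of `l` and
    -- `r`.
    have hC : IsClosed ({Q : ℝ × ℝ | Q.1 = v} ∪ (rightEdge c ∩ {Q | Q.1 ≤ v} ∪
        leftEdge c ∩ {Q | v ≤ Q.1})) :=
      (isClosed_eq (by fun_prop) (by fun_prop)).union
        ((isClosed_rightEdge.inter (isClosed_le (by fun_prop) (by fun_prop))).union
          (isClosed_leftEdge.inter (isClosed_le (by fun_prop) (by fun_prop))))
    obtain ⟨Q, hQ, hQC⟩ := closedFuture_nonempty_inter a hC fun n => by
      obtain ⟨γ, hγ, h, h0, h1⟩ := exists_path_edges a hN n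
      have z0 : (0 : ℝ) ∈ Icc (0 : ℝ) 1 := ⟨le_rfl, zero_le_one⟩
      have z1 : (1 : ℝ) ∈ Icc (0 : ℝ) 1 := ⟨zero_le_one, le_rfl⟩
      by_cases c0 : (γ 0).1 ≤ v
      · exact ⟨γ 0, h 0 z0, Or.inr (Or.inl ⟨h0, c0⟩)⟩
      by_cases c1 : v ≤ (γ 1).1
      · exact ⟨γ 1, h 1 z1, Or.inr (Or.inr ⟨h1, c1⟩)⟩
      obtain ⟨t, ht, e⟩ := intermediate_value_Icc' (zero_le_one (α := ℝ))
        (continuous_fst.comp_continuousOn hγ) ⟨(not_le.1 c1).le, (not_le.1 c0).le⟩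
      exact ⟨γ t, h t ht, Or.inl e⟩
    rcases hQC with h | ⟨h, h'⟩ | ⟨h, h'⟩
    · obtain rfl : Q.1 = v := h
      exact ⟨Q.2, hQ⟩
    · exact absurd ((le_rightEdge a hN hQ hr h).trans h') hvr.not_ge
    · exact absurd (h'.trans (leftEdge_le a hN hQ hl h.1)) hlv.not_ge
  choose! g hg using hfib
  have hgr : ∀ Q ∈ closedFuture c N, Q.2 = g Q.1 := fun Q hQ =>
    congrArg Prod.snd (eq_of_fst_eq a hN hQ (hg Q.1 (hbound Q hQ)) rfl)
  refine ⟨l.1, r.1, g, hlr, (closedFuture_isOrbit hl).config 0 |>.v_nonneg, hg,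
    fun Q hQ => ⟨hbound Q hQ, hgr Q hQ⟩, ?_, ?_⟩
  · rwa [← hgr l hl]
  · rwa [← hgr r hr]

/-- The slope of the secant of the curve of points with a given future. -/
noncomputable def secantSlope (c : ℝ) (N : ℕ → ℝ) (Q Q' : ℝ × ℝ) : ℝ :=
  contFracLim (fun i => (1 - c) / c * ((orb c N Q i).2 + (orb c N Q' i).2))
    fun i => 2 * c * N i / ((orb c N Q (i + 1)).1 + (orb c N Q' (i + 1)).1)

theorem continuous_secantSlope (a : Adm c k) (hN : IsWord k N) :
    Continuous fun y : closedFuture c N × closedFuture c N => secantSlope c N y.1 y.2 := by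
  have h1 : ∀ i, Continuous fun y : closedFuture c N × closedFuture c N => orb c N (y.1 : ℝ × ℝ) i :=
    fun i => (continuous_orb N i).comp (continuous_subtype_val.comp continuous_fst)
  have h2 : ∀ i, Continuous fun y : closedFuture c N × closedFuture c N => orb c N (y.2 : ℝ × ℝ) i :=
    fun i => (continuous_orb N i).comp (continuous_subtype_val.comp continuous_snd)
  refine ContractingCoeffs.continuous_contFracLim a (fun i => ?_) (fun i => ?_) fun y =>
    (closedFuture_isOrbit y.1.2).contractingCoeffs a hN (closedFuture_isOrbit y.2.2)
  · have := h1 i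
    have := h2 i
    fun_prop
  · refine continuous_const.div (((h1 _).fst).add (h2 _).fst) fun y => ?_
    have p1 := (closedFuture_isOrbit y.1.2).v_pos a i
    have p2 := (closedFuture_isOrbit y.2.2).v_pos a i
    exact (add_pos p1 p2).ne'

/-- The curve of the points with a given future is smooth. -/
theorem graph_smooth (a : Adm c k) (hN : IsWord k N) {α β : ℝ} {g : ℝ → ℝ} (hα : 0 ≤ α)
    (hg : ∀ v ∈ Icc α β, (v, g v) ∈ closedFuture c N) :
    ContinuousOn g (Icc α β) ∧ ∃ s : ℝ → ℝ, ContinuousOn s (Icc α β) ∧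
      (∀ v ∈ Icc α β, 0 < s v ∧ 2 * ((1 - c) / c) * g v * s v < 1) ∧
      ∀ v ∈ Ioo α β, HasDerivAt g (-(s v * (2 * v))) v := by
  have hsec : ∀ v ∈ Icc α β, ∀ v' ∈ Icc α β, v ≠ v' →
      g v' - g v = -secantSlope c N (v, g v) (v', g v') * (v' ^ 2 - v ^ 2) ∧
      secantSlope c N (v, g v) (v', g v') ≤ slopeBound c k := fun v hv v' hv' hne =>
    (closedFuture_isOrbit (hg v hv)).slope_eq a hN (closedFuture_isOrbit (hg v' hv')) hne
  have hpos : ∀ v ∈ Icc α β, ∀ v' ∈ Icc α β, 0 < secantSlope c N (v, g v) (v', g v') ∧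
      (1 - c) / c * (g v + g v') * secantSlope c N (v, g v) (v', g v') < 1 := fun v hv v' hv' =>
    ((closedFuture_isOrbit (hg v hv)).contractingCoeffs a hN
      (closedFuture_isOrbit (hg v' hv'))).contFracLim_pos a
  have hle : ∀ v ∈ Icc α β, v ≤ 3 / 2 := fun v hv =>
    ((closedFuture_isOrbit (hg v hv)).config 0).v_le_bound a
  have hgc : ContinuousOn g (Icc α β) := by
    refine (LipschitzOnWith.of_dist_le_mul (K := (slopeBound c k * 3).toNNReal) ?_).continuousOn
    intro v hv v' hv'
    rcases eq_or_ne v v' with rfl | hne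
    · simp
    obtain ⟨h1, h2⟩ := hsec v' hv' v hv hne.symm
    have h3 := (hpos v' hv' v hv).1
    rw [Real.dist_eq, Real.dist_eq, h1, abs_mul, abs_neg, abs_of_pos h3, sq_sub_sq, abs_mul,
      Real.coe_toNNReal _ (by nlinarith), mul_assoc]
    refine mul_le_mul h2 ?_ (by positivity) (h3.le.trans h2)
    refine mul_le_mul_of_nonneg_right ?_ (abs_nonneg _)
    have := hle v hv
    have := hle v' hv'
    have := hα.trans hv.1
    have := hα.trans hv'.1
    rw [abs_of_nonneg (by linarith)]
    linarith
  obtain ⟨q, hq, hqc⟩ : ∃ q : Icc α β → closedFuture c N,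
      (∀ v, (q v : ℝ × ℝ) = ((v : ℝ), g v)) ∧ Continuous q := by
    rw [continuousOn_iff_continuous_domRestrict] at hgc
    exact ⟨fun v => ⟨((v : ℝ), g v), hg v v.2⟩, fun v => rfl,
      (continuous_subtype_val.prodMk hgc).subtype_mk _⟩
  have hcs : ∀ p : Icc α β → closedFuture c N, Continuous p →
      ContinuousOn (fun x => if hx : x ∈ Icc α β then
        secantSlope c N (p ⟨x, hx⟩) (x, g x) else 0) (Icc α β) := by
    intro p hp
    rw [continuousOn_iff_continuous_domRestrict]
    refine ((continuous_secantSlope a hN).comp (hp.prodMk hqc)).congr fun x => ?_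
    simp [Set.domRestrict, hq]
  refine ⟨hgc, fun v => secantSlope c N (v, g v) (v, g v), ?_, fun v hv => ⟨(hpos v hv v hv).1, ?_⟩,
    fun v hv => ?_⟩
  · refine (hcs q hqc).congr fun x hx => ?_
    simp only [dif_pos hx, hq]
  · have := (hpos v hv v hv).2
    linarith
  · have hv' : v ∈ Icc α β := Ioo_subset_Icc_self hv
    have hcont : ContinuousOn (fun x => secantSlope c N (v, g v) (x, g x)) (Icc α β) := by
      refine (hcs (fun _ => q ⟨v, hv'⟩) continuous_const).congr fun x hx => ?_
      simp only [dif_pos hx, hq]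
    have hnhds : Icc α β ∈ 𝓝 v := Icc_mem_nhds hv.1 hv.2
    -- The difference quotient of `g` is minus the slope with respect to `v²` times `x + v`;
    -- continuity of the secant slope up to the diagonal gives the derivative.
    have hlim : Tendsto (fun x => -(secantSlope c N (v, g v) (x, g x) * (x + v))) (𝓝[≠] v)
        (𝓝 (-(secantSlope c N (v, g v) (v, g v) * (2 * v)))) := by
      have h1 : ContinuousAt (fun x => -(secantSlope c N (v, g v) (x, g x) * (x + v))) v :=
        ((hcont.continuousAt hnhds).mul (continuousAt_id.add continuousAt_const)).neg
      have h2 := h1.tendsto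
      simp only [← two_mul] at h2
      exact h2.mono_left nhdsWithin_le_nhds
    rw [hasDerivAt_iff_tendsto_slope]
    refine hlim.congr' ?_
    filter_upwards [self_mem_nhdsWithin, mem_nhdsWithin_of_mem_nhds hnhds] with x hx hxI
    have hx' : x - v ≠ 0 := sub_ne_zero.2 hx
    rw [slope_def_field, (hsec v hv' x hxI (Ne.symm hx)).1]
    field_simp
    ring

end Curve

/-! ### Transfer to the phase space -/

/-- The interior of the closed phase space. -/
def openTriangles (c : ℝ) : Set (ℝ × ℝ) :=
  {Q | Q ∈ triangles c ∧ Q.2 < Q.1 + third c Q ∧ Q.1 < third c Q + Q.2 ∧ third c Q < Q.1 + Q.2}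

/-- The scaling factor between the relative velocity and the third side of the triangle. -/
def rescale (m : ℝ) : ℝ := 2 * (1 - m)

/-- The sides of the triangle. -/
noncomputable def toSides (m : ℝ) (p : ℝ × ℝ) : ℝ × ℝ := (√(2 * p.1 / m), -rescale m * p.2)

/-- The inverse of `toSides`. -/
noncomputable def ofSides (m : ℝ) (Q : ℝ × ℝ) : ℝ × ℝ := (m * Q.1 ^ 2 / 2, -Q.2 / rescale m)

/-- The time reversal in the original coordinates. -/
noncomputable def rev (m : ℝ) (p : ℝ × ℝ) : ℝ × ℝ := (m * F m p, p.2)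

section Transfer

variable {m k : ℝ} {p q Q : ℝ × ℝ}

theorem rescale_pos (h1 : m < 1) : 0 < rescale m := by unfold rescale; linarith

theorem two_F_eq (h0 : 0 < m) (h1 : m < 1) (hp : 0 ≤ p.1) :
    2 - (toSides m p).1 ^ 2 - (1 - rescale m) / rescale m * (toSides m p).2 ^ 2 = 2 * F m p := by
  have hc : 1 - m ≠ 0 := by linarith
  simp only [toSides, F, alpha, rescale]
  rw [Real.sq_sqrt (by positivity)]
  field_simp
  ring

theorem third_toSides (h0 : 0 < m) (h1 : m < 1) (hp : 0 ≤ p.1) :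
    third (rescale m) (toSides m p) = √(2 * F m p) := by
  rw [third, two_F_eq h0 h1 hp]

/-- Up to positive factors the two phase space inequalities read `(v - u)² < w²` and `w² < (v +
u)²`. Together they force `vu > 0`, hence `u > 0`, and amount to the strict triangle inequalities.
-/
theorem mem_phaseSpace_iff (h0 : 0 < m) (h1 : m < 1) :
    p ∈ phaseSpace m ↔ toSides m p ∈ openTriangles (rescale m) := by
  have hc := rescale_pos h1
  have key : 0 ≤ p.1 →
      2 * F m p - ((toSides m p).1 - (toSides m p).2) ^ 2 =
        4 * (1 / 2 - p.1 - 1 / 2 * (1 - m) * (p.2 + √(2 * p.1 / m)) ^ 2) ∧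
      m * (2 * F m p - ((toSides m p).1 + (toSides m p).2) ^ 2) =
        2 * (m * (1 - m) * p.2 * (2 * √(2 * p.1 / m) - p.2) - 2 * p.1 + m) := by
    intro hp
    have hv : √(2 * p.1 / m) ^ 2 = 2 * p.1 / m := Real.sq_sqrt (by positivity)
    have hv' : m * √(2 * p.1 / m) ^ 2 = 2 * p.1 := by rw [hv]; field_simp
    have hF : m * F m p = m - p.1 + m * alpha m * p.2 ^ 2 := by
      simp only [F]; field_simp
    simp only [toSides]
    set v := √(2 * p.1 / m)
    have hp1 : p.1 = m * v ^ 2 / 2 := by linarith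
    have hF' : F m p = 1 - v ^ 2 / 2 + alpha m * p.2 ^ 2 := by
      apply mul_left_cancel₀ h0.ne'
      rw [hF, hp1]; ring
    rw [hF', hp1]
    simp only [alpha, rescale]
    constructor <;> ring
  constructor
  · rintro ⟨⟨hp0, hp1⟩, hq, hr⟩
    obtain ⟨e1, e2⟩ := key hp0.le
    have hw := third_toSides h0 h1 hp0.le
    have hE := two_F_eq h0 h1 hp0.le
    have hv : 0 < (toSides m p).1 := Real.sqrt_pos.2 (by positivity)
    set v := (toSides m p).1
    set u := (toSides m p).2
    have b1 : (v - u) ^ 2 < 2 * F m p := by linarith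
    have b2 : 2 * F m p < (v + u) ^ 2 := by
      have : m * (2 * F m p - (v + u) ^ 2) < 0 := by linarith
      have := neg_of_mul_neg_right this h0.le
      linarith
    have hF : 0 ≤ 2 * F m p := (sq_nonneg _).trans b1.le
    have hw2 : third (rescale m) (toSides m p) ^ 2 = 2 * F m p := by rw [hw, Real.sq_sqrt hF]
    have hw0 : 0 ≤ third (rescale m) (toSides m p) := Real.sqrt_nonneg _
    have hu : 0 < u := by
      have : 0 < v * u := by nlinarith
      exact pos_of_mul_pos_right this hv.le
    rw [← hw2] at b1 b2
    have c1 := abs_lt_of_sq_lt_sq b1 hw0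
    have c2 := (sq_lt_sq₀ hw0 (by positivity)).1 b2
    rw [abs_lt] at c1
    refine ⟨⟨?_, ?_, ?_, c2.le⟩, ?_, ?_, c2⟩
    · exact third_energy hc (by rw [hE]; exact hF)
    all_goals linarith
  · rintro ⟨hK, s1, s2, s3⟩
    have hK' : Config (rescale m) (toSides m p).1 (third (rescale m) (toSides m p))
      (toSides m p).2 := hK
    have hv : 0 < (toSides m p).1 := by linarith
    have hw0 : 0 < third (rescale m) (toSides m p) := by linarith
    have hp0 : 0 < p.1 := by
      have := Real.sqrt_pos.1 hv
      rw [div_pos_iff_of_pos_right h0] at this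
      linarith
    obtain ⟨e1, e2⟩ := key hp0.le
    have hw := third_toSides h0 h1 hp0.le
    have hF : 0 < 2 * F m p := by
      rw [hw] at hw0
      exact Real.sqrt_pos.1 hw0
    have hw2 : third (rescale m) (toSides m p) ^ 2 = 2 * F m p := by rw [hw, Real.sq_sqrt hF.le]
    rw [← hw2] at e1 e2
    have b1 : ((toSides m p).1 - (toSides m p).2) ^ 2 < third (rescale m) (toSides m p) ^ 2 :=
      sq_lt_sq' (by linarith) (by linarith)
    have b2 : third (rescale m) (toSides m p) ^ 2 < ((toSides m p).1 + (toSides m p).2) ^ 2 :=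
      pow_lt_pow_left₀ s3 hw0.le two_ne_zero
    have hq : 1 / 2 - p.1 > 1 / 2 * (1 - m) * (p.2 + √(2 * p.1 / m)) ^ 2 := by linarith
    have hq0 : 0 ≤ 1 / 2 * (1 - m) * (p.2 + √(2 * p.1 / m)) ^ 2 :=
      mul_nonneg (by linarith) (sq_nonneg _)
    refine ⟨⟨hp0, by linarith⟩, hq, ?_⟩
    have : m * (third (rescale m) (toSides m p) ^ 2 -
      ((toSides m p).1 + (toSides m p).2) ^ 2) < 0 := mul_neg_of_pos_of_neg h0 (by linarith)
    linarith

theorem toSides_floorHit (h0 : 0 < m) (h1 : m < 1) (hp : 0 ≤ p.1) (n : ℕ) :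
    toSides m (floorHit m n p) = step (rescale m) (n + 1) (toSides m p) := by
  rw [step, third_toSides h0 h1 hp]
  have : 2 * (m * F m p) / m = 2 * F m p := by field_simp
  ext
  · simp only [toSides, floorHit, this]
  · simp only [toSides, floorHit]
    ring

theorem toSides_rev (h0 : 0 < m) (h1 : m < 1) (hp : 0 ≤ p.1) :
    toSides m (rev m p) = reversal (rescale m) (toSides m p) := by
  rw [reversal, third_toSides h0 h1 hp]
  have : 2 * (m * F m p) / m = 2 * F m p := by field_simp
  simp only [toSides, rev, this]

theorem toSides_ofSides (h0 : 0 < m) (h1 : m < 1) (hQ : 0 ≤ Q.1) :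
    toSides m (ofSides m Q) = Q := by
  have hc := rescale_pos h1
  have : 2 * (m * Q.1 ^ 2 / 2) / m = Q.1 ^ 2 := by field_simp
  ext
  · simp only [toSides, ofSides, this, Real.sqrt_sq hQ]
  · simp only [toSides, ofSides]
    field_simp

theorem ofSides_toSides (h0 : 0 < m) (h1 : m < 1) (hp : 0 ≤ p.1) :
    ofSides m (toSides m p) = p := by
  have hc := rescale_pos h1
  ext
  · simp only [toSides, ofSides]
    rw [Real.sq_sqrt (by positivity)]
    field_simp
  · simp only [toSides, ofSides]
    field_simp

theorem fst_pos_of_mem (hp : p ∈ phaseSpace m) : 0 < p.1 := hp.1.1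

theorem F_rev (h0 : 0 < m) : m * F m (rev m p) = p.1 := by
  simp only [rev, F]
  field_simp
  ring

theorem rev_rev (h0 : 0 < m) : rev m (rev m p) = p := Prod.ext (F_rev h0) rfl

theorem reversal_mem_openTriangles {c : ℝ} (hc : 0 < c) (hQ : Q ∈ openTriangles c) :
    reversal c Q ∈ openTriangles c := by
  obtain ⟨hK, s1, s2, s3⟩ := hQ
  have h : Config c Q.1 (third c Q) Q.2 := hK
  have e : third c (reversal c Q) = Q.1 := h.symm.third_eq hc
  refine ⟨h.symm.mem_triangles hc, ?_⟩
  rw [e]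
  exact ⟨by simp only [reversal]; linarith, s3, s2⟩

theorem rev_mem (h0 : 0 < m) (h1 : m < 1) (hp : p ∈ phaseSpace m) : rev m p ∈ phaseSpace m := by
  have hp0 := (fst_pos_of_mem hp).le
  rw [mem_phaseSpace_iff h0 h1] at hp ⊢
  rw [toSides_rev h0 h1 hp0]
  exact reversal_mem_openTriangles (rescale_pos h1) hp

theorem rev_mem_iff (h0 : 0 < m) (h1 : m < 1) : rev m p ∈ phaseSpace m ↔ p ∈ phaseSpace m :=
  ⟨fun h => by rw [← rev_rev (p := p) h0]; exact rev_mem h0 h1 h, rev_mem h0 h1⟩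

theorem floorHit_rev (h0 : 0 < m) (n : ℕ) :
    floorHit m n (rev m (floorHit m n p)) = rev m p := by
  have h := F_rev (p := floorHit m n p) h0
  have e : F m (rev m (floorHit m n p)) = F m p := by
    apply mul_left_cancel₀ h0.ne'
    rw [h]
    rfl
  rw [floorHit, e]
  simp [rev, floorHit]

/-- The number of bumps before the return is unique. -/
theorem mem_R_iff (h0 : 0 < m) (h1 : m < 1) {n : ℕ} :
    p ∈ R m n ↔ p ∈ phaseSpace m ∧ floorHit m n p ∈ phaseSpace m := by
  refine ⟨fun h => ⟨h.1, h.2.1⟩, fun ⟨hp, hn⟩ => ⟨hp, hn, fun j hj hj' => ?_⟩⟩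
  have hc := rescale_pos h1
  have hp0 := (fst_pos_of_mem hp).le
  rw [mem_phaseSpace_iff h0 h1] at hp hn hj'
  rw [toSides_floorHit h0 h1 hp0] at hn hj'
  set Q := toSides m p
  set c := rescale m
  obtain ⟨hK, s1, s2, s3⟩ := hp
  have hK' : Config c Q.1 (third c Q) Q.2 := hK
  obtain ⟨hA, a1, a2, a3⟩ := hj'
  have hA' : Config c (third c Q) (third c (step c (j + 1) Q)) (2 * c * (j + 1) * third c Q - Q.2) :=
    hA
  obtain ⟨hB, b1, b2, b3⟩ := hn
  have hB' : Config c (third c Q) (third c (step c (n + 1) Q)) (2 * c * (n + 1) * third c Q - Q.2) :=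
    hB
  simp only [step] at a1 a2 a3 b1 b2 b3
  -- Landing in the phase space at `j` makes the height negative one bump later. The heights lie on
  -- a concave parabola that starts nonnegative, so they remain negative, whereas landing at `n > j`
  -- requires a positive height.
  have e1 := height_eq₃ hc.ne' hK'.energy hA'.energy (N := (j : ℝ) + 1) (by ring)
  have e2 := height_eq₁ hc.ne' hK'.energy hB'.energy (N := (n : ℝ) + 1) (by ring)
  have c1 : third c (step c (j + 1) Q) ^ 2 <
      (third c Q + (2 * c * (j + 1) * third c Q - Q.2)) ^ 2 :=
    pow_lt_pow_left₀ a3 hA'.w_nonneg two_ne_zero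
  have c2 : (third c Q - (2 * c * (n + 1) * third c Q - Q.2)) ^ 2 <
      third c (step c (n + 1) Q) ^ 2 :=
    sq_lt_sq' (by simp only [step]; linarith) (by simp only [step]; linarith)
  have c3 := hK'.sub_sq_le
  have hw : 0 < third c Q := by linarith
  set w := third c Q
  set u := Q.2
  have hjn : (j : ℝ) + 1 ≤ n := by exact_mod_cast hj
  have hj0 : (0 : ℝ) ≤ j := j.cast_nonneg
  have d1 : 4 * ((j : ℝ) + 1) * w * (u - c * (j + 1 + 1) * w) < 0 := by linarith
  have d2 : u - c * (j + 1 + 1) * w < 0 := neg_of_mul_neg_right d1 (by positivity)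
  have d3 : (n : ℝ) * (u - c * (n + 1) * w) ≤ (j + 1) * (u - c * (j + 1 + 1) * w) := by
    have hcw := mul_pos hc hw
    have : (n : ℝ) * (u - c * (n + 1) * w) ≤ n * (u - c * (j + 1 + 1) * w) :=
      mul_le_mul_of_nonneg_left (by nlinarith) (by linarith)
    nlinarith
  have d4 : 4 * w * ((n : ℝ) * (u - c * (n + 1) * w)) ≤
    4 * w * ((j + 1) * (u - c * (j + 1 + 1) * w)) := mul_le_mul_of_nonneg_left d3 (by positivity)
  linarith

theorem T_eq_floorHit {n : ℕ} (hp : p ∈ R m n) : T m p = floorHit m n p := by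
  rw [T, bumps_eq hp]

theorem rev_T_mem (h0 : 0 < m) (h1 : m < 1) {n : ℕ} (hp : p ∈ R m n) :
    rev m (T m p) ∈ R m n ∧ T m (rev m (T m p)) = rev m p := by
  have h : rev m (T m p) ∈ R m n := by
    rw [T_eq_floorHit hp, mem_R_iff h0 h1, floorHit_rev h0]
    exact ⟨rev_mem h0 h1 hp.2.1, rev_mem h0 h1 hp.1⟩
  refine ⟨h, ?_⟩
  rw [T_eq_floorHit h, T_eq_floorHit hp, floorHit_rev h0]

/-- The sequence of symbols, increased by one, of the future. -/
def word (x : ℤ → ℕ) (i : ℕ) : ℝ := x i + 1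

/-- The reversed sequence. -/
def reverse (x : ℤ → ℕ) (i : ℤ) : ℕ := x (-(i + 1))

theorem toSides_iterate (h0 : 0 < m) (h1 : m < 1) {x : ℤ → ℕ} (h : p ∈ futureSet m x) (i : ℕ) :
    toSides m ((T m)^[i] p) = orb (rescale m) (word x) (toSides m p) i := by
  induction i with
  | zero => rfl
  | succ i ih =>
    rw [Function.iterate_succ_apply', T_eq_floorHit (h i),
      toSides_floorHit h0 h1 (fst_pos_of_mem (h i).1).le, ih]
    rfl

theorem mem_futureSet_iff_orb (h0 : 0 < m) (h1 : m < 1) {x : ℤ → ℕ} : p ∈ futureSet m x ↔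
    ∀ i, orb (rescale m) (word x) (toSides m p) i ∈ openTriangles (rescale m) := by
  constructor
  · intro h i
    rw [← toSides_iterate h0 h1 h, ← mem_phaseSpace_iff h0 h1]
    exact (h i).1
  · intro h
    have key : ∀ i, toSides m ((T m)^[i] p) = orb (rescale m) (word x) (toSides m p) i ∧
        (T m)^[i] p ∈ R m (x i) := by
      have aux : ∀ i, toSides m ((T m)^[i] p) = orb (rescale m) (word x) (toSides m p) i →
          (T m)^[i] p ∈ R m (x i) := by
        intro i hi
        have hm : (T m)^[i] p ∈ phaseSpace m := by
          rw [mem_phaseSpace_iff h0 h1, hi]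
          exact h i
        rw [mem_R_iff h0 h1]
        refine ⟨hm, ?_⟩
        rw [mem_phaseSpace_iff h0 h1, toSides_floorHit h0 h1 (fst_pos_of_mem hm).le, hi]
        exact h (i + 1)
      intro i
      induction i with
      | zero => exact ⟨rfl, aux 0 rfl⟩
      | succ i ih =>
        have : toSides m ((T m)^[i + 1] p) = orb (rescale m) (word x) (toSides m p) (i + 1) := by
          rw [Function.iterate_succ_apply', T_eq_floorHit ih.2,
            toSides_floorHit h0 h1 (fst_pos_of_mem ih.2.1).le, ih.1]
          rfl
        exact ⟨this, aux _ this⟩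
    exact fun i => (key i).2

/-- Only the initial point has to be checked to be interior: `strict_succ` propagates this along a
closed orbit. -/
theorem mem_futureSet_iff (a : Adm (rescale m) k) (h0 : 0 < m) (h1 : m < 1) {x : ℤ → ℕ}
    (hN : IsWord k (word x)) : p ∈ futureSet m x ↔
      p ∈ phaseSpace m ∧ toSides m p ∈ closedFuture (rescale m) (word x) := by
  rw [mem_futureSet_iff_orb h0 h1, mem_phaseSpace_iff h0 h1]
  refine ⟨fun h => ⟨h 0, fun i => (h i).1⟩, fun ⟨h, hF⟩ => ?_⟩
  have key : ∀ (i : ℕ) (N : ℕ → ℝ) (Q : ℝ × ℝ), IsWord k N → Q ∈ openTriangles (rescale m) →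
      Q ∈ closedFuture (rescale m) N → orb (rescale m) N Q i ∈ openTriangles (rescale m) := by
    intro i
    induction i with
    | zero => exact fun _ _ _ h _ => h
    | succ i ih =>
      intro N Q hN hQ hF
      rw [orb_succ]
      refine ih _ _ hN.shift ⟨hF 1, ?_⟩ fun i => ?_
      · exact (closedFuture_isOrbit hF).strict_succ a hN hQ.2.1 hQ.2.2.1 hQ.2.2.2
      · rw [← orb_succ]
        exact hF (i + 1)
  exact fun i => key i _ _ hN h hF

theorem isBackwardOrbit_rev (h0 : 0 < m) (h1 : m < 1) {x : ℤ → ℕ}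
    (h : rev m p ∈ futureSet m x) :
    IsBackwardOrbit m (fun i => rev m ((T m)^[i] (rev m p))) p ∧
      ∀ i : ℕ, rev m ((T m)^[i + 1] (rev m p)) ∈ R m (x i) := by
  have key : ∀ i : ℕ, rev m ((T m)^[i + 1] (rev m p)) ∈ R m (x i) ∧
      T m (rev m ((T m)^[i + 1] (rev m p))) = rev m ((T m)^[i] (rev m p)) := by
    intro i
    rw [Function.iterate_succ_apply']
    exact rev_T_mem h0 h1 (h i)
  exact ⟨⟨rev_rev h0, fun i => ⟨⟨_, (key i).1⟩, (key i).2⟩⟩, fun i => (key i).1⟩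

/-- Reversal conjugates `T` to its inverse, and the step leading from time `-(i + 1)` to `-i`
becomes the `i`-th step of the reversed future; hence the index shift in `reverse`. -/
theorem mem_pastSet_iff (h0 : 0 < m) (h1 : m < 1) {x : ℤ → ℕ} :
    p ∈ pastSet m x ↔ rev m p ∈ futureSet m (reverse x) := by
  constructor
  · rintro ⟨o, ⟨ho, hT⟩, hR⟩
    have key : ∀ i, (T m)^[i] (rev m p) = rev m (o i) := by
      intro i
      induction i with
      | zero => rw [ho]; rfl
      | succ i ih =>
        rw [Function.iterate_succ_apply', ih, ← (hT i).2]
        exact (rev_T_mem h0 h1 (hR i)).2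
    intro i
    rw [key i, ← (hT i).2]
    exact (rev_T_mem h0 h1 (hR i)).1
  · intro h
    obtain ⟨b1, b2⟩ := isBackwardOrbit_rev h0 h1 h
    exact ⟨_, b1, b2⟩

theorem hasItinerary_iff (h0 : 0 < m) (h1 : m < 1) {x : ℤ → ℕ} : HasItinerary m p x ↔
    p ∈ futureSet m x ∧ rev m p ∈ futureSet m (reverse x) := by
  constructor
  · rintro ⟨o, ho, h⟩
    refine ⟨?_, (mem_pastSet_iff h0 h1).1 ?_⟩
    · have key : ∀ i : ℕ, (T m)^[i] p = o i := by
        intro i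
        induction i with
        | zero => rw [Int.natCast_zero, ho]; rfl
        | succ i ih =>
          rw [Function.iterate_succ_apply', ih, (h i).2]
          rfl
      intro i
      rw [key i]
      exact (h i).1
    · refine ⟨fun i => o (-(i : ℤ)), ⟨by simpa using ho, fun i => ⟨⟨_, (h _).1⟩, ?_⟩⟩, fun i => ?_⟩
      · rw [(h _).2]
        congr 1
        push_cast
        ring
      · have := (h (-((i : ℤ) + 1))).1
        simpa using this
  · rintro ⟨hf, hp⟩
    obtain ⟨⟨hb0, hb⟩, hbR⟩ := isBackwardOrbit_rev h0 h1 hp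
    refine ⟨fun i => match i with
      | Int.ofNat n => (T m)^[n] p
      | Int.negSucc n => rev m ((T m)^[n + 1] (rev m p)), rfl, ?_⟩
    rintro (n | n)
    · refine ⟨hf n, ?_⟩
      exact (Function.iterate_succ_apply' (T m) n p).symm
    · refine ⟨hbR n, (hb n).2.trans ?_⟩
      rcases n with _ | n
      · exact hb0
      · rfl

end Transfer

/-! ### The stable and unstable manifolds -/

section Manifolds

variable {m k : ℝ} {p q : ℝ × ℝ} {x : ℤ → ℕ}

theorem dist_le_of_sides (h0 : 0 < m) (h1 : m < 1) (hp : 0 ≤ p.1) (hq : 0 ≤ q.1) {D E : ℝ}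
    (bp : (toSides m p).1 ≤ 3 / 2) (bq : (toSides m q).1 ≤ 3 / 2)
    (hv : |(toSides m p).1 - (toSides m q).1| ≤ D) (hu : |(toSides m p).2 - (toSides m q).2| ≤ E) :
    dist p q ≤ 3 * D + E / rescale m := by
  have hc := rescale_pos h1
  rw [← ofSides_toSides h0 h1 hp, ← ofSides_toSides h0 h1 hq]
  have n1 : 0 ≤ (toSides m p).1 := Real.sqrt_nonneg _
  have n2 : 0 ≤ (toSides m q).1 := Real.sqrt_nonneg _
  set P := toSides m p
  set Q := toSides m q
  have hD : 0 ≤ D := (abs_nonneg _).trans hv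
  have hE : 0 ≤ E := (abs_nonneg _).trans hu
  have hEc : 0 ≤ E / rescale m := by positivity
  rw [Prod.dist_eq]
  refine max_le ?_ ?_
  · simp only [ofSides, Real.dist_eq]
    have e : m * P.1 ^ 2 / 2 - m * Q.1 ^ 2 / 2 = m / 2 * (P.1 + Q.1) * (P.1 - Q.1) := by ring
    rw [e, abs_mul, abs_of_nonneg (by positivity)]
    have : m / 2 * (P.1 + Q.1) ≤ 3 := by nlinarith
    have := mul_le_mul this hv (abs_nonneg _) (by norm_num)
    linarith
  · simp only [ofSides, Real.dist_eq]
    rw [← sub_div, abs_div, abs_of_pos hc]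
    have e : |-P.2 - -Q.2| = |P.2 - Q.2| := by rw [← abs_neg]; congr 1; ring
    rw [e]
    have : |P.2 - Q.2| / rescale m ≤ E / rescale m := by gcongr
    linarith

/-- A constant for the exponential contraction. -/
theorem IsOrbit.exists_asymptotic {c : ℝ} (a : Adm c k) : ∃ C : ℝ,
    ∀ (N v u v' u' : ℕ → ℝ), IsWord k N → IsOrbit c N v u → IsOrbit c N v' u' → ∀ n,
      |u n - u' n| ≤ C * contr c ^ n ∧ |v n - v' n| ≤ C * contr c ^ n ∧
      |v (n + 1) - v' (n + 1)| ≤ C * contr c ^ n := by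
  have hp := a.contr_pos
  have hl := a.contr_lt_one
  have hc := a.c_pos
  set A := 3 / contr c
  set B := A / (2 * c)
  have hA : 0 ≤ A := by positivity
  have hB : 0 ≤ B := by positivity
  have hBl : B ≤ B / contr c := le_div_self hB hp hl.le
  -- The available estimate for `v` has index `n + 1`: dividing `B` by `contr c` shifts it, and the
  -- summand `3` covers `v 0`.
  refine ⟨A + B / contr c + 3, fun N v u v' u' hN h h' n => ?_⟩
  have hpow : 0 ≤ contr c ^ n := by positivity
  obtain ⟨b1, b2⟩ := h.asymptotic a hN h' n
  refine ⟨b1.trans (mul_le_mul_of_nonneg_right (by linarith) hpow), ?_,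
    b2.trans (mul_le_mul_of_nonneg_right (by linarith) hpow)⟩
  rcases n with _ | n
  · have := (h.config 0).v_nonneg
    have := (h'.config 0).v_nonneg
    have := (h.config 0).v_le_bound a
    have := (h'.config 0).v_le_bound a
    rw [pow_zero, mul_one]
    have : 0 ≤ B / contr c := hB.trans hBl
    exact abs_le.2 ⟨by linarith, by linarith⟩
  · have b3 := (h.asymptotic a hN h' n).2
    refine b3.trans ?_
    have e : A / (2 * c) * contr c ^ n = B / contr c * contr c ^ (n + 1) := by
      simp only [B, pow_succ]; field_simp
    rw [e]
    exact mul_le_mul_of_nonneg_right (by linarith) hpow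

theorem forwardAsymptotic (a : Adm (rescale m) k) (h0 : 0 < m) (h1 : m < 1)
    (hN : IsWord k (word x)) (hp : p ∈ futureSet m x) :
    ForwardAsymptotic m p (futureSet m x) := by
  obtain ⟨C, hC⟩ := IsOrbit.exists_asymptotic a
  refine ⟨hp, 3 * C + C / rescale m, contr (rescale m), a.contr_pos, a.contr_lt_one,
    fun q hq n => ⟨⟨_, hp n, hq n⟩, ?_⟩⟩
  have op := closedFuture_isOrbit ((mem_futureSet_iff a h0 h1 hN).1 hp).2
  have oq := closedFuture_isOrbit ((mem_futureSet_iff a h0 h1 hN).1 hq).2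
  obtain ⟨b1, b2, -⟩ := hC _ _ _ _ _ hN oq op n
  have cp := (op.config n).v_le_bound a
  have cq := (oq.config n).v_le_bound a
  simp only [← toSides_iterate h0 h1 hp] at b1 b2 cp
  simp only [← toSides_iterate h0 h1 hq] at b1 b2 cq
  refine (dist_le_of_sides h0 h1 (fst_pos_of_mem (hq n).1).le (fst_pos_of_mem (hp n).1).le cq cp
    b2 b1).trans (le_of_eq ?_)
  ring

theorem backwardAsymptotic (a : Adm (rescale m) k) (h0 : 0 < m) (h1 : m < 1)
    (hN : IsWord k (word (reverse x))) (hp : p ∈ pastSet m x) :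
    BackwardAsymptotic m p (pastSet m x) := by
  obtain ⟨C, hC⟩ := IsOrbit.exists_asymptotic a
  refine ⟨hp, 3 * C + C / rescale m, contr (rescale m), a.contr_pos, a.contr_lt_one,
    fun q hq => ?_⟩
  have hp' := (mem_pastSet_iff h0 h1).1 hp
  have hq' := (mem_pastSet_iff h0 h1).1 hq
  obtain ⟨bp, rp⟩ := isBackwardOrbit_rev h0 h1 hp'
  obtain ⟨bq, rq⟩ := isBackwardOrbit_rev h0 h1 hq'
  refine ⟨_, _, bp, bq, fun n => ⟨⟨_, rp n, rq n⟩, ?_⟩⟩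
  have op := closedFuture_isOrbit ((mem_futureSet_iff a h0 h1 hN).1 hp').2
  have oq := closedFuture_isOrbit ((mem_futureSet_iff a h0 h1 hN).1 hq').2
  obtain ⟨b1, -, b2⟩ := hC _ _ _ _ _ hN oq op n
  have ep : toSides m (rev m ((T m)^[n] (rev m p))) = reversal (rescale m)
      (orb (rescale m) (word (reverse x)) (toSides m (rev m p)) n) := by
    rw [toSides_rev h0 h1 (fst_pos_of_mem (hp' n).1).le, toSides_iterate h0 h1 hp']
  have eq : toSides m (rev m ((T m)^[n] (rev m q))) = reversal (rescale m)
      (orb (rescale m) (word (reverse x)) (toSides m (rev m q)) n) := by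
    rw [toSides_rev h0 h1 (fst_pos_of_mem (hq' n).1).le, toSides_iterate h0 h1 hq']
  refine (dist_le_of_sides (D := C * contr (rescale m) ^ n) (E := C * contr (rescale m) ^ n) h0 h1
    (fst_pos_of_mem (rev_mem h0 h1 (hq' n).1)).le
    (fst_pos_of_mem (rev_mem h0 h1 (hp' n).1)).le ?_ ?_ ?_ ?_).trans (le_of_eq ?_)
  · rw [eq]; exact (oq.config n).w_le_bound a
  · rw [ep]; exact (op.config n).w_le_bound a
  · rw [ep, eq]; exact b2
  · rw [ep, eq]; exact b1
  · ring

theorem F_ofSides (h1 : m < 1) {Q : ℝ × ℝ} (hQ : Q ∈ triangles (rescale m)) (h0 : 0 < m) :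
    F m (ofSides m Q) = third (rescale m) Q ^ 2 / 2 := by
  have hc := rescale_pos h1
  have h := Config.energy hQ
  have hm : 1 - m ≠ 0 := by linarith
  simp only [F, ofSides, alpha]
  apply mul_left_cancel₀ hc.ne'
  have e : rescale m * (third (rescale m) Q ^ 2 / 2) =
      rescale m - rescale m * Q.1 ^ 2 / 2 - (1 - rescale m) * Q.2 ^ 2 / 2 := by linarith
  rw [e]
  simp only [rescale]
  field_simp
  ring

/-- The set of points with a given future is a smooth curve. -/
theorem exists_curve (a : Adm (rescale m) k) (h0 : 0 < m) (h1 : m < 1) (hN : IsWord k (word x)) :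
    ∃ γ : ℝ → ℝ × ℝ, ContinuousOn γ (Icc 0 1) ∧ InjOn γ (Icc 0 1) ∧
      ContDiffOn ℝ 1 γ (Ioo 0 1) ∧
      -- The last inequality says that `mF` decreases along the curve, so that its time reversal has
      -- unstable directions.
      (∀ t ∈ Ioo (0 : ℝ) 1, ∃ d : ℝ × ℝ, HasDerivAt γ d t ∧ 0 < d.1 ∧ 0 < d.2 ∧
        m * (-d.1 / m + alpha m * (2 * (γ t).2 * d.2)) < 0) ∧
      γ '' Ioo 0 1 = futureSet m x ∧
      (γ 0 ∉ phaseSpace m ∧ (γ 0).1 < m * F m (γ 0)) ∧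
      (γ 1 ∉ phaseSpace m ∧ m * F m (γ 1) < (γ 1).1) := by
  have hc := rescale_pos h1
  obtain ⟨α, β, g, hαβ, hα, hg, hF, hl, hr⟩ := exists_graph a hN
  obtain ⟨hgc, s, hsc, hs, hgd⟩ := graph_smooth a hN hα hg
  have hβα : 0 < β - α := by linarith
  set y : ℝ → ℝ := fun t => α + t * (β - α) with hy
  have yIcc : MapsTo y (Icc 0 1) (Icc α β) := fun t ht =>
    ⟨by simp only [hy]; nlinarith [ht.1], by simp only [hy]; nlinarith [ht.2]⟩
  have yIoo : MapsTo y (Ioo 0 1) (Ioo α β) := fun t ht =>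
    ⟨by simp only [hy]; nlinarith [ht.1], by simp only [hy]; nlinarith [ht.2]⟩
  have yc : Continuous y := by simp only [hy]; fun_prop
  have y0 : y 0 = α := by simp [hy]
  have y1 : y 1 = β := by simp [hy]
  have hv0 : ∀ v ∈ Icc α β, 0 ≤ v := fun v hv => hα.trans hv.1
  have hside : ∀ v ∈ Icc α β, toSides m (ofSides m (v, g v)) = (v, g v) :=
    fun v hv => toSides_ofSides h0 h1 (hv0 v hv)
  have hinv : ∀ v ∈ Icc α β, ofSides m (v, g v) ∈ phaseSpace m ↔
      (v, g v) ∈ openTriangles (rescale m) := fun v hv => by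
    rw [mem_phaseSpace_iff h0 h1, hside v hv]
  have hα' : α ∈ Icc α β := ⟨le_rfl, hαβ.le⟩
  have hβ' : β ∈ Icc α β := ⟨hαβ.le, le_rfl⟩
  have hgC : ContDiffOn ℝ 1 g (Ioo α β) := by
    rw [contDiffOn_one_iff_derivWithin isOpen_Ioo.uniqueDiffOn]
    refine ⟨fun v hv => (hgd v hv).differentiableAt.differentiableWithinAt, ?_⟩
    refine ContinuousOn.congr (f := fun v => -(s v * (2 * v))) ?_ fun v hv => ?_
    · exact ((hsc.mono Ioo_subset_Icc_self).mul (by fun_prop)).neg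
    · rw [(hgd v hv).hasDerivWithinAt.derivWithin (isOpen_Ioo.uniqueDiffWithinAt hv)]
  refine ⟨fun t => ofSides m (y t, g (y t)), ?_, ?_, ?_, ?_, ?_, ⟨?_, ?_⟩, ?_, ?_⟩
  · have h2 : ContinuousOn (fun t => g (y t)) (Icc 0 1) := hgc.comp yc.continuousOn yIcc
    simp only [ofSides]
    exact ContinuousOn.prodMk (by fun_prop) (h2.neg.div_const _)
  · intro t ht t' ht' e
    have e' := congrArg (toSides m) e
    simp only at e'
    rw [hside _ (yIcc ht), hside _ (yIcc ht')] at e'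
    have e'' : y t = y t' := congrArg Prod.fst e'
    simp only [hy] at e''
    exact mul_right_cancel₀ hβα.ne' (by linarith)
  · have yC : ContDiff ℝ 1 y := by simp only [hy]; fun_prop
    have h2 : ContDiffOn ℝ 1 (fun t => g (y t)) (Ioo 0 1) := hgC.comp yC.contDiffOn yIoo
    simp only [ofSides]
    exact ContDiffOn.prodMk (ContDiff.contDiffOn (by fun_prop)) (h2.neg.div_const _)
  · intro t ht
    have hyt := yIoo ht
    have hyt' := Ioo_subset_Icc_self hyt
    have hvp : 0 < y t := hα.trans_lt hyt.1
    obtain ⟨s1, s2⟩ := hs _ hyt'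
    have dy : HasDerivAt y (β - α) t := by
      simpa [hy] using ((hasDerivAt_id t).mul_const (β - α)).const_add α
    have dg : HasDerivAt (fun t => g (y t)) (-(s (y t) * (2 * y t)) * (β - α)) t :=
      (hgd _ hyt).comp t dy
    refine ⟨(m * (2 * y t * (β - α)) / 2, s (y t) * (2 * y t) * (β - α) / rescale m), ?_, ?_, ?_, ?_⟩
    · simp only [ofSides]
      refine HasDerivAt.prodMk ?_ ?_
      · simpa using ((dy.pow 2).const_mul m).div_const 2
      · have := dg.neg.div_const (rescale m)
        refine this.congr_deriv ?_
        ring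
    · positivity
    · positivity
    · have e : m * (-(m * (2 * y t * (β - α)) / 2) / m + alpha m * (2 * (-g (y t) / rescale m) *
          (s (y t) * (2 * y t) * (β - α) / rescale m))) =
          -(m * y t * (β - α) * (1 - 2 * ((1 - rescale m) / rescale m) * g (y t) * s (y t))) := by
        have hm : 1 - m ≠ 0 := by linarith
        simp only [alpha, rescale]
        field_simp
        ring
      simp only [ofSides]
      rw [e, neg_lt_zero]
      have : 0 < 1 - 2 * ((1 - rescale m) / rescale m) * g (y t) * s (y t) := by linarith
      positivity
  · ext q
    rw [mem_futureSet_iff a h0 h1 hN]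
    constructor
    · rintro ⟨t, ht, rfl⟩
      have hyt := yIoo ht
      have hyt' := Ioo_subset_Icc_self hyt
      have hQ := hg _ hyt'
      simp only
      rw [hside _ hyt', hinv _ hyt']
      refine ⟨⟨hQ 0, ?_⟩, hQ⟩
      have hK : Config (rescale m) (y t) (third (rescale m) (y t, g (y t))) (g (y t)) := hQ 0
      -- Points of the graph on an edge are extremal in `v`, so only its two ends can lie there.
      have hleft : y t ^ 2 ≠ (third (rescale m) (y t, g (y t)) - g (y t)) ^ 2 := fun e =>
        (leftEdge_le a hN hQ (hg α hα') e).not_gt hyt.1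
      have hright : y t ≠ third (rescale m) (y t, g (y t)) + g (y t) := fun e =>
        (le_rightEdge a hN hQ (hg β hβ') e).not_gt hyt.2
      refine ⟨lt_of_le_of_ne hK.u_le fun e => hleft ?_, lt_of_le_of_ne hK.v_le hright,
        lt_of_le_of_ne hK.w_le fun e => hleft ?_⟩
      · simp only at e
        have : y t = g (y t) - third (rescale m) (y t, g (y t)) := by linarith
        nth_rewrite 1 [this]
        ring
      · simp only at e
        rw [e]
        ring
    · rintro ⟨hq, hqF⟩
      obtain ⟨hI, hgq⟩ := hF _ hqF
      have hqp := (fst_pos_of_mem hq).le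
      have hqe : q = ofSides m ((toSides m q).1, g (toSides m q).1) := by
        rw [← hgq]
        exact (ofSides_toSides h0 h1 hqp).symm
      have hopen := (mem_phaseSpace_iff h0 h1).1 hq
      have hQ : toSides m q = ((toSides m q).1, g (toSides m q).1) := by rw [← hgq]
      have hα1 : α < (toSides m q).1 := by
        refine lt_of_le_of_ne hI.1 fun e => ?_
        rw [hQ, ← e] at hopen
        have h2 : α ^ 2 = (third (rescale m) (α, g α) - g α) ^ 2 := hl.1
        obtain ⟨-, o1, o2, o3⟩ := hopen
        simp only at o1 o2 o3
        exact (sq_lt_sq' (by linarith) (by linarith) :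
          (third (rescale m) (α, g α) - g α) ^ 2 < α ^ 2).ne' h2
      have hβ1 : (toSides m q).1 < β := by
        refine lt_of_le_of_ne hI.2 fun e => ?_
        rw [hQ, e] at hopen
        exact hopen.2.2.1.ne hr
      refine ⟨((toSides m q).1 - α) / (β - α), ⟨div_pos (by linarith) hβα,
        (div_lt_one hβα).2 (by linarith)⟩, ?_⟩
      have : y (((toSides m q).1 - α) / (β - α)) = (toSides m q).1 := by
        simp only [hy]; field_simp; ring
      simp only [this]
      exact hqe.symm
  · simp only [y0]
    rw [hinv α hα']
    rintro ⟨-, o1, o2, o3⟩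
    have h2 : α ^ 2 = (third (rescale m) (α, g α) - g α) ^ 2 := hl.1
    simp only at o1 o2 o3
    exact (sq_lt_sq' (by linarith) (by linarith) :
      (third (rescale m) (α, g α) - g α) ^ 2 < α ^ 2).ne' h2
  · simp only [y0]
    rw [F_ofSides h1 (Q := (α, g α)) (hg α hα' 0) h0]
    have := left_lt_third a hN (hg α hα') hl
    have : α ^ 2 < third (rescale m) (α, g α) ^ 2 := pow_lt_pow_left₀ this hα two_ne_zero
    simp only [ofSides]
    nlinarith
  · simp only [y1]
    rw [hinv β hβ']
    rintro ⟨-, o1, o2, o3⟩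
    exact o2.ne hr
  · simp only [y1]
    rw [F_ofSides h1 (Q := (β, g β)) (hg β hβ' 0) h0]
    have := third_lt_right a hN (hg β hβ') hr
    have : third (rescale m) (β, g β) ^ 2 < β ^ 2 :=
      pow_lt_pow_left₀ this (Real.sqrt_nonneg _) two_ne_zero
    simp only [ofSides]
    nlinarith

theorem mem_frontier_of_curve {γ : ℝ → ℝ × ℝ} {S : Set (ℝ × ℝ)} (hγ : ContinuousOn γ (Icc 0 1))
    (h : γ '' Ioo 0 1 ⊆ S) {t : ℝ} (ht : t ∈ Icc (0 : ℝ) 1) (hS : γ t ∉ S) : γ t ∈ frontier S := by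
  refine ⟨?_, fun hi => hS (interior_subset hi)⟩
  have hcl : closure (Ioo (0 : ℝ) 1) = Icc 0 1 := closure_Ioo zero_ne_one
  rw [← hcl] at hγ ht
  exact closure_mono h (hγ.image_closure (mem_image_of_mem γ ht))

theorem futureSet_subset : futureSet m x ⊆ phaseSpace m := fun _ h => (h 0).1

theorem fullyCrosses_futureSet (a : Adm (rescale m) k) (h0 : 0 < m) (h1 : m < 1)
    (hN : IsWord k (word x)) : FullyCrosses m stableCone (futureSet m x) := by
  obtain ⟨γ, hγ, hi, hC, hd, him, ⟨hl, hl'⟩, hr, hr'⟩ := exists_curve a h0 h1 hN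
  have hsub : γ '' Ioo 0 1 ⊆ phaseSpace m := him.trans_subset futureSet_subset
  refine ⟨futureSet_subset, γ, hγ, hi, hC, fun t ht => ?_, him,
    ⟨mem_frontier_of_curve hγ hsub ⟨le_rfl, zero_le_one⟩ hl, hl'⟩,
    ⟨mem_frontier_of_curve hγ hsub ⟨zero_le_one, le_rfl⟩ hr, hr'⟩⟩
  obtain ⟨d, hd1, hd2, hd3, -⟩ := hd t ht
  rw [hd1.deriv]
  exact mul_pos hd2 hd3

theorem contDiff_rev : ContDiff ℝ 1 (rev m) := by
  unfold rev F
  fun_prop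

/-- The curve is the time reversal of a stable one, run backwards because the reversal exchanges the
two sides of the boundary. -/
theorem fullyCrosses_pastSet (a : Adm (rescale m) k) (h0 : 0 < m) (h1 : m < 1)
    (hN : IsWord k (word (reverse x))) : FullyCrosses m unstableCone (pastSet m x) := by
  obtain ⟨γ, hγ, hi, hC, hd, him, ⟨hl, hl'⟩, hr, hr'⟩ := exists_curve a h0 h1 hN
  have mIcc : MapsTo (fun t : ℝ => 1 - t) (Icc 0 1) (Icc 0 1) :=
    fun t ht => ⟨by linarith [ht.2], by linarith [ht.1]⟩
  have mIoo : MapsTo (fun t : ℝ => 1 - t) (Ioo 0 1) (Ioo 0 1) :=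
    fun t ht => ⟨by linarith [ht.2], by linarith [ht.1]⟩
  have him' : (fun t => rev m (γ (1 - t))) '' Ioo 0 1 = pastSet m x := by
    ext q
    rw [mem_pastSet_iff h0 h1, ← him]
    constructor
    · rintro ⟨t, ht, rfl⟩
      exact ⟨1 - t, mIoo ht, (rev_rev h0).symm⟩
    · rintro ⟨t, ht, e⟩
      refine ⟨1 - t, mIoo ht, ?_⟩
      simp only [sub_sub_cancel]
      rw [e, rev_rev h0]
  have hpast : pastSet m x ⊆ phaseSpace m := fun q hq =>
    (rev_mem_iff h0 h1).1 (futureSet_subset ((mem_pastSet_iff h0 h1).1 hq))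
  have hsub := him'.trans_subset hpast
  have hγ' : ContinuousOn (fun t => rev m (γ (1 - t))) (Icc 0 1) :=
    contDiff_rev.continuous.comp_continuousOn (hγ.comp (by fun_prop) mIcc)
  refine ⟨hpast, fun t => rev m (γ (1 - t)), hγ', ?_, ?_, fun t ht => ?_, him',
    ⟨mem_frontier_of_curve hγ' hsub ⟨le_rfl, zero_le_one⟩ ?_, ?_⟩,
    ⟨mem_frontier_of_curve hγ' hsub ⟨zero_le_one, le_rfl⟩ ?_, ?_⟩⟩
  · intro t ht t' ht' e
    have e' := congrArg (rev m) e
    simp only [rev_rev h0] at e'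
    have := hi (mIcc ht) (mIcc ht') e'
    simp only at this
    linarith
  · exact contDiff_rev.comp_contDiffOn (hC.comp (ContDiff.contDiffOn (by fun_prop)) mIoo)
  · obtain ⟨d, hd1, hd2, hd3, hd4⟩ := hd _ (mIoo ht)
    have dγ : HasDerivAt (fun t => γ (1 - t)) (-d) t := by
      have h' : HasDerivAt (fun t : ℝ => 1 - t) (-1) t := (hasDerivAt_id t).const_sub 1
      exact (HasDerivAt.scomp t hd1 h').congr_deriv (by simp)
    have d1 : HasDerivAt (fun t => (γ (1 - t)).1) (-d.1) t := dγ.fst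
    have d2 : HasDerivAt (fun t => (γ (1 - t)).2) (-d.2) t := dγ.snd
    have d3 : HasDerivAt (fun t => rev m (γ (1 - t)))
        (m * (- -d.1 / m + alpha m * (2 * (γ (1 - t)).2 * -d.2)), -d.2) t := by
      simp only [rev, F]
      refine HasDerivAt.prodMk ?_ d2
      have := (((d1.div_const m).const_sub 1).add ((d2.pow 2).const_mul (alpha m))).const_mul m
      refine this.congr_deriv ?_
      simp only [Nat.cast_ofNat, Nat.add_one_sub_one, pow_one]
      ring
    rw [d3.deriv]
    change m * (- -d.1 / m + alpha m * (2 * (γ (1 - t)).2 * -d.2)) * -d.2 < 0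
    have e : m * (- -d.1 / m + alpha m * (2 * (γ (1 - t)).2 * -d.2)) =
      -(m * (-d.1 / m + alpha m * (2 * (γ (1 - t)).2 * d.2))) := by ring
    rw [e, neg_mul_neg]
    exact mul_neg_of_neg_of_pos hd4 hd3
  · simp only [sub_zero, rev_mem_iff h0 h1]
    exact hr
  · simp only [sub_zero, F_rev h0]
    exact hr'
  · simp only [sub_self, rev_mem_iff h0 h1]
    exact hl
  · simp only [sub_self, F_rev h0]
    exact hl'

end Manifolds

/-! ### Symbolic dynamics -/

section Symbolic

variable {c k : ℝ}

/-- Paths from above to below the stable strips meet the set of points with a given future. -/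
theorem exists_mem_partialFuture (a : Adm c k) (n : ℕ) {N : ℕ → ℝ} (hN : IsWord k N)
    {γ : ℝ → ℝ × ℝ} (hγ : ContinuousOn γ (Icc 0 1))
    (hK : ∀ t ∈ Icc (0 : ℝ) 1, γ t ∈ triangles c) (h0 : γ 0 ∈ aboveStrips c k)
    (h1 : γ 1 ∈ belowStrips c k) : ∃ t ∈ Icc (0 : ℝ) 1, γ t ∈ partialFuture c N n := by
  induction n generalizing N γ with
  | zero =>
    refine ⟨0, ⟨le_rfl, zero_le_one⟩, fun i hi => ?_⟩
    obtain rfl : i = 0 := by omega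
    exact hK 0 ⟨le_rfl, zero_le_one⟩
  | succ n ih =>
    obtain ⟨τ, hτ, hm, hK', h0', h1'⟩ := exists_image_path a hγ hK h0 h1 (hN 0).1 (hN 0).2
    obtain ⟨t, ht, h⟩ := ih hN.shift
      ((continuous_step (N 0)).comp_continuousOn (hγ.comp hτ.continuousOn hm)) hK' h0' h1'
    refine ⟨τ t, hm ht, fun i hi => ?_⟩
    rcases i with _ | i
    · exact hK _ (hm ht)
    · rw [orb_succ]
      exact h i (by omega)

/-- For each `n`, a path of points with the prescribed past of length `n` runs from above to below
the strips and so meets the set with the prescribed future of length `n`. Compactness yields a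
common point for all `n`. -/
theorem exists_two_sided (a : Adm c k) {N N' : ℕ → ℝ} (hN : IsWord k N) (hN' : IsWord k N') :
    ∃ Q ∈ closedFuture c N, reversal c Q ∈ closedFuture c N' := by
  have hcl : ∀ n, IsClosed (partialFuture c N n ∩ reversal c ⁻¹' partialFuture c N' n) := fun n =>
    (isClosed_partialFuture N n).inter ((isClosed_partialFuture N' n).preimage continuous_reversal)
  obtain ⟨Q, hQ⟩ := IsCompact.nonempty_iInter_of_sequence_nonempty_isCompact_isClosed
    (fun n => partialFuture c N n ∩ reversal c ⁻¹' partialFuture c N' n)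
    (fun n => inter_subset_inter (partialFuture_anti N n)
      (preimage_mono (partialFuture_anti N' n)))
    (fun n => by
      obtain ⟨γ, hγ, hK, h0, h1, hF⟩ := exists_path_partialFuture a n hN'
      obtain ⟨t, ht, h⟩ := exists_mem_partialFuture a n hN hγ hK h0 h1
      exact ⟨γ t, h, hF t ht⟩)
    (a.isCompact_triangles.of_isClosed_subset (hcl 0)
      (inter_subset_left.trans (partialFuture_subset N 0))) hcl
  rw [mem_iInter] at hQ
  exact ⟨Q, mem_closedFuture_iff.2 fun n => (hQ n).1, mem_closedFuture_iff.2 fun n => (hQ n).2⟩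

/-- For distinct points a common future gives `Δw Δu > 0`, while a common past, where `w` plays the
role of `v`, gives `Δw Δu < 0`. -/
theorem two_sided_unique (a : Adm c k) {N N' : ℕ → ℝ} (hN : IsWord k N) (hN' : IsWord k N')
    {P Q : ℝ × ℝ} (hP : P ∈ closedFuture c N) (hP' : reversal c P ∈ closedFuture c N')
    (hQ : Q ∈ closedFuture c N) (hQ' : reversal c Q ∈ closedFuture c N') : P = Q := by
  by_contra hne
  have h1 : P.1 ≠ Q.1 ∨ P.2 ≠ Q.2 := by
    by_contra! h
    exact hne (Prod.ext h.1 h.2)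
  have s1 : 0 < (third c P - third c Q) * (P.2 - Q.2) :=
    IsOrbit.stable_cone_succ a hN (closedFuture_isOrbit hP) (closedFuture_isOrbit hQ) h1 0
  have h2 : third c P ≠ third c Q ∨ P.2 ≠ Q.2 := by
    refine Or.inl fun h => ?_
    rw [h, sub_self, zero_mul] at s1
    exact lt_irrefl _ s1
  have s2 : (third c P - third c Q) * (P.2 - Q.2) < 0 :=
    IsOrbit.stable_cone a hN' (closedFuture_isOrbit hP') (closedFuture_isOrbit hQ') h2
  exact s1.not_gt s2

theorem two_sided_mem_open (a : Adm c k) {N N' : ℕ → ℝ} (hN : IsWord k N) (hN' : IsWord k N')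
    {P : ℝ × ℝ} (hP : P ∈ closedFuture c N) (hP' : reversal c P ∈ closedFuture c N') :
    P ∈ openTriangles c :=
  ⟨hP 0, (closedFuture_isOrbit hP).strict_of_two_sided a hN hN' (closedFuture_isOrbit hP') rfl
    (Config.third_eq a.c_pos (Config.symm (hP 0))) rfl⟩

/-- The orbits depend continuously on the initial point and on the word. -/
theorem continuous_orb_word {X : Type*} [TopologicalSpace X] {N : X → ℕ → ℝ}
    (hN : ∀ i, Continuous fun x => N x i) {f : X → ℝ × ℝ} (hf : Continuous f) (i : ℕ) :
    Continuous fun x => orb c (N x) (f x) i := by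
  induction i with
  | zero => exact hf
  | succ i ih =>
    have h1 : Continuous fun x => third c (orb c (N x) (f x) i) := continuous_third.comp ih
    have h2 := hN i
    simp only [orb, step]
    fun_prop

end Symbolic

/-! ### Coding by symbol sequences -/

section Main

variable {m : ℝ} {k : ℕ}

/-- With `c = 2(1 - m)`, the lower bound on `m` is `c(k + 2) ≤ 2` and the upper bound is `1 < ck(k +
1)`. -/
theorem adm_of_mem (hk : 1 ≤ k) (hm : m ∈ Ico ((1 + k : ℝ) / (2 + k))
    ((2 * (k : ℝ) ^ 2 + 2 * k - 1) / (2 * (k : ℝ) ^ 2 + 2 * k))) :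
    0 < m ∧ m < 1 ∧ Adm (rescale m) k := by
  obtain ⟨h1, h2⟩ := hm
  have hk' : (1 : ℝ) ≤ k := by exact_mod_cast hk
  rw [div_le_iff₀ (by positivity)] at h1
  rw [lt_div_iff₀ (by positivity)] at h2
  have hm0 : 0 < m := by
    by_contra hcon
    nlinarith
  have hm1 : m < 1 := by
    by_contra! hcon
    nlinarith
  refine ⟨hm0, hm1, rescale_pos hm1, hk', ?_, ?_⟩
  · unfold rescale; linarith
  · unfold rescale; linarith

/-- The natural numbers underlying a sequence of symbols. -/
def symbols (x : Symb k) (i : ℤ) : ℕ := x i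

theorem isWord_symbols (hk : 1 ≤ k) (x : Symb k) : IsWord k (word (symbols x)) := by
  intro i
  have h := (x (i : ℤ)).2
  have hx : symbols x i = k - 1 ∨ symbols x i = k := h
  unfold word
  rcases hx with h | h
  · rw [h, Nat.cast_sub hk]
    constructor <;> push_cast <;> linarith
  · rw [h]
    constructor <;> linarith

/-- The reversed sequence of symbols. -/
def reverseSymb (x : Symb k) : Symb k := fun i => x (-(i + 1))

theorem isWord_reverse (hk : 1 ≤ k) (x : Symb k) : IsWord k (word (reverse (symbols x))) :=
  isWord_symbols hk (reverseSymb x)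

theorem continuous_word (i : ℕ) : Continuous fun x : Symb k => word (symbols x) i := by
  have h : Continuous fun n : ({k - 1, k} : Set ℕ) => ((n : ℕ) : ℝ) + 1 :=
    continuous_of_discreteTopology
  exact h.comp (continuous_apply (i : ℤ))

theorem continuous_reverse_word (i : ℕ) :
    Continuous fun x : Symb k => word (reverse (symbols x)) i := by
  have h : Continuous fun n : ({k - 1, k} : Set ℕ) => ((n : ℕ) : ℝ) + 1 :=
    continuous_of_discreteTopology
  exact h.comp (continuous_apply (-((i : ℤ) + 1)))

/-- The points with a given itinerary form a continuous family. -/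
theorem exists_continuous_coding {c : ℝ} (a : Adm c k) (hk : 1 ≤ k) :
    ∃ ρ : Symb k → ℝ × ℝ, Continuous ρ ∧ ∀ x, ρ x ∈ closedFuture c (word (symbols x)) ∧
      reversal c (ρ x) ∈ closedFuture c (word (reverse (symbols x))) := by
  choose ρ h1 h2 using fun x : Symb k =>
    exists_two_sided a (isWord_symbols hk x) (isWord_reverse hk x)
  refine ⟨ρ, ?_, fun x => ⟨h1 x, h2 x⟩⟩
  have : CompactSpace (triangles c) := isCompact_iff_compactSpace.1 a.isCompact_triangles
  rw [continuous_iff_isClosed]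
  intro S hS
  -- Closed graph argument: by uniqueness the preimage of `S` is the projection of the closed set
  -- `Γ` along the compact factor `triangles c`.
  set Γ : Set (Symb k × triangles c) := {y |
    (∀ i, orb c (word (symbols y.1)) (y.2 : ℝ × ℝ) i ∈ triangles c) ∧
    (∀ i, orb c (word (reverse (symbols y.1))) (reversal c y.2) i ∈ triangles c) ∧
    (y.2 : ℝ × ℝ) ∈ S} with hΓ
  have hcl : IsClosed Γ := by
    have e : Γ = (⋂ i, (fun y : Symb k × triangles c =>
          orb c (word (symbols y.1)) (y.2 : ℝ × ℝ) i) ⁻¹' triangles c) ∩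
        ((⋂ i, (fun y : Symb k × triangles c =>
          orb c (word (reverse (symbols y.1))) (reversal c y.2) i) ⁻¹' triangles c) ∩
        (fun y : Symb k × triangles c => (y.2 : ℝ × ℝ)) ⁻¹' S) := by
      ext y
      simp [hΓ]
    have hv : Continuous fun y : Symb k × triangles c => (y.2 : ℝ × ℝ) :=
      continuous_subtype_val.comp continuous_snd
    rw [e]
    refine (isClosed_iInter fun i => isClosed_triangles.preimage ?_).inter
      ((isClosed_iInter fun i => isClosed_triangles.preimage ?_).inter (hS.preimage hv))
    · exact continuous_orb_word (fun i => (continuous_word i).comp continuous_fst) hv i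
    · exact continuous_orb_word (fun i => (continuous_reverse_word i).comp continuous_fst)
        (continuous_reversal.comp hv) i
  have himg : ρ ⁻¹' S = Prod.fst '' Γ := by
    ext x
    constructor
    · exact fun hx => ⟨(x, ⟨ρ x, h1 x 0⟩), ⟨h1 x, h2 x, hx⟩, rfl⟩
    · rintro ⟨⟨x, Q⟩, ⟨e1, e2, e3⟩, rfl⟩
      have := two_sided_unique a (isWord_symbols hk x) (isWord_reverse hk x) (h1 x) (h2 x) e1 e2
      change ρ x ∈ S
      rw [this]
      exact e3
  rw [himg]
  exact isClosedMap_fst_of_compactSpace _ hcl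

theorem futureSet_symbol_unique {p : ℝ × ℝ} {x y : ℤ → ℕ} (hx : p ∈ futureSet m x)
    (hy : p ∈ futureSet m y) (i : ℕ) : x i = y i := by
  rw [← bumps_eq (hx i), bumps_eq (hy i)]

theorem hasItinerary_unique {p : ℝ × ℝ} (h0 : 0 < m) (h1 : m < 1) {x y : ℤ → ℕ}
    (hx : HasItinerary m p x) (hy : HasItinerary m p y) : x = y := by
  rw [hasItinerary_iff h0 h1] at hx hy
  funext i
  rcases i with n | n
  · exact futureSet_symbol_unique hx.1 hy.1 n
  · exact futureSet_symbol_unique hx.2 hy.2 n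

theorem HasItinerary.shift {p : ℝ × ℝ} {x : ℤ → ℕ} (h : HasItinerary m p x) :
    HasItinerary m (T m p) fun i => x (i + 1) := by
  obtain ⟨o, ho, h⟩ := h
  refine ⟨fun i => o (i + 1), ?_, fun i => h (i + 1)⟩
  rw [← ho, (h 0).2]

end Main

end FallingBalls

/-! ### The full shift -/

open FallingBalls in
theorem mainTheorem6 (k : ℕ) (hk : 1 ≤ k) (m : ℝ)
    (hm : m ∈ Set.Ico ((1 + k : ℝ) / (2 + k))
      ((2 * (k : ℝ) ^ 2 + 2 * k - 1) / (2 * (k : ℝ) ^ 2 + 2 * k))) :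
    ∃ π : FallingBalls.Symb k → ℝ × ℝ,
      (∀ x, π x ∈ FallingBalls.phaseSpace m ∧
        FallingBalls.HasItinerary m (π x) (fun i => (x i : ℕ)) ∧
        (∀ Q, FallingBalls.HasItinerary m Q (fun i => (x i : ℕ)) → Q = π x) ∧
        FallingBalls.IsCrossingStableManifold m (π x)
          (FallingBalls.futureSet m (fun i => (x i : ℕ))) ∧
        FallingBalls.IsCrossingUnstableManifold m (π x)
          (FallingBalls.pastSet m (fun i => (x i : ℕ)))) ∧
      Topology.IsEmbedding π ∧
      (∀ x, FallingBalls.T m (π x) = π (FallingBalls.shift x)) := by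
  obtain ⟨h0, h1, a⟩ := adm_of_mem hk hm
  obtain ⟨ρ, hρ, hmem⟩ := exists_continuous_coding a hk
  have hside : ∀ x, toSides m (ofSides m (ρ x)) = ρ x := fun x =>
    toSides_ofSides h0 h1 (Config.v_nonneg ((hmem x).1 0))
  have hphase : ∀ x, ofSides m (ρ x) ∈ phaseSpace m := fun x => by
    rw [mem_phaseSpace_iff h0 h1, hside]
    exact two_sided_mem_open a (isWord_symbols hk x) (isWord_reverse hk x) (hmem x).1 (hmem x).2
  have hfut : ∀ x, ofSides m (ρ x) ∈ futureSet m (symbols x) := fun x => by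
    rw [mem_futureSet_iff a h0 h1 (isWord_symbols hk x), hside]
    exact ⟨hphase x, (hmem x).1⟩
  have hpast : ∀ x, rev m (ofSides m (ρ x)) ∈ futureSet m (reverse (symbols x)) := fun x => by
    rw [mem_futureSet_iff a h0 h1 (isWord_reverse hk x),
      toSides_rev h0 h1 (fst_pos_of_mem (hphase x)).le, hside]
    exact ⟨rev_mem h0 h1 (hphase x), (hmem x).2⟩
  have hit : ∀ x, HasItinerary m (ofSides m (ρ x)) (symbols x) := fun x =>
    (hasItinerary_iff h0 h1).2 ⟨hfut x, hpast x⟩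
  have huniq : ∀ x Q, HasItinerary m Q (symbols x) → Q = ofSides m (ρ x) := by
    intro x Q hQ
    obtain ⟨q1, q2⟩ := (hasItinerary_iff h0 h1).1 hQ
    rw [mem_futureSet_iff a h0 h1 (isWord_symbols hk x)] at q1
    rw [mem_futureSet_iff a h0 h1 (isWord_reverse hk x),
      toSides_rev h0 h1 (fst_pos_of_mem q1.1).le] at q2
    rw [← ofSides_toSides h0 h1 (fst_pos_of_mem q1.1).le, two_sided_unique a (isWord_symbols hk x)
      (isWord_reverse hk x) q1.2 q2.2 (hmem x).1 (hmem x).2]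
  refine ⟨fun x => ofSides m (ρ x), fun x => ⟨hphase x, hit x, huniq x, ⟨?_, ?_⟩, ?_, ?_⟩, ?_,
    fun x => ?_⟩
  · exact forwardAsymptotic a h0 h1 (isWord_symbols hk x) (hfut x)
  · exact fullyCrosses_futureSet a h0 h1 (isWord_symbols hk x)
  · exact backwardAsymptotic a h0 h1 (isWord_reverse hk x) ((mem_pastSet_iff h0 h1).2 (hpast x))
  · exact fullyCrosses_pastSet a h0 h1 (isWord_reverse hk x)
  · have hcont : Continuous fun x => ofSides m (ρ x) := by
      unfold ofSides
      fun_prop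
    -- The sequence space is compact, so a continuous injection suffices; injectivity holds because
    -- a point determines its itinerary.
    refine (hcont.isClosedEmbedding fun x y e => ?_).isEmbedding
    have hx := hit x
    rw [show ofSides m (ρ x) = ofSides m (ρ y) from e] at hx
    have := hasItinerary_unique h0 h1 hx (hit y)
    funext i
    exact Subtype.ext (congrFun this i)
  · exact huniq (shift x) _ (hit x).shift
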